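/- Let $n\ge 2$ and let $\mathbf p=(p_1,\dots,p_n)$ satisfy $$1<p_i<\bar p\Big(1+\frac2n\Big)\quad(i=1,\dots,n),\qquad \bar p<n,\qquad \bar p\le\frac{2n}{n+2},\qquad\text{where } \bar p:=\Big(\frac1n\sum_{i=1}^n\frac1{p_i}\Big)^{-1}.$$ Put $P:=\max\{2,p_1,\dots,p_n\}$ and fix a real number $m>\frac{n}{\bar p}(2-\bar p)$. Let $\Omega\subset\mathbb R^n$ be a bounded domain, $T\in(0,\infty)$, $\Omega_T:=\Omega\times(0,T)$ and $\delta_1,\dots,\delta_n\ge0$. For $\rho>0$ let $$K_\rho(x_0):=\prod_{i=1}^n\big(x_{0,i}-\rho^{1/p_i},\,x_{0,i}+\rho^{1/p_i}\big),\qquad Q_\rho(x_0,t_0):=K_\rho(x_0)\times(t_0-\rho,t_0).$$ Let $L^{\mathbf p}_{loc}(0,T;W^{1,\mathbf p}_{loc}(\Omega))$ be the set of all $v\in L^1_{loc}(0,T;W^{1,1}_{loc}(\Omega))$ with $\partial_{x_i}v\in L^{p_i}_{loc}(\Omega_T)$ for every $i$. For $\mathcal C>0$, the class $\mathcal{DG}(\mathbf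 p,\{\delta_i\},\Omega_T,\mathcal C)$ consists of all $u\in L^{\mathbf p}_{loc}(0,T;W^{1,\mathbf p}_{loc}(\Omega))\cap L^P_{loc}(\Omega_T)$ such that, for every cylinder $Q_\rho(x_0,t_0)\Subset\Omega_T$, every $k\in\mathbb R$ and every cut-off function $\zeta$ as below, $$\operatorname*{ess\,sup}_{t_0-\rho<\tau<t_0}\int_{K_\rho(x_0)}(u-k)_\pm^2\,\zeta(x,\tau)\,dx+\sum_{i=1}^n\iint_{Q_\rho(x_0,t_0)}(|\partial_{x_i}u|-\delta_i)_+^{p_i}\,\zeta\,\mathbf 1_{\{\pm(u-k)>0\}}\,dx\,dt$$ $$\le\ \mathcal C\iint_{Q_\rho(x_0,t_0)}(u-k)_\pm^2\,\partial_t\zeta\,dx\,dt+\mathcal C\sum_{i=1}^n\iint_{Q_\rho(x_0,t_0)}(u-k)_\pm^{p_i}\,\big|\partial_{x_i}\zeta^{1/p_i}\big|^{p_i}\,dx\,dt$$ for both choices of the sign. The cut-off functions are the $\zeta\in C^\infty(\mathbb R^{n+1})$ of the form $\zeta(x,t)=\psi(t)\prod_{i}\zeta_i(x_i)^{p_i}$,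 where $\psi\in C^\infty(\mathbb R;[0,1])$ is non-decreasing with $\psi=0$ on $(-\infty,t_0-\rho+\frac\epsilon2]$ and $\psi=1$ on $[t_0-\rho+\epsilon,\infty)$ for some $\epsilon\in(0,\rho)$, and $\zeta_i\in C_0^\infty(\mathbb R;[0,1])$ with $\operatorname{supp}\zeta_i\subset(x_{0,i}-\rho^{1/p_i},x_{0,i}+\rho^{1/p_i})$. (1) Let $u\in\mathcal{DG}(\mathbf p,\{\delta_i\},\Omega_T,\mathcal C)$ and $u\in L^m_{loc}(\Omega_T)$. Then $u\in L^\infty_{loc}(\Omega_T)$ and, for every cylinder $Q_{2\rho}(x_0,t_0)\Subset\Omega_T$, $$\operatorname*{ess\,sup}_{Q_\rho(x_0,t_0)}|u|\ \le\ C\left[\left(\frac1{|Q_{2\rho}(x_0,t_0)|}\iint_{Q_{2\rho}(x_0,t_0)}|u|^m\,dx\,dt\right)^{\frac1{m-\frac n{\bar p}(2-\bar p)}}+1+\sqrt\rho\,\right],\qquad(*)$$ where $C>0$ depends only on $n$, $\mathcal C$, $\mathbf p$, $m$ and $\max_i\delta_i$. (2) In particular, let $\Lambda\ge1$, let $a_1,\dots,a_n$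 be measurable with $\Lambda^{-1}\le a_i\le\Lambda$ a.e. in $\Omega_T$, and let $u\in L^m_{loc}(\Omega_T)$ be a local weak solution of $$\partial_tu=\sum_{i=1}^n\partial_{x_i}\Big[a_i(x,t)\,(|\partial_{x_i}u|-\delta_i)_+^{p_i-1}\frac{\partial_{x_i}u}{|\partial_{x_i}u|}\Big]\quad\text{in }\Omega_T,$$ that is, $u\in L^{\mathbf p}_{loc}(0,T;W^{1,\mathbf p}_{loc}(\Omega))\cap L^P_{loc}(\Omega_T)$ and, for all $\varphi\in C_0^\infty(\Omega_T)$, $$\iint_{\Omega_T}\Big(u\,\partial_t\varphi-\sum_{i=1}^na_i\,(|\partial_{x_i}u|-\delta_i)_+^{p_i-1}\frac{\partial_{x_i}u}{|\partial_{x_i}u|}\,\partial_{x_i}\varphi\Big)\,dx\,dt=0 .$$ Then $u\in L^\infty_{loc}(\Omega_T)$ and $(*)$ holds with a constant $C>0$ depending only on $n$, $\Lambda$, $\mathbf p$, $m$ and $\max_i\delta_i$. -/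

import Mathlib

open MeasureTheory Set
open scoped ContDiff ENNReal

/-! Points of `ℝⁿ` are functions `Fin n → ℝ` and points of space-time `ℝⁿ⁺¹` are pairs `(x, t)`.
Only the topology, the bounded sets, the smooth functions and the Lebesgue measure of `ℝⁿ` are used
below, and these do not depend on the choice between the sup norm and the Euclidean norm. -/

noncomputable section

namespace AnisoDiff

variable {n : ℕ}

/-- The harmonic average `p̄ = ((1/n) ∑ 1/pᵢ)⁻¹` of the exponents. -/
def harmonicAvg (p : Fin n → ℝ) : ℝ := ((1 / (n : ℝ)) * ∑ i, 1 / p i)⁻¹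

/-- `P = max {2, p₁, …, pₙ}`. -/
def bigP (p : Fin n → ℝ) : ℝ := max 2 (⨆ i, p i)

/-- The hyper-rectangle `K_ρ(x₀) = ∏ᵢ (x₀ᵢ - ρ^(1/pᵢ), x₀ᵢ + ρ^(1/pᵢ))`. -/
def box (p : Fin n → ℝ) (x₀ : Fin n → ℝ) (ρ : ℝ) : Set (Fin n → ℝ) :=
  Set.univ.pi fun i => Ioo (x₀ i - ρ ^ (1 / p i)) (x₀ i + ρ ^ (1 / p i))

/-- The cylinder `Q_ρ(x₀, t₀) = K_ρ(x₀) × (t₀ - ρ, t₀)`. -/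
def cyl (p : Fin n → ℝ) (x₀ : Fin n → ℝ) (t₀ ρ : ℝ) : Set ((Fin n → ℝ) × ℝ) :=
  box p x₀ ρ ×ˢ Ioo (t₀ - ρ) t₀

/-- The space-time domain `Ω_T = Ω × (0, T)`. -/
def spaceTime (Ω : Set (Fin n → ℝ)) (T : ℝ) : Set ((Fin n → ℝ) × ℝ) := Ω ×ˢ Ioo 0 T

/-- The classical partial derivative `∂f/∂xᵢ` at `x`. -/
def partialDeriv (i : Fin n) (f : (Fin n → ℝ) → ℝ) (x : Fin n → ℝ) : ℝ :=
  deriv (fun s => f (Function.update x i s)) (x i)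

/-- The classical partial derivative `∂f/∂xᵢ` of a function of `(x, t)`. -/
def spaceDeriv (i : Fin n) (f : (Fin n → ℝ) × ℝ → ℝ) (z : (Fin n → ℝ) × ℝ) : ℝ :=
  partialDeriv i (fun x => f (x, z.2)) z.1

/-- The classical derivative `∂f/∂t` of a function of `(x, t)`. -/
def timeDeriv (f : (Fin n → ℝ) × ℝ → ℝ) (z : (Fin n → ℝ) × ℝ) : ℝ :=
  deriv (fun s => f (z.1, s)) z.2

/-- `f ∈ L^q_loc(U)`: `f` is in `L^q` of every compact subset of `U`. -/
def MemLpLoc {α : Type*} [TopologicalSpace α] [MeasureSpace α] (f : α → ℝ) (q : ℝ≥0∞)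
    (U : Set α) : Prop :=
  ∀ K : Set α, IsCompact K → K ⊆ U → MemLp f q (volume.restrict K)

/-- `φ ∈ C₀^∞(U)`. -/
def IsTestFunction {E : Type*} [NormedAddCommGroup E] [NormedSpace ℝ E] (U : Set E)
    (φ : E → ℝ) : Prop :=
  ContDiff ℝ ∞ φ ∧ HasCompactSupport φ ∧ tsupport φ ⊆ U

/-- `g` is the weak partial derivative `∂f/∂xᵢ` in the open set `Ω`
(both functions being in `L¹_loc(Ω)`). -/
def HasWeakPartialDeriv (Ω : Set (Fin n → ℝ)) (i : Fin n) (f g : (Fin n → ℝ) → ℝ) : Prop :=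
  MemLpLoc f 1 Ω ∧ MemLpLoc g 1 Ω ∧
    ∀ φ : (Fin n → ℝ) → ℝ, IsTestFunction Ω φ →
      ∫ x in Ω, f x * partialDeriv i φ x = - ∫ x in Ω, g x * φ x

/-- `u ∈ L^𝐩_loc(0, T; W^{1,𝐩}_loc(Ω))`, with weak spatial gradient `Du = (∂₁u, …, ∂ₙu)`:
`u` is in `L¹_loc(Ω_T)`, `∂ᵢu` is in `L^{pᵢ}_loc(Ω_T)`, and for almost every time `t` the function
`∂ᵢu(·, t)` is the weak partial derivative of `u(·, t)` in `Ω`. -/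
def MemSobolevLoc (p : Fin n → ℝ) (Ω : Set (Fin n → ℝ)) (T : ℝ)
    (u : (Fin n → ℝ) × ℝ → ℝ) (Du : Fin n → (Fin n → ℝ) × ℝ → ℝ) : Prop :=
  MemLpLoc u 1 (spaceTime Ω T) ∧
  ∀ i, MemLpLoc (Du i) (ENNReal.ofReal (p i)) (spaceTime Ω T) ∧
    ∀ᵐ t ∂(volume.restrict (Ioo 0 T)),
      HasWeakPartialDeriv Ω i (fun x => u (x, t)) (fun x => Du i (x, t))

/-! ### The equation -/

/-- The energy density `F(x, t, ξ) = ∑ᵢ (aᵢ(x,t) / pᵢ) (|ξᵢ| - δᵢ)₊^{pᵢ}`. -/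
def energyDensity (p δ : Fin n → ℝ) (a : Fin n → (Fin n → ℝ) × ℝ → ℝ)
    (z : (Fin n → ℝ) × ℝ) (ξ : Fin n → ℝ) : ℝ :=
  ∑ i, a i z / p i * max (|ξ i| - δ i) 0 ^ p i

/-- The `i`-th component `aᵢ(x,t) (|ξᵢ| - δᵢ)₊^{pᵢ-1} ξᵢ/|ξᵢ|` of the gradient `D_ξ F(x, t, ξ)`
(see `partialDeriv_energyDensity`; it vanishes if `ξᵢ = 0`). -/
def flux (p δ : Fin n → ℝ) (a : Fin n → (Fin n → ℝ) × ℝ → ℝ)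
    (z : (Fin n → ℝ) × ℝ) (ξ : Fin n → ℝ) (i : Fin n) : ℝ :=
  a i z * max (|ξ i| - δ i) 0 ^ (p i - 1) * (ξ i / |ξ i|)

theorem hasDerivAt_posPart_rpow {p : ℝ} (hp : 1 < p) (s : ℝ) :
    HasDerivAt (fun s : ℝ => max s 0 ^ p) (p * max s 0 ^ (p - 1)) s := by
  rcases lt_trichotomy s 0 with hs | hs | hs
  · have h : (fun s : ℝ => max s 0 ^ p) =ᶠ[nhds s] fun _ => (0 : ℝ) := by
      filter_upwards [Iio_mem_nhds hs] with y hy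
      rw [max_eq_right (le_of_lt hy), Real.zero_rpow (by linarith)]
    rw [max_eq_right hs.le, Real.zero_rpow (by linarith), mul_zero]
    exact (hasDerivAt_const s (0 : ℝ)).congr_of_eventuallyEq h
  · subst hs
    rw [max_self, Real.zero_rpow (by linarith), mul_zero]
    have h := (Real.hasDerivAt_rpow_const (x := 0) (p := p) (Or.inr hp.le))
    rw [Real.zero_rpow (by linarith), mul_zero] at h
    rw [hasDerivAt_iff_isLittleO] at h ⊢
    refine Asymptotics.IsLittleO.of_norm_left ?_
    refine Asymptotics.IsBigO.trans_isLittleO ?_ h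
    refine Asymptotics.IsBigO.of_bound 1 (Filter.Eventually.of_forall fun y => ?_)
    simp only [max_self, Real.zero_rpow (show p ≠ 0 by linarith), sub_zero, smul_zero, one_mul,
      norm_norm]
    rcases le_total y 0 with hy | hy
    · rw [max_eq_right hy, Real.zero_rpow (by linarith)]; simp
    · rw [max_eq_left hy]
  · have h : (fun s : ℝ => max s 0 ^ p) =ᶠ[nhds s] fun s => s ^ p := by
      filter_upwards [Ioi_mem_nhds hs] with y hy
      rw [max_eq_left (le_of_lt hy)]
    rw [max_eq_left hs.le]
    exact (Real.hasDerivAt_rpow_const (Or.inr hp.le)).congr_of_eventuallyEq h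

theorem hasDerivAt_abs_sub_posPart_rpow {p d : ℝ} (hp : 1 < p) (hd : 0 ≤ d) (s : ℝ) :
    HasDerivAt (fun s : ℝ => max (|s| - d) 0 ^ p)
      (p * max (|s| - d) 0 ^ (p - 1) * (s / |s|)) s := by
  rcases lt_trichotomy s 0 with hs | hs | hs
  · have h := (hasDerivAt_posPart_rpow hp (|s| - d)).comp s ((hasDerivAt_abs_neg hs).sub_const d)
    rwa [show s / |s| = -1 by rw [abs_of_neg hs, div_neg, div_self hs.ne]]
  · subst hs
    have h1 := (hasDerivAt_posPart_rpow hp (0 - d)).comp (0 : ℝ) ((hasDerivAt_id (0 : ℝ)).sub_const d)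
    have h2 := (hasDerivAt_posPart_rpow hp (0 - d)).comp_of_eq (0 : ℝ)
      (((hasDerivAt_id (0 : ℝ)).neg).sub_const d) (by simp)
    have h3 := h1.add h2
    have e0 : max (0 - d) 0 = 0 := max_eq_right (by linarith)
    rw [e0, Real.zero_rpow (by linarith)] at h3
    simp only [abs_zero, div_zero, mul_zero]
    refine (h3.congr_deriv (by simp)).congr_of_eventuallyEq (Filter.Eventually.of_forall fun y => ?_)
    have hp0 : p ≠ 0 := by linarith
    rcases le_total y 0 with hy | hy
    · have : max (y - d) 0 = 0 := max_eq_right (by linarith)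
      simp [this, Real.zero_rpow hp0, abs_of_nonpos hy]
    · have : max (-y - d) 0 = 0 := max_eq_right (by linarith)
      simp [this, Real.zero_rpow hp0, abs_of_nonneg hy]
  · have h := (hasDerivAt_posPart_rpow hp (|s| - d)).comp s ((hasDerivAt_abs_pos hs).sub_const d)
    rwa [show s / |s| = 1 by rw [abs_of_pos hs, div_self hs.ne']]

/-- `flux` is the gradient of `energyDensity` in `ξ`. -/
theorem partialDeriv_energyDensity {p δ : Fin n → ℝ} (hp : ∀ i, 1 < p i) (hδ : ∀ i, 0 ≤ δ i)
    (a : Fin n → (Fin n → ℝ) × ℝ → ℝ) (z : (Fin n → ℝ) × ℝ) (ξ : Fin n → ℝ) (i : Fin n) :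
    partialDeriv i (energyDensity p δ a z) ξ = flux p δ a z ξ i := by
  have hi : p i ≠ 0 := by linarith [hp i]
  have key : ∀ j ∈ Finset.univ, HasDerivAt
      (fun s => a j z / p j * max (|Function.update ξ i s j| - δ j) 0 ^ p j)
      (if j = i then flux p δ a z ξ i else 0) (ξ i) := by
    intro j _
    by_cases hj : j = i
    · subst hj
      simp only [Function.update_self, if_true]
      refine ((hasDerivAt_abs_sub_posPart_rpow (hp j) (hδ j) (ξ j)).const_mul _).congr_deriv ?_
      unfold flux
      field_simp
    · simp only [Function.update_of_ne hj, if_neg hj]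
      exact hasDerivAt_const _ _
  have h := (HasDerivAt.fun_sum key).deriv
  simpa [partialDeriv, energyDensity] using h

/-- `u` is a local weak solution in `Ω_T` of
`∂ₜu = ∑ᵢ ∂ᵢ [aᵢ(x,t) (|∂ᵢu| - δᵢ)₊^{pᵢ-1} ∂ᵢu/|∂ᵢu|]`. -/
def IsLocalWeakSolution (p δ : Fin n → ℝ) (a : Fin n → (Fin n → ℝ) × ℝ → ℝ)
    (Ω : Set (Fin n → ℝ)) (T : ℝ) (u : (Fin n → ℝ) × ℝ → ℝ) : Prop :=
  MemLpLoc u (ENNReal.ofReal (bigP p)) (spaceTime Ω T) ∧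
  ∃ Du : Fin n → (Fin n → ℝ) × ℝ → ℝ, MemSobolevLoc p Ω T u Du ∧
    ∀ φ : (Fin n → ℝ) × ℝ → ℝ, IsTestFunction (spaceTime Ω T) φ →
      ∫ z in spaceTime Ω T,
        (u z * timeDeriv φ z - ∑ i, flux p δ a z (fun j => Du j z) i * spaceDeriv i φ z) = 0

/-! ### De Giorgi classes -/

/-- The smooth cut-off functions `ζ(x,t) = ψ(t) ∏ᵢ ζᵢ(xᵢ)^{pᵢ}` of the cylinder `Q_ρ(x₀, t₀)`. -/
def IsCutoff (p : Fin n → ℝ) (x₀ : Fin n → ℝ) (t₀ ρ : ℝ) (ζ : (Fin n → ℝ) × ℝ → ℝ) : Prop :=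
  ContDiff ℝ ∞ ζ ∧
  ∃ (ε : ℝ) (ψ : ℝ → ℝ) (η : Fin n → ℝ → ℝ),
    0 < ε ∧ ε < ρ ∧
    ContDiff ℝ ∞ ψ ∧ (∀ t, ψ t ∈ Icc (0 : ℝ) 1) ∧ Monotone ψ ∧
    (∀ t ≤ t₀ - ρ + ε / 2, ψ t = 0) ∧ (∀ t, t₀ - ρ + ε ≤ t → ψ t = 1) ∧
    (∀ i, ContDiff ℝ ∞ (η i) ∧ (∀ s, η i s ∈ Icc (0 : ℝ) 1) ∧ HasCompactSupport (η i) ∧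
      tsupport (η i) ⊆ Ioo (x₀ i - ρ ^ (1 / p i)) (x₀ i + ρ ^ (1 / p i))) ∧
    ∀ x t, ζ (x, t) = ψ t * ∏ i, η i (x i) ^ p i

/-- The energy inequality on `Q_ρ(x₀, t₀)` with cut-off function `ζ`,
```
ess sup_{t₀-ρ<τ<t₀} ∫_{K_ρ(x₀)} w² ζ(x,τ) dx + ∑ᵢ ∬_{Q_ρ(x₀,t₀)} (|∂ᵢu| - δᵢ)₊^{pᵢ} ζ 1_S dx dt
  ≤ 𝒞 ∬_{Q_ρ(x₀,t₀)} w² ∂ₜζ dx dt + 𝒞 ∑ᵢ ∬_{Q_ρ(x₀,t₀)} w^{pᵢ} |∂ᵢ ζ^{1/pᵢ}|^{pᵢ} dx dt,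
```
to be used for `w = (u-k)₊`, `S = {u > k}` and for `w = (u-k)₋`, `S = {u < k}`.
All integrands are nonnegative, and the integrals are taken in `[0, ∞]`. -/
def EnergyInequality (p δ : Fin n → ℝ) (𝒞 : ℝ) (x₀ : Fin n → ℝ) (t₀ ρ : ℝ)
    (ζ : (Fin n → ℝ) × ℝ → ℝ) (Du : Fin n → (Fin n → ℝ) × ℝ → ℝ)
    (w : (Fin n → ℝ) × ℝ → ℝ) (S : Set ((Fin n → ℝ) × ℝ)) : Prop :=
  essSup (fun τ : ℝ => ∫⁻ x in box p x₀ ρ, ENNReal.ofReal (w (x, τ) ^ 2 * ζ (x, τ)))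
      (volume.restrict (Ioo (t₀ - ρ) t₀)) +
    ∑ i, ∫⁻ z in cyl p x₀ t₀ ρ,
      ENNReal.ofReal (max (|Du i z| - δ i) 0 ^ p i * ζ z * S.indicator 1 z)
  ≤ ENNReal.ofReal 𝒞 * (∫⁻ z in cyl p x₀ t₀ ρ, ENNReal.ofReal (w z ^ 2 * timeDeriv ζ z)) +
    ENNReal.ofReal 𝒞 * ∑ i, ∫⁻ z in cyl p x₀ t₀ ρ,
      ENNReal.ofReal (w z ^ p i * |spaceDeriv i (fun y => ζ y ^ (1 / p i)) z| ^ p i)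

/-- The De Giorgi class `𝒟𝒢(𝐩, {δᵢ}, Ω_T, 𝒞)`: the functions
`u ∈ L^𝐩_loc(0, T; W^{1,𝐩}_loc(Ω)) ∩ L^P_loc(Ω_T)` that satisfy the energy inequalities for
`(u-k)₊` and for `(u-k)₋`, for all levels `k ∈ ℝ`, all cylinders `Q_ρ(x₀, t₀) ⋐ Ω_T` and all
cut-off functions `ζ`. -/
def DeGiorgiClass (p δ : Fin n → ℝ) (Ω : Set (Fin n → ℝ)) (T 𝒞 : ℝ)
    (u : (Fin n → ℝ) × ℝ → ℝ) : Prop :=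
  MemLpLoc u (ENNReal.ofReal (bigP p)) (spaceTime Ω T) ∧
  ∃ Du : Fin n → (Fin n → ℝ) × ℝ → ℝ, MemSobolevLoc p Ω T u Du ∧
    ∀ (x₀ : Fin n → ℝ) (t₀ ρ : ℝ), 0 < ρ → closure (cyl p x₀ t₀ ρ) ⊆ spaceTime Ω T →
      ∀ ζ, IsCutoff p x₀ t₀ ρ ζ → ∀ k : ℝ,
        EnergyInequality p δ 𝒞 x₀ t₀ ρ ζ Du (fun z => max (u z - k) 0) {z | k < u z} ∧
        EnergyInequality p δ 𝒞 x₀ t₀ ρ ζ Du (fun z => max (k - u z) 0) {z | u z < k}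

/-- The bound
`ess sup_{Q_ρ} |u| ≤ C [(⨍_{Q_{2ρ}} |u|^m dx dt)^{1 / (m - (n/p̄)(2 - p̄))} + 1 + √ρ]`
for every cylinder with `Q_{2ρ}(x₀, t₀) ⋐ Ω_T`. -/
def SupBound (p : Fin n → ℝ) (m C : ℝ) (Ω : Set (Fin n → ℝ)) (T : ℝ)
    (u : (Fin n → ℝ) × ℝ → ℝ) : Prop :=
  ∀ (x₀ : Fin n → ℝ) (t₀ ρ : ℝ), 0 < ρ → closure (cyl p x₀ t₀ (2 * ρ)) ⊆ spaceTime Ω T →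
    essSup (fun z => ENNReal.ofReal |u z|) (volume.restrict (cyl p x₀ t₀ ρ)) ≤
      ENNReal.ofReal (C * ((⨍ z in cyl p x₀ t₀ (2 * ρ), |u z| ^ m) ^
        (1 / (m - (n : ℝ) / harmonicAvg p * (2 - harmonicAvg p))) + 1 + √ρ))

end AnisoDiff

end

/-! The proof is De Giorgi's iteration in the anisotropic subcritical range. Write P for the
harmonic average of the exponents and q = P(1 + 2/n). The hypothesis P ≤ 2n/(n+2) says q ≤ 2, and
since p_i < q all exponents lie below 2.

Boundedness. Let Y_j be the integral of (u - k_j)₊² over the j-th of a sequence of cylinders that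
shrink from Q_{2ρ} towards Q_ρ, with levels k_j = k(2 - 2⁻ʲ) rising from k towards 2k. The energy
inequality controls the L^∞(L²) norm and the gradient of a truncation by Y_j, at the price of
inverse powers of the gap between levels. Troisi's anisotropic Sobolev inequality, applied on time
slices (`exists_parabolic_embedding`), turns this into a bound of the L^q norm to the power q by
Y_j^{1 + P/n} (`exists_embedding_step`). As q ≤ 2, this does not control the L² norm; the assumed
L^m integrability is used to interpolate, 2 = qθ + m(1 - θ) (`exists_iteration_step`). The outcome
is Y_{j+1} ≤ B b^j Y_j^{1+ε} with 1 + ε = (1 + P/n)θ, and ε(m - q) = (P/n)μ for μ = m - (n/P)(2 -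
P). So the recursion is superlinear exactly when m exceeds the threshold of the theorem. Then Y_j
tends to 0 as soon as Y_0 is small enough, that is, for k large, and u ≤ 2k on Q_ρ. Solving the
smallness condition for k gives the exponent 1/μ (`exists_ae_le`). The same bound for -u completes
part (1).

Solutions. For part (2) it suffices that a solution lies in a De Giorgi class whose constant depends
only on Λ and p (`IsLocalWeakSolution.deGiorgiClass`). Formally the equation is tested with (u - k)₊
ζ θ, θ being a decreasing cut-off in time. As u need not have a time derivative, the equation, which
is linear in the pair (u, flux), is mollified in space-time; the chain rule is classical for the
mollified functions, and every term converges by strong L^p convergence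
(`integral_softSq_mul_fderiv`). Bounded truncations are used first and removed by dominated
convergence (`integral_posPart_sq_mul_fderiv`). Coercivity of the flux and Young's inequality absorb
half of the gradient term. The derivative of θ is a mollification kernel, so the time term is a
mollification of t ↦ ∫ (u - k)₊² ζ dx, and its limit at almost every t is the essential supremum
bound. -/

noncomputable section

namespace AnisoDiff

/-! ### Mollification: convergence, contraction in L^p, and classical derivatives -/

section Mollify

open Filter Metric ContinuousLinearMap
open scoped Topology Convolution

variable {E : Type*} [NormedAddCommGroup E] [NormedSpace ℝ E] [FiniteDimensional ℝ E]
  [MeasurableSpace E] [BorelSpace E] {μ : Measure E} [μ.IsAddHaarMeasure]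

/-- The mollification of `f` by the normalized bump function `φ`. -/
def mollify (μ : Measure E) (φ : ContDiffBump (0 : E)) (f : E → ℝ) : E → ℝ :=
  φ.normed μ ⋆[lsmul ℝ ℝ, μ] f

theorem mollify_apply (φ : ContDiffBump (0 : E)) (f : E → ℝ) (x : E) :
    mollify μ φ f x = ∫ y, φ.normed μ (x - y) * f y ∂μ := by
  simp only [mollify, convolution_eq_swap, lsmul_apply, smul_eq_mul]

theorem contDiff_mollify (φ : ContDiffBump (0 : E)) {f : E → ℝ} (hf : LocallyIntegrable f μ) :
    ContDiff ℝ 1 (mollify μ φ f) :=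
  (φ.hasCompactSupport_normed).contDiff_convolution_left _ (φ.contDiff_normed (n := 1)) hf

theorem fderiv_mollify (φ : ContDiffBump (0 : E)) {f : E → ℝ} (hf : LocallyIntegrable f μ)
    (x v : E) :
    fderiv ℝ (mollify μ φ f) x v = ∫ y, fderiv ℝ (φ.normed μ) (x - y) v * f y ∂μ := by
  have h := (φ.hasCompactSupport_normed (μ := μ)).hasFDerivAt_convolution_left (lsmul ℝ ℝ)
    (φ.contDiff_normed (n := 1)) hf x
  have hE := ((φ.hasCompactSupport_normed (μ := μ)).fderiv ℝ).convolutionExists_left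
    ((lsmul ℝ ℝ).precompL E)
    ((φ.contDiff_normed (n := 1) (μ := μ)).continuous_fderiv one_ne_zero) hf x
  rw [mollify, h.fderiv, convolution_eq_swap]
  rw [ContinuousLinearMap.integral_apply]
  · rfl
  · exact hE.integrable_swap

/-- The bounded ratio of the radii makes the kernels comparable to averages over balls, as the
almost everywhere convergence at Lebesgue points requires. -/
theorem exists_contDiffBump_seq (E : Type*) [NormedAddCommGroup E] [NormedSpace ℝ E] :
    ∃ φ : ℕ → ContDiffBump (0 : E), Tendsto (fun i => (φ i).rOut) atTop (𝓝 0) ∧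
      ∀ i, (φ i).rOut ≤ 2 * (φ i).rIn := by
  refine ⟨fun i => ⟨1 / ((i : ℝ) + 1) / 2, 1 / ((i : ℝ) + 1), by positivity, ?_⟩, ?_, fun i => ?_⟩
  · have : (0 : ℝ) < 1 / ((i : ℝ) + 1) := by positivity
    linarith
  · exact tendsto_one_div_add_atTop_nhds_zero_nat
  · simp only; linarith

theorem ae_tendsto_mollify {φ : ℕ → ContDiffBump (0 : E)}
    (hφ : Tendsto (fun i => (φ i).rOut) atTop (𝓝 0)) (h'φ : ∀ i, (φ i).rOut ≤ 2 * (φ i).rIn)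
    {f : E → ℝ} (hf : LocallyIntegrable f μ) :
    ∀ᵐ x ∂μ, Tendsto (fun i => mollify μ (φ i) f x) atTop (𝓝 (f x)) :=
  ContDiffBump.ae_convolution_tendsto_right_of_locallyIntegrable hφ (Eventually.of_forall h'φ) hf

/-- The kernel is a probability density, so Jensen's inequality bounds the p-th power of the average
by the average of the p-th powers; Tonelli and translation invariance do the rest. -/
theorem lintegral_enorm_mollify_rpow_le (φ : ContDiffBump (0 : E)) {f : E → ℝ} {p : ℝ}
    (hp : 1 ≤ p) (hf : AEStronglyMeasurable f μ) :
    ∫⁻ x, ‖mollify μ φ f x‖ₑ ^ p ∂μ ≤ ∫⁻ x, ‖f x‖ₑ ^ p ∂μ := by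
  have hp0 : 0 < p := by linarith
  set w : E → ℝ≥0∞ := fun y => ENNReal.ofReal (φ.normed μ y) with hw
  have hwm : Measurable w := (φ.continuous_normed (μ := μ)).measurable.ennreal_ofReal
  have hw1 : ∫⁻ y, w y ∂μ = 1 := by
    rw [hw, ← ofReal_integral_eq_lintegral_ofReal φ.integrable_normed
      (Eventually.of_forall φ.nonneg_normed), φ.integral_normed, ENNReal.ofReal_one]
  have key : ∀ x, ‖mollify μ φ f x‖ₑ ^ p ≤ ∫⁻ y, w y * ‖f (x - y)‖ₑ ^ p ∂μ := by
    intro x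
    have hqm : AEStronglyMeasurable (fun y => f (x - y)) μ :=
      hf.comp_quasiMeasurePreserving (quasiMeasurePreserving_sub_left_of_right_invariant μ x)
    have h1 : ‖mollify μ φ f x‖ₑ ≤ ∫⁻ y, w y * ‖f (x - y)‖ₑ ∂μ := by
      rw [mollify, convolution_def]
      refine (enorm_integral_le_lintegral_enorm _).trans (le_of_eq ?_)
      refine lintegral_congr fun y => ?_
      simp only [lsmul_apply, smul_eq_mul, enorm_mul]
      rw [Real.enorm_of_nonneg (φ.nonneg_normed y)]
    have hprob : IsProbabilityMeasure (μ.withDensity w) :=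
      ⟨by rw [withDensity_apply _ MeasurableSet.univ, Measure.restrict_univ, hw1]⟩
    have hac : μ.withDensity w ≪ μ := withDensity_absolutelyContinuous _ _
    -- Jensen's inequality, in the form that the L¹ norm is at most the L^p norm for a probability
    -- measure.
    have h2 := eLpNorm_le_eLpNorm_of_exponent_le (μ := μ.withDensity w)
      (show (1 : ℝ≥0∞) ≤ ENNReal.ofReal p by simpa using hp) (hqm.mono_ac hac)
    rw [eLpNorm_one_eq_lintegral_enorm, eLpNorm_eq_lintegral_rpow_enorm_toReal (by simpa using hp0)
      ENNReal.ofReal_ne_top, ENNReal.toReal_ofReal hp0.le,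
      lintegral_withDensity_eq_lintegral_mul₀ hwm.aemeasurable hqm.enorm,
      lintegral_withDensity_eq_lintegral_mul₀ hwm.aemeasurable (hqm.enorm.pow_const p)] at h2
    refine (ENNReal.rpow_le_rpow (h1.trans h2) hp0.le).trans (le_of_eq ?_)
    rw [← ENNReal.rpow_mul, one_div_mul_cancel hp0.ne', ENNReal.rpow_one]
    rfl
  calc ∫⁻ x, ‖mollify μ φ f x‖ₑ ^ p ∂μ
      ≤ ∫⁻ x, ∫⁻ y, w y * ‖f (x - y)‖ₑ ^ p ∂μ ∂μ := lintegral_mono key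
    _ = ∫⁻ y, ∫⁻ x, w y * ‖f (x - y)‖ₑ ^ p ∂μ ∂μ := by
        refine lintegral_lintegral_swap ?_
        refine AEMeasurable.mul (hwm.comp measurable_snd).aemeasurable ?_
        refine AEMeasurable.pow_const (AEStronglyMeasurable.enorm ?_) p
        exact hf.comp_quasiMeasurePreserving (quasiMeasurePreserving_sub μ μ)
    _ = ∫⁻ y, w y * ∫⁻ x, ‖f x‖ₑ ^ p ∂μ ∂μ := by
        refine lintegral_congr fun y => ?_
        rw [lintegral_const_mul' _ _ ENNReal.ofReal_ne_top]
        congr 1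
        exact lintegral_sub_right_eq_self (fun x => ‖f x‖ₑ ^ p) y
    _ = ∫⁻ x, ‖f x‖ₑ ^ p ∂μ := by
        rw [lintegral_mul_const _ hwm, hw1, one_mul]

theorem eLpNorm_mollify_le (φ : ContDiffBump (0 : E)) {f : E → ℝ} {p : ℝ}
    (hp : 1 ≤ p) (hf : AEStronglyMeasurable f μ) :
    eLpNorm (mollify μ φ f) (ENNReal.ofReal p) μ ≤ eLpNorm f (ENNReal.ofReal p) μ := by
  have hp0 : 0 < p := by linarith
  rw [eLpNorm_eq_lintegral_rpow_enorm_toReal (by simpa using hp0) ENNReal.ofReal_ne_top,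
    eLpNorm_eq_lintegral_rpow_enorm_toReal (by simpa using hp0) ENNReal.ofReal_ne_top,
    ENNReal.toReal_ofReal hp0.le]
  exact ENNReal.rpow_le_rpow (lintegral_enorm_mollify_rpow_le φ hp hf) (by positivity)

theorem mollify_sub (φ : ContDiffBump (0 : E)) {f g : E → ℝ} (hf : LocallyIntegrable f μ)
    (hg : LocallyIntegrable g μ) :
    mollify μ φ (f - g) = mollify μ φ f - mollify μ φ g := by
  have h : ∀ {f : E → ℝ}, LocallyIntegrable f μ → ∀ x,
      Integrable (fun y => φ.normed μ (x - y) * f y) μ := fun hf x =>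
    ((φ.hasCompactSupport_normed).convolutionExists_left (lsmul ℝ ℝ)
      φ.continuous_normed hf x).integrable_swap
  ext x
  simp only [mollify_apply, Pi.sub_apply, mul_sub]
  exact integral_sub (h hf x) (h hg x)

/-- Uniform continuity gives uniform convergence, and all supports lie in one compact neighbourhood
of the support of `g`, so uniform convergence implies L^p convergence. -/
theorem tendsto_eLpNorm_mollify_sub_of_continuous {φ : ℕ → ContDiffBump (0 : E)}
    (hφ : Tendsto (fun i => (φ i).rOut) atTop (𝓝 0)) {g : E → ℝ} (hg : Continuous g)
    (hgs : HasCompactSupport g) {p : ℝ} (hp : 1 ≤ p) :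
    Tendsto (fun i => eLpNorm (mollify μ (φ i) g - g) (ENNReal.ofReal p) μ) atTop (𝓝 0) := by
  have hp0 : 0 < p := by linarith
  set K := cthickening 1 (tsupport g) with hK
  have hKc : IsCompact K := hgs.isCompact.cthickening
  set V := μ K ^ (1 / p) with hV
  have hVt : V ≠ ⊤ := ENNReal.rpow_ne_top_of_nonneg (by positivity) hKc.measure_lt_top.ne
  have hbound : ∀ ε : ℝ, 0 < ε → ∀ᶠ i in atTop,
      eLpNorm (mollify μ (φ i) g - g) (ENNReal.ofReal p) μ ≤ V * ENNReal.ofReal ε := by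
    intro ε hε
    obtain ⟨d, hd, hdg⟩ := Metric.uniformContinuous_iff.1
      (hgs.uniformContinuous_of_continuous hg) ε hε
    filter_upwards [hφ.eventually (gt_mem_nhds (lt_min hd one_pos))] with i hi
    have h1 : ∀ x, ‖(mollify μ (φ i) g - g) x‖ ≤ ε := fun x => by
      rw [Pi.sub_apply, ← dist_eq_norm]
      refine ContDiffBump.dist_normed_convolution_le hg.aestronglyMeasurable fun y hy => ?_
      exact (hdg (lt_trans (mem_ball.1 hy) (hi.trans_le (min_le_left _ _)))).le
    have h2 : ∀ x, x ∉ K → (mollify μ (φ i) g - g) x = 0 := by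
      intro x hx
      have hx' : ∀ y ∈ ball x (φ i).rOut, g y = 0 := by
        intro y hy
        by_contra hne
        refine hx (mem_cthickening_of_dist_le x y 1 _ (subset_tsupport g hne) ?_)
        rw [dist_comm]
        exact ((mem_ball.1 hy).trans (hi.trans_le (min_le_right _ _))).le
      have hxx := hx' x (mem_ball_self (φ i).rOut_pos)
      rw [Pi.sub_apply, mollify, ContDiffBump.normed_convolution_eq_right, sub_self]
      intro y hy
      rw [hx' y hy, hxx]
    rw [← eLpNorm_restrict_eq_of_support_subset (s := K)]
    · refine (eLpNorm_le_of_ae_bound (Eventually.of_forall h1)).trans (le_of_eq ?_)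
      rw [Measure.restrict_apply_univ, ENNReal.toReal_ofReal hp0.le, hV, one_div]
    · intro x hx
      by_contra hne
      exact hx (h2 x hne)
  rw [ENNReal.tendsto_nhds_zero]
  intro ε hε
  by_cases hε' : ε = ⊤
  · simp [hε']
  have h3 : ∃ e : ℝ, 0 < e ∧ V * ENNReal.ofReal e ≤ ε := by
    have hpos : 0 < ε.toReal / (V.toReal + 1) := by
      have := ENNReal.toReal_pos hε.ne' hε'
      positivity
    refine ⟨_, hpos, ?_⟩
    rw [← ENNReal.ofReal_toReal hVt, ← ENNReal.ofReal_mul ENNReal.toReal_nonneg]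
    refine ENNReal.ofReal_le_of_le_toReal ?_
    rw [ENNReal.toReal_ofReal ENNReal.toReal_nonneg]
    have := ENNReal.toReal_nonneg (a := V)
    rw [mul_div_assoc', div_le_iff₀ (by positivity)]
    nlinarith [ENNReal.toReal_nonneg (a := ε)]
  obtain ⟨e, he, hle⟩ := h3
  exact (hbound e he).mono fun i hi => hi.trans hle

/-- A three-term estimate: approximate by a continuous compactly supported function and use that
mollification is a contraction in L^p. -/
theorem tendsto_eLpNorm_mollify_sub {φ : ℕ → ContDiffBump (0 : E)}
    (hφ : Tendsto (fun i => (φ i).rOut) atTop (𝓝 0)) {f : E → ℝ} {p : ℝ} (hp : 1 ≤ p)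
    (hf : MemLp f (ENNReal.ofReal p) μ) :
    Tendsto (fun i => eLpNorm (mollify μ (φ i) f - f) (ENNReal.ofReal p) μ) atTop (𝓝 0) := by
  have hp1 : (1 : ℝ≥0∞) ≤ ENNReal.ofReal p := by simpa using hp
  have hfl : LocallyIntegrable f μ := hf.locallyIntegrable hp1
  rw [ENNReal.tendsto_nhds_zero]
  intro ε hε
  have hε3 : ε / 3 ≠ 0 := (ENNReal.div_pos hε.ne' (by simp)).ne'
  obtain ⟨g, hgs, hfg, hg, hgL⟩ := hf.exists_hasCompactSupport_eLpNorm_sub_le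
    ENNReal.ofReal_ne_top hε3
  have hgl : LocallyIntegrable g μ := hgL.locallyIntegrable hp1
  have h1 := tendsto_eLpNorm_mollify_sub_of_continuous (μ := μ) hφ hg hgs hp
  filter_upwards [ENNReal.tendsto_nhds_zero.1 h1 (ε / 3) (pos_iff_ne_zero.2 hε3)] with i hi
  have hmeas : ∀ {f : E → ℝ}, LocallyIntegrable f μ →
      AEStronglyMeasurable (mollify μ (φ i) f) μ := fun hf =>
    (contDiff_mollify (φ i) hf).continuous.aestronglyMeasurable
  have hdec : mollify μ (φ i) f - f =
      mollify μ (φ i) (f - g) + ((mollify μ (φ i) g - g) + (g - f)) := by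
    rw [mollify_sub _ hfl hgl]; abel
  rw [hdec]
  refine (eLpNorm_add_le (hmeas (hfl.sub hgl)) (((hmeas hgl).sub hgL.1).add (hgL.1.sub hf.1))
    hp1).trans ?_
  refine (add_le_add ((eLpNorm_mollify_le _ hp (hf.1.sub hgL.1)).trans hfg)
    ((eLpNorm_add_le ((hmeas hgl).sub hgL.1) (hgL.1.sub hf.1) hp1).trans
      (add_le_add hi ((eLpNorm_sub_comm g f _ _).le.trans hfg)))).trans (le_of_eq ?_)
  rw [← add_assoc, ENNReal.add_thirds]

/-- If a first-order linear relation between `F` and `g` holds in the sense of distributions in `W`,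
then it holds classically for the mollifications, at points of distance `> r` to the complement
of `W`. -/
theorem sum_fderiv_mollify_eq {ι : Type*} [Fintype ι] {W : Set E} {F : ι → E → ℝ} {g : E → ℝ}
    {v : ι → E} (hF : ∀ i, Integrable (F i) μ) (hg : Integrable g μ)
    (h : ∀ η : E → ℝ, IsTestFunction W η →
      ∫ x, (∑ i, F i x * fderiv ℝ η x (v i) + g x * η x) ∂μ = 0)
    (φ : ContDiffBump (0 : E)) {x : E} (hx : closedBall x φ.rOut ⊆ W) :
    ∑ i, fderiv ℝ (mollify μ φ (F i)) x (v i) = mollify μ φ g x := by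
  set k := φ.normed μ with hk
  have hkc : ContDiff ℝ ∞ k := φ.contDiff_normed
  have hks : HasCompactSupport k := φ.hasCompactSupport_normed
  -- The reflected kernel is the test function. Its derivative in `y` is minus the derivative of the
  -- kernel at `x - y`, so testing with it differentiates the mollification at `x`.
  have htest : IsTestFunction W (fun y => k (x - y)) := by
    refine ⟨hkc.comp (contDiff_const.sub (contDiff_id (E := E))),
      hks.comp_homeomorph (Homeomorph.subLeft x), ?_⟩
    refine subset_trans ?_ hx
    refine closure_minimal ?_ isClosed_closedBall
    intro y hy
    have : x - y ∈ Function.support k := hy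
    rw [hk, φ.support_normed_eq] at this
    rw [mem_closedBall, dist_comm, dist_eq_norm]
    exact (mem_ball_zero_iff.1 this).le
  have hd : ∀ y w, fderiv ℝ (fun y => k (x - y)) y w = - fderiv ℝ k (x - y) w := by
    intro y w
    have h1 : HasFDerivAt (fun y => k (x - y))
        ((fderiv ℝ k (x - y)).comp (-ContinuousLinearMap.id ℝ E)) y := by
      have h0 : HasFDerivAt k (fderiv ℝ k (x - y)) (x - y) :=
        (hkc.differentiable (by simp)).differentiableAt.hasFDerivAt
      exact h0.comp y ((hasFDerivAt_id (𝕜 := ℝ) y).const_sub x)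
    rw [h1.fderiv]; simp
  have hint : ∀ i, Integrable (fun y => fderiv ℝ k (x - y) (v i) * F i y) μ := by
    intro i
    have := ((hks.fderiv ℝ).convolutionExists_left ((lsmul ℝ ℝ).precompL E)
      (hkc.continuous_fderiv (by simp)) (hF i).locallyIntegrable x).integrable_swap
    exact (ContinuousLinearMap.apply ℝ ℝ (v i)).integrable_comp this
  have hint' : Integrable (fun y => k (x - y) * g y) μ :=
    (hks.convolutionExists_left (lsmul ℝ ℝ) hkc.continuous hg.locallyIntegrable x).integrable_swap
  have h2 := h _ htest
  have h3 : ∫ y, (k (x - y) * g y - ∑ i, fderiv ℝ k (x - y) (v i) * F i y) ∂μ = 0 := by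
    rw [← h2]
    refine integral_congr_ae (Eventually.of_forall fun y => ?_)
    simp only [hd]
    rw [sub_eq_add_neg, ← Finset.sum_neg_distrib, add_comm, mul_comm]
    congr 1
    exact Finset.sum_congr rfl fun i _ => by ring
  rw [integral_sub hint' (integrable_finsetSum _ fun i _ => hint i),
    integral_finsetSum _ fun i _ => hint i, sub_eq_zero] at h3
  rw [mollify_apply, h3]
  exact Finset.sum_congr rfl fun i _ => fderiv_mollify φ (hF i).locallyIntegrable x (v i)

end Mollify

/-! ### Troisi's anisotropic Sobolev inequality and its Gagliardo-Nirenberg form -/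

section Troisi

open Function

variable {n : ℕ}

theorem ennreal_prod_rpow_eq_rpow_sum {ι : Type*} (s : Finset ι) (a : ℝ≥0∞) {w : ι → ℝ}
    (hw : ∀ i ∈ s, 0 ≤ w i) : ∏ i ∈ s, a ^ w i = a ^ ∑ i ∈ s, w i := by
  classical
  induction s using Finset.induction with
  | empty => simp
  | insert i s hi ih =>
    rw [Finset.prod_insert hi, Finset.sum_insert hi,
      ih fun j hj => hw j (Finset.mem_insert_of_mem hj), ENNReal.rpow_add_of_nonneg]
    · exact hw i (Finset.mem_insert_self i s)
    · exact Finset.sum_nonneg fun j hj => hw j (Finset.mem_insert_of_mem hj)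

/-- A crude substitute for the weighted arithmetic-geometric mean inequality: every factor is at
most the whole sum. -/
theorem ennreal_prod_rpow_le_sum {ι : Type*} (s : Finset ι) (a : ι → ℝ≥0∞) {w : ι → ℝ}
    (hw : ∀ i ∈ s, 0 ≤ w i) (h1 : ∑ i ∈ s, w i = 1) : ∏ i ∈ s, a i ^ w i ≤ ∑ i ∈ s, a i := by
  calc ∏ i ∈ s, a i ^ w i ≤ ∏ i ∈ s, (∑ j ∈ s, a j) ^ w i :=
        Finset.prod_le_prod' fun i hi => ENNReal.rpow_le_rpow
          (Finset.single_le_sum (f := a) (fun _ _ => zero_le) hi) (hw i hi)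
    _ = ∑ i ∈ s, a i := by rw [ennreal_prod_rpow_eq_rpow_sum s _ hw, h1, ENNReal.rpow_one]

/-- The Loomis-Whitney inequality, with a non-optimal constant. -/
theorem lintegral_prod_lintegral_rpow_le_prod (hn : 2 ≤ n) {f : Fin n → (Fin n → ℝ) → ℝ≥0∞}
    (hf : ∀ i, Measurable (f i)) (h0 : ∀ i, ∫⁻ x, f i x ≠ 0) (ht : ∀ i, ∫⁻ x, f i x ≠ ⊤) :
    ∫⁻ x, ∏ i, (∫⁻ s, f i (update x i s)) ^ ((1 : ℝ) / ((n : ℝ) - 1)) ≤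
      (n : ℝ≥0∞) ^ ((n : ℝ) / ((n : ℝ) - 1)) *
        ∏ i, (∫⁻ x, f i x) ^ ((1 : ℝ) / ((n : ℝ) - 1)) := by
  have hn' : (2 : ℝ) ≤ n := by exact_mod_cast hn
  set α : ℝ := (1 : ℝ) / ((n : ℝ) - 1) with hα
  have hα0 : 0 ≤ α := by rw [hα]; apply div_nonneg <;> linarith
  set c : Fin n → ℝ≥0∞ := fun i => ∫⁻ x, f i x with hc
  set F : (Fin n → ℝ) → ℝ≥0∞ := fun x => ∑ i, (c i)⁻¹ * f i x with hF
  have hFm : Measurable F := Finset.measurable_sum _ fun i _ => (hf i).const_mul _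
  have hFi : ∫⁻ x, F x = n := by
    rw [hF, lintegral_finsetSum _ fun i _ => (hf i).const_mul _]
    have : ∀ i, ∫⁻ x, (c i)⁻¹ * f i x = 1 := fun i => by
      rw [lintegral_const_mul _ (hf i)]
      exact ENNReal.inv_mul_cancel (h0 i) (ht i)
    simp [this]
  have hconj : Real.HolderConjugate (Fintype.card (Fin n)) ((n : ℝ) / ((n : ℝ) - 1)) := by
    rw [Fintype.card_fin]
    exact Real.HolderConjugate.conjExponent (by linarith)
  have hgrid := lintegral_prod_lintegral_pow_le (ι := Fin n) (A := fun _ => ℝ)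
    (fun _ => volume) hconj hFm
  rw [← volume_pi, hFi, Fintype.card_fin] at hgrid
  have hle : ∀ i x, ∫⁻ s, f i (update x i s) ≤ c i * ∫⁻ s, F (update x i s) := by
    intro i x
    have h1 : ∀ y, f i y ≤ c i * F y := fun y => by
      calc f i y = c i * ((c i)⁻¹ * f i y) := by
            rw [← mul_assoc, ENNReal.mul_inv_cancel (h0 i) (ht i), one_mul]
        _ ≤ c i * F y := by
            gcongr
            exact Finset.single_le_sum (f := fun i => (c i)⁻¹ * f i y) (fun _ _ => zero_le)
              (Finset.mem_univ i)
    rw [← lintegral_const_mul' _ _ (ht i)]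
    exact lintegral_mono fun s => h1 _
  calc ∫⁻ x, ∏ i, (∫⁻ s, f i (update x i s)) ^ α
      ≤ ∫⁻ x, (∏ i, c i ^ α) * ∏ i, (∫⁻ s, F (update x i s)) ^ α := by
        refine lintegral_mono fun x => ?_
        rw [← Finset.prod_mul_distrib]
        refine Finset.prod_le_prod' fun i _ => ?_
        rw [← ENNReal.mul_rpow_of_nonneg _ _ hα0]
        exact ENNReal.rpow_le_rpow (hle i x) hα0
    _ = (∏ i, c i ^ α) * ∫⁻ x, ∏ i, (∫⁻ s, F (update x i s)) ^ α := by
        refine lintegral_const_mul' _ _ (ENNReal.prod_ne_top fun i _ => ?_)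
        exact ENNReal.rpow_ne_top_of_nonneg hα0 (ht i)
    _ ≤ (∏ i, c i ^ α) * (n : ℝ≥0∞) ^ ((n : ℝ) / ((n : ℝ) - 1)) := by gcongr
    _ = _ := mul_comm _ _

/-- The fundamental theorem of calculus along the line in direction `i`, applied to |f|^γ. The
assumption γ > 1 makes this power continuously differentiable. -/
theorem enorm_rpow_le_lintegral_update {f : (Fin n → ℝ) → ℝ} (hf : ContDiff ℝ 1 f)
    (hfs : HasCompactSupport f) {γ : ℝ} (hγ : 1 < γ) (i : Fin n) (x : Fin n → ℝ) :
    ‖f x‖ₑ ^ γ ≤ ∫⁻ s, ENNReal.ofReal γ * (‖f (update x i s)‖ₑ ^ (γ - 1) *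
      ‖fderiv ℝ f (update x i s) (Pi.single i 1)‖ₑ) := by
  set g : ℝ → ℝ := fun s => f (update x i s) with hg
  have hgc : ContDiff ℝ 1 g := hf.comp (contDiff_update 1 x i)
  have hgs : HasCompactSupport g := hfs.comp_isClosedEmbedding (isClosedEmbedding_update x i)
  have hgd : ∀ s, deriv g s = fderiv ℝ f (update x i s) (Pi.single i 1) := fun s => by
    have h1 : HasFDerivAt f (fderiv ℝ f (update x i s)) (update x i s) :=
      (hf.differentiable one_ne_zero).differentiableAt.hasFDerivAt
    exact (h1.comp_hasDerivAt s (hasDerivAt_update x i s)).deriv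
  have hGc : ContDiff ℝ 1 (fun s => ‖g s‖ ^ γ) := hgc.norm_rpow hγ
  have hGs : HasCompactSupport (fun s => ‖g s‖ ^ γ) :=
    hgs.comp_left (g := fun y => ‖y‖ ^ γ) (by simp [Real.zero_rpow (by linarith : γ ≠ 0)])
  have h := HasCompactSupport.enorm_le_lintegral_Ici_deriv hGc hGs (x i)
  have e1 : ‖f x‖ₑ ^ γ = ‖‖g (x i)‖ ^ γ‖ₑ := by
    rw [hg]; simp only [update_eq_self]
    rw [Real.enorm_rpow_of_nonneg (norm_nonneg _) (by linarith), enorm_norm]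
  rw [e1]
  refine (h.trans (setLIntegral_le_lintegral _ _)).trans (lintegral_mono fun s => ?_)
  have h2 := ENNReal.ofReal_le_ofReal
    (norm_fderiv_norm_rpow_le (hgc.differentiable one_ne_zero) (x := s) hγ)
  rw [mul_assoc, ENNReal.ofReal_mul (by linarith), ENNReal.ofReal_mul (by positivity),
    ← ENNReal.ofReal_rpow_of_nonneg (norm_nonneg _) (by linarith), ofReal_norm, ofReal_norm,
    ofReal_norm] at h2
  have e2 : ‖deriv (fun s => ‖g s‖ ^ γ) s‖ₑ = ‖fderiv ℝ (fun s => ‖g s‖ ^ γ) s‖ₑ := by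
    rw [← ofReal_norm, ← ofReal_norm, norm_deriv_eq_norm_fderiv]
  have e3 : ‖fderiv ℝ g s‖ₑ = ‖fderiv ℝ f (update x i s) (Pi.single i 1)‖ₑ := by
    rw [← hgd, ← ofReal_norm, ← ofReal_norm, norm_deriv_eq_norm_fderiv]
  rw [e2, ← e3]
  exact h2

theorem harmonicAvg_pos (hn : 0 < n) {p : Fin n → ℝ} (hp : ∀ i, 0 < p i) :
    0 < harmonicAvg p := by
  have : Nonempty (Fin n) := ⟨⟨0, hn⟩⟩
  have h1 : 0 < ∑ i, 1 / p i :=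
    Finset.sum_pos (fun i _ => one_div_pos.2 (hp i)) Finset.univ_nonempty
  have : (0 : ℝ) < n := by exact_mod_cast hn
  unfold harmonicAvg
  positivity

theorem sum_one_div_eq_div_harmonicAvg (hn : 0 < n) (p : Fin n → ℝ) :
    ∑ i, 1 / p i = n / harmonicAvg p := by
  have : (n : ℝ) ≠ 0 := by exact_mod_cast hn.ne'
  unfold harmonicAvg
  rw [div_inv_eq_mul]; field_simp

/-- Troisi's anisotropic Sobolev inequality for `C¹` functions with compact support. -/
theorem exists_troisi (hn : 2 ≤ n) {p : Fin n → ℝ} (hp : ∀ i, 1 < p i)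
    (hpn : harmonicAvg p < n) :
    ∃ C : ℝ≥0∞, C ≠ ⊤ ∧ ∀ f : (Fin n → ℝ) → ℝ, ContDiff ℝ 1 f → HasCompactSupport f →
      (∫⁻ x, ‖f x‖ₑ ^ ((n : ℝ) * harmonicAvg p / (n - harmonicAvg p))) ^
          (((n : ℝ) - harmonicAvg p) / n) ≤
        C * ∑ i, ∫⁻ x, ‖fderiv ℝ f x (Pi.single i 1)‖ₑ ^ p i := by
  set P := harmonicAvg p with hP
  have hP0 : 0 < P := harmonicAvg_pos (by omega) fun i => by linarith [hp i]
  have hsum : ∑ i, 1 / p i = n / P := sum_one_div_eq_div_harmonicAvg (by omega) p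
  have hn' : (2 : ℝ) ≤ n := by exact_mod_cast hn
  set r : ℝ := (n : ℝ) * P / (n - P) with hr
  have hnP : 0 < (n : ℝ) - P := by linarith
  have hr0 : 0 < r := by rw [hr]; positivity
  set α : ℝ := (1 : ℝ) / ((n : ℝ) - 1) with hα
  have hn1 : 0 < (n : ℝ) - 1 := by linarith
  have hα0 : 0 < α := by rw [hα]; positivity
  -- Two requirements fix `γ`: γ_i - 1 = r(1 - 1/p_i), so that Hölder's inequality for |f|^{γ_i -
  -- 1}|∂_i f| reproduces the integral of |f|^r, and ∑ γ_i α = r, which is what determines the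
  -- Sobolev exponent `r`.
  set γ : Fin n → ℝ := fun i => 1 + r * (1 - 1 / p i) with hγ
  have hpi : ∀ i, 0 < 1 - 1 / p i := fun i => by
    have := hp i
    rw [sub_pos, div_lt_one (by linarith)]; exact this
  have hγ1 : ∀ i, 1 < γ i := fun i => by
    have := mul_pos hr0 (hpi i)
    simp only [hγ]; linarith
  have hγs : ∑ i, γ i * α = r := by
    rw [← Finset.sum_mul]
    have : ∑ i, γ i = n + r * (n - n / P) := by
      simp only [hγ, Finset.sum_add_distrib, ← Finset.mul_sum, Finset.sum_sub_distrib, hsum]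
      simp
    rw [this, hα, hr]
    field_simp
    ring
  -- The total power of ∫|f|^r produced on the right by Hölder's inequality. It is less than 1
  -- because the harmonic average is below `n`, so it can be absorbed on the left.
  set s : ℝ := ∑ i, (1 - 1 / p i) * α with hs
  have hs' : s = (n - n / P) * α := by
    rw [hs, ← Finset.sum_mul, Finset.sum_sub_distrib, hsum]; simp
  have h1s : 1 - s = (n / P - 1) * α := by
    rw [hs', hα]; field_simp; ring
  have h1s0 : 0 < 1 - s := by
    rw [h1s]; refine mul_pos ?_ hα0
    rw [sub_pos, lt_div_iff₀ hP0]; linarith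
  have hs0 : 0 ≤ s := Finset.sum_nonneg fun i _ => mul_nonneg (hpi i).le hα0.le
  -- The power that turns the exponent 1 - s into (n - P)/n; since κα = P/n, the weights of the
  -- gradient integrals then add up to 1.
  set κ : ℝ := ((n : ℝ) - P) / n / (1 - s) with hκ
  have hκ0 : 0 ≤ κ := by rw [hκ]; positivity
  have hκα : κ * α = P / n := by
    rw [hκ, h1s]
    have : (n : ℝ) / P - 1 ≠ 0 := by rw [div_sub_one hP0.ne']; positivity
    field_simp
  set A : ℝ≥0∞ := (n : ℝ≥0∞) ^ ((n : ℝ) / ((n : ℝ) - 1)) *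
    ∏ i, (ENNReal.ofReal (γ i)) ^ α with hA
  have hAt : A ≠ ⊤ := by
    refine ENNReal.mul_ne_top (ENNReal.rpow_ne_top_of_nonneg (by positivity) (by simp))
      (ENNReal.prod_ne_top fun i _ => ENNReal.rpow_ne_top_of_nonneg hα0.le ENNReal.ofReal_ne_top)
  refine ⟨A ^ κ, ENNReal.rpow_ne_top_of_nonneg hκ0 hAt, fun f hf hfs => ?_⟩
  set D : Fin n → (Fin n → ℝ) → ℝ≥0∞ := fun i x => ‖fderiv ℝ f x (Pi.single i 1)‖ₑ with hD
  have hdc : ∀ i, Continuous fun x => fderiv ℝ f x (Pi.single i 1) := fun i =>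
    (hf.continuous_fderiv one_ne_zero).clm_apply continuous_const
  have hDm : ∀ i, Measurable (D i) := fun i => (hdc i).measurable.enorm
  have hfm : Measurable fun x => ‖f x‖ₑ := hf.continuous.measurable.enorm
  -- The zero function is set apart, since the Loomis-Whitney inequality and the later division need
  -- nonzero integrals.
  by_cases hf0 : ∀ x, f x = 0
  · have : (∫⁻ x, ‖f x‖ₑ ^ r) ^ (((n : ℝ) - P) / n) = 0 := by
      simp only [hf0, enorm_zero, ENNReal.zero_rpow_of_pos hr0, lintegral_zero]
      exact ENNReal.zero_rpow_of_pos (by positivity)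
    rw [this]; exact zero_le
  push Not at hf0
  obtain ⟨x₀, hx₀⟩ := hf0
  -- continuous functions with compact support
  set h : Fin n → (Fin n → ℝ) → ℝ :=
    fun i x => γ i * (‖f x‖ ^ (γ i - 1) * ‖fderiv ℝ f x (Pi.single i 1)‖) with hh
  have hhc : ∀ i, Continuous (h i) := fun i =>
    continuous_const.mul ((hf.continuous.norm.rpow_const fun x => Or.inr (by linarith [hγ1 i])).mul
      (hdc i).norm)
  have hhs : ∀ i, HasCompactSupport (h i) := fun i => by
    refine HasCompactSupport.mul_left (HasCompactSupport.mul_right ?_)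
    exact hfs.comp_left (g := fun y => ‖y‖ ^ (γ i - 1))
      (by simp [Real.zero_rpow (by linarith [hγ1 i] : γ i - 1 ≠ 0)])
  have hh0 : ∀ i x, 0 ≤ h i x := fun i x => by
    have := hγ1 i
    simp only [hh]; positivity
  set F : Fin n → (Fin n → ℝ) → ℝ≥0∞ := fun i x =>
    ENNReal.ofReal (γ i) * (‖f x‖ₑ ^ (γ i - 1) * D i x) with hF
  have hFh : ∀ i x, F i x = ENNReal.ofReal (h i x) := fun i x => by
    have := hγ1 i
    simp only [hF, hh, hD]
    rw [ENNReal.ofReal_mul (by linarith), ENNReal.ofReal_mul (by positivity),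
      ← ENNReal.ofReal_rpow_of_nonneg (norm_nonneg _) (by linarith), ofReal_norm,
      ofReal_norm]
  have hFm : ∀ i, Measurable (F i) := fun i =>
    ((hfm.pow_const _).mul (hDm i)).const_mul _
  have hFle : ∀ i x, ‖f x‖ₑ ^ γ i ≤ ∫⁻ t, F i (update x i t) := fun i x =>
    enorm_rpow_le_lintegral_update hf hfs (hγ1 i) i x
  have hFt : ∀ i, ∫⁻ x, F i x ≠ ⊤ := fun i => by
    simp only [hFh]
    exact ((hhc i).integrable_of_hasCompactSupport (hhs i)).lintegral_lt_top.ne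
  have hFne : ∀ i, ∫⁻ x, F i x ≠ 0 := fun i h0 => by
    rw [lintegral_eq_zero_iff (hFm i)] at h0
    have h1 : h i =ᵐ[volume] 0 := by
      filter_upwards [h0] with x hx
      rw [hFh] at hx
      exact le_antisymm (ENNReal.ofReal_eq_zero.1 hx) (hh0 i x)
    have h2 : h i = 0 := Continuous.ae_eq_iff_eq volume (hhc i) continuous_zero |>.1 h1
    have h3 := hFle i x₀
    simp only [hFh, h2, Pi.zero_apply, ENNReal.ofReal_zero, lintegral_zero, nonpos_iff_eq_zero]
      at h3
    rw [ENNReal.rpow_eq_zero_iff_of_pos (by linarith [hγ1 i]), enorm_eq_zero] at h3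
    exact hx₀ h3
  set R : ℝ≥0∞ := ∫⁻ x, ‖f x‖ₑ ^ r with hR
  have hRh : ∀ x, ‖f x‖ₑ ^ r = ENNReal.ofReal (‖f x‖ ^ r) := fun x => by
    rw [← ENNReal.ofReal_rpow_of_nonneg (norm_nonneg _) hr0.le, ofReal_norm]
  have hRc : Continuous fun x => ‖f x‖ ^ r := hf.continuous.norm.rpow_const fun _ => Or.inr hr0.le
  have hRt : R ≠ ⊤ := by
    simp only [hR, hRh]
    exact (hRc.integrable_of_hasCompactSupport (hfs.comp_left (g := fun y => ‖y‖ ^ r)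
      (by simp [Real.zero_rpow hr0.ne']))).lintegral_lt_top.ne
  have hR0 : R ≠ 0 := fun h0 => by
    rw [hR, lintegral_eq_zero_iff (hfm.pow_const _)] at h0
    have h1 : f =ᵐ[volume] 0 := by
      filter_upwards [h0] with x hx
      rw [Pi.zero_apply, ENNReal.rpow_eq_zero_iff_of_pos hr0, enorm_eq_zero] at hx
      exact hx
    have h2 : f = 0 := Continuous.ae_eq_iff_eq volume hf.continuous continuous_zero |>.1 h1
    exact hx₀ (by rw [h2]; rfl)
  have hHol : ∀ i, ∫⁻ x, F i x ≤
      ENNReal.ofReal (γ i) * (R ^ (1 - 1 / p i) * (∫⁻ x, D i x ^ p i) ^ (1 / p i)) := by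
    intro i
    have hp0 : 0 < p i := by linarith [hp i]
    simp only [hF]
    rw [lintegral_const_mul' _ _ ENNReal.ofReal_ne_top]
    gcongr
    have h1 := ENNReal.lintegral_mul_norm_pow_le (μ := (volume : Measure (Fin n → ℝ)))
      (f := fun x => ‖f x‖ₑ ^ r)
      (g := fun x => D i x ^ p i) (hfm.pow_const _).aemeasurable
      ((hDm i).pow_const _).aemeasurable (hpi i).le (by positivity : 0 ≤ 1 / p i) (by ring)
    refine le_trans (le_of_eq (lintegral_congr fun x => ?_)) h1
    rw [← ENNReal.rpow_mul, ← ENNReal.rpow_mul, mul_one_div_cancel hp0.ne', ENNReal.rpow_one]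
    congr 2
    simp only [hγ]; ring
  have hmain : R ≤ A * (R ^ s * ∏ i, (∫⁻ x, D i x ^ p i) ^ (1 / p i * α)) := by
    calc R = ∫⁻ x, ∏ i, (‖f x‖ₑ ^ γ i) ^ α := by
          rw [hR]
          refine lintegral_congr fun x => ?_
          simp only [← ENNReal.rpow_mul]
          rw [ennreal_prod_rpow_eq_rpow_sum _ _ fun i _ => mul_nonneg (by linarith [hγ1 i]) hα0.le,
            hγs]
      _ ≤ ∫⁻ x, ∏ i, (∫⁻ t, F i (update x i t)) ^ α :=
          lintegral_mono fun x => Finset.prod_le_prod' fun i _ =>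
            ENNReal.rpow_le_rpow (hFle i x) hα0.le
      _ ≤ (n : ℝ≥0∞) ^ ((n : ℝ) / ((n : ℝ) - 1)) * ∏ i, (∫⁻ x, F i x) ^ α :=
          lintegral_prod_lintegral_rpow_le_prod hn hFm hFne hFt
      _ ≤ (n : ℝ≥0∞) ^ ((n : ℝ) / ((n : ℝ) - 1)) * ∏ i, (ENNReal.ofReal (γ i) *
            (R ^ (1 - 1 / p i) * (∫⁻ x, D i x ^ p i) ^ (1 / p i))) ^ α := by
          gcongr with i
          exact hHol i
      _ = _ := by
          simp only [ENNReal.mul_rpow_of_nonneg _ _ hα0.le, Finset.prod_mul_distrib,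
            ← ENNReal.rpow_mul]
          rw [ennreal_prod_rpow_eq_rpow_sum _ R fun i _ => mul_nonneg (hpi i).le hα0.le, hA,
            mul_assoc]
  -- Division by `R ^ s`, legitimate because `R` is neither 0 nor ∞ for a nonzero continuous
  -- function of compact support.
  have hdiv : R ^ (1 - s) ≤ A * ∏ i, (∫⁻ x, D i x ^ p i) ^ (1 / p i * α) := by
    rw [ENNReal.rpow_sub _ _ hR0 hRt, ENNReal.rpow_one]
    refine ENNReal.div_le_of_le_mul (hmain.trans (le_of_eq ?_))
    ring
  calc R ^ (((n : ℝ) - P) / n) = (R ^ (1 - s)) ^ κ := by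
        rw [← ENNReal.rpow_mul, hκ, mul_div_cancel₀ _ h1s0.ne']
    _ ≤ (A * ∏ i, (∫⁻ x, D i x ^ p i) ^ (1 / p i * α)) ^ κ := ENNReal.rpow_le_rpow hdiv hκ0
    _ = A ^ κ * ∏ i, (∫⁻ x, D i x ^ p i) ^ (1 / p i * (P / n)) := by
        rw [ENNReal.mul_rpow_of_nonneg _ _ hκ0, ← ENNReal.prod_rpow_of_nonneg hκ0]
        congr 1
        refine Finset.prod_congr rfl fun i _ => ?_
        rw [← ENNReal.rpow_mul, mul_assoc, mul_comm α, hκα]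
    _ ≤ A ^ κ * ∑ i, ∫⁻ x, D i x ^ p i := by
        gcongr
        refine ennreal_prod_rpow_le_sum _ _ (fun i _ => ?_) ?_
        · have := hp i
          positivity
        · rw [← Finset.sum_mul, hsum]; field_simp

/-- The Gagliardo-Nirenberg form of Troisi's inequality. -/
theorem exists_gagliardo_nirenberg (hn : 2 ≤ n) {p : Fin n → ℝ} (hp : ∀ i, 1 < p i)
    (hpn : harmonicAvg p < n) :
    ∃ C : ℝ≥0∞, C ≠ ⊤ ∧ ∀ f : (Fin n → ℝ) → ℝ, ContDiff ℝ 1 f → HasCompactSupport f →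
      ∫⁻ x, ‖f x‖ₑ ^ (harmonicAvg p * (1 + 2 / n)) ≤
        C * ((∫⁻ x, ‖f x‖ₑ ^ (2 : ℝ)) ^ (harmonicAvg p / n) *
          ∑ i, ∫⁻ x, ‖fderiv ℝ f x (Pi.single i 1)‖ₑ ^ p i) := by
  obtain ⟨C, hC, h⟩ := exists_troisi hn hp hpn
  refine ⟨C, hC, fun f hf hfs => ?_⟩
  have hP0 : 0 < harmonicAvg p := harmonicAvg_pos (by omega) fun i => by linarith [hp i]
  set P := harmonicAvg p with hP
  have hn' : (2 : ℝ) ≤ n := by exact_mod_cast hn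
  have hnP : 0 < (n : ℝ) - P := by linarith
  have hfm : Measurable fun x => ‖f x‖ₑ := hf.continuous.measurable.enorm
  -- Hölder's inequality with weights P/n and (n - P)/n: 2·P/n + r·(n - P)/n = P(1 + 2/n).
  have h1 := ENNReal.lintegral_mul_norm_pow_le (μ := (volume : Measure (Fin n → ℝ)))
    (f := fun x => ‖f x‖ₑ ^ (2 : ℝ)) (g := fun x => ‖f x‖ₑ ^ ((n : ℝ) * P / (n - P)))
    (hfm.pow_const _).aemeasurable (hfm.pow_const _).aemeasurable
    (by positivity : 0 ≤ P / n) (by positivity : 0 ≤ ((n : ℝ) - P) / n) (by field_simp; ring)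
  calc ∫⁻ x, ‖f x‖ₑ ^ (P * (1 + 2 / n))
      = ∫⁻ x, (‖f x‖ₑ ^ (2 : ℝ)) ^ (P / n) *
          (‖f x‖ₑ ^ ((n : ℝ) * P / (n - P))) ^ (((n : ℝ) - P) / n) := by
        refine lintegral_congr fun x => ?_
        rw [← ENNReal.rpow_mul, ← ENNReal.rpow_mul, ← ENNReal.rpow_add_of_nonneg]
        · congr 1; field_simp; ring
        · positivity
        · positivity
    _ ≤ _ := h1
    _ ≤ (∫⁻ x, ‖f x‖ₑ ^ (2 : ℝ)) ^ (P / n) *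
          (C * ∑ i, ∫⁻ x, ‖fderiv ℝ f x (Pi.single i 1)‖ₑ ^ p i) := by
        gcongr; exact h f hf hfs
    _ = _ := by ring

end Troisi

/-! ### Bounded C¹ approximations of the truncations (s - k)₊ and (s - k)₊²/2 -/

section Truncation

open Filter
open scoped Topology

/-- A continuous approximation of the indicator function of `{s | k < s}`, supported in
`[k, k + j + 1]`. -/
def softStep (k : ℝ) (j : ℕ) (s : ℝ) : ℝ :=
  max 0 (min 1 (min (((j : ℝ) + 1) * (s - k)) ((j : ℝ) + 1 - (s - k))))

/-- The primitive of `softStep k j`, an approximation of `(s - k)₊`. -/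
def softPos (k : ℝ) (j : ℕ) (s : ℝ) : ℝ := ∫ t in k..s, softStep k j t

/-- The primitive of `softPos k j`, an approximation of `(s - k)₊² / 2`. -/
def softSq (k : ℝ) (j : ℕ) (s : ℝ) : ℝ := ∫ t in k..s, softPos k j t

variable (k : ℝ) (j : ℕ)

theorem continuous_softStep : Continuous (softStep k j) := by
  unfold softStep; fun_prop

theorem softStep_nonneg (s : ℝ) : 0 ≤ softStep k j s := le_max_left _ _

theorem softStep_le_one (s : ℝ) : softStep k j s ≤ 1 :=
  max_le zero_le_one (min_le_left _ _)

theorem softStep_of_le {s : ℝ} (hs : s ≤ k) : softStep k j s = 0 := by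
  refine max_eq_left ((min_le_right _ _).trans ((min_le_left _ _).trans ?_))
  exact mul_nonpos_of_nonneg_of_nonpos (by positivity) (by linarith)

theorem softStep_of_ge {s : ℝ} (hs : k + (j + 1) ≤ s) : softStep k j s = 0 :=
  max_eq_left ((min_le_right _ _).trans ((min_le_right _ _).trans (by linarith)))

theorem softStep_le_indicator (s : ℝ) : softStep k j s ≤ (Ioi k).indicator 1 s := by
  by_cases hs : k < s
  · rw [indicator_of_mem (by exact hs)]; exact softStep_le_one k j s
  · rw [indicator_of_notMem (by exact hs), softStep_of_le k j (not_lt.1 hs)]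

/-- At s = k every approximation vanishes, so the limit is the indicator of the open half-line,
matching the set {u > k} of the energy inequality. -/
theorem tendsto_softStep (s : ℝ) :
    Tendsto (fun j => softStep k j s) atTop (𝓝 ((Ioi k).indicator 1 s)) := by
  by_cases hs : k < s
  · rw [indicator_of_mem (by exact hs)]
    have hs' : 0 < s - k := by linarith
    have h1 : ∀ᶠ j : ℕ in atTop, 1 / (s - k) ≤ (j : ℝ) :=
      tendsto_natCast_atTop_atTop.eventually_ge_atTop _
    have h2 : ∀ᶠ j : ℕ in atTop, s - k ≤ (j : ℝ) :=
      tendsto_natCast_atTop_atTop.eventually_ge_atTop _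
    refine tendsto_const_nhds.congr' ?_
    filter_upwards [h1, h2] with j h1 h2
    rw [div_le_iff₀ hs'] at h1
    rw [softStep, min_eq_left, max_eq_right zero_le_one]; · rfl
    exact le_min (by nlinarith) (by linarith)
  · rw [indicator_of_notMem (by exact hs)]
    refine tendsto_const_nhds.congr fun j => ?_
    rw [softStep_of_le k j (not_lt.1 hs)]

theorem hasDerivAt_softPos (s : ℝ) : HasDerivAt (softPos k j) (softStep k j s) s :=
  intervalIntegral.integral_hasDerivAt_right ((continuous_softStep k j).intervalIntegrable _ _)
    ((continuous_softStep k j).stronglyMeasurableAtFilter _ _)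
    (continuous_softStep k j).continuousAt

theorem continuous_softPos : Continuous (softPos k j) :=
  continuous_iff_continuousAt.2 fun s => (hasDerivAt_softPos k j s).continuousAt

theorem hasDerivAt_softSq (s : ℝ) : HasDerivAt (softSq k j) (softPos k j s) s :=
  intervalIntegral.integral_hasDerivAt_right ((continuous_softPos k j).intervalIntegrable _ _)
    ((continuous_softPos k j).stronglyMeasurableAtFilter _ _)
    (continuous_softPos k j).continuousAt

theorem contDiff_softPos : ContDiff ℝ 1 (softPos k j) := by
  rw [contDiff_one_iff_deriv]
  refine ⟨fun s => (hasDerivAt_softPos k j s).differentiableAt, ?_⟩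
  rw [show deriv (softPos k j) = softStep k j from funext fun s => (hasDerivAt_softPos k j s).deriv]
  exact continuous_softStep k j

theorem contDiff_softSq : ContDiff ℝ 1 (softSq k j) := by
  rw [contDiff_one_iff_deriv]
  refine ⟨fun s => (hasDerivAt_softSq k j s).differentiableAt, ?_⟩
  rw [show deriv (softSq k j) = softPos k j from funext fun s => (hasDerivAt_softSq k j s).deriv]
  exact continuous_softPos k j

theorem softPos_of_le {s : ℝ} (hs : s ≤ k) : softPos k j s = 0 := by
  rw [softPos, intervalIntegral.integral_symm, neg_eq_zero]
  refine intervalIntegral.integral_zero_ae (Eventually.of_forall fun t ht => ?_)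
  rw [uIoc_of_le hs] at ht
  exact softStep_of_le k j ht.2

theorem softPos_nonneg (s : ℝ) : 0 ≤ softPos k j s := by
  rcases le_total s k with hs | hs
  · rw [softPos_of_le k j hs]
  · exact intervalIntegral.integral_nonneg hs fun t _ => softStep_nonneg k j t

theorem softPos_le (s : ℝ) : softPos k j s ≤ max (s - k) 0 := by
  rcases le_total s k with hs | hs
  · rw [softPos_of_le k j hs]; exact le_max_right _ _
  · refine le_trans ?_ (le_max_left _ _)
    have := intervalIntegral.integral_mono_on (μ := volume) (f := softStep k j) (g := fun _ => 1) hs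
      ((continuous_softStep k j).intervalIntegrable _ _)
      (continuous_const.intervalIntegrable _ _) fun t _ => softStep_le_one k j t
    simpa [softPos] using this

/-- `softStep` vanishes beyond `k + j + 1`, so its primitive stops growing there. This makes
`softSq` globally Lipschitz, so that L¹ convergence passes through it. -/
theorem softPos_le_const (s : ℝ) : softPos k j s ≤ j + 1 := by
  rcases le_total s (k + (j + 1)) with hs | hs
  · refine (softPos_le k j s).trans (max_le (by linarith) (by positivity))
  · have h1 : softPos k j s = softPos k j (k + (j + 1)) := by
      unfold softPos
      rw [← intervalIntegral.integral_add_adjacent_intervals (b := k + (j + 1))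
        ((continuous_softStep k j).intervalIntegrable _ _)
        ((continuous_softStep k j).intervalIntegrable _ _)]
      rw [add_eq_left]
      refine intervalIntegral.integral_zero_ae (Eventually.of_forall fun t ht => ?_)
      rw [uIoc_of_le hs] at ht
      exact softStep_of_ge k j ht.1.le
    rw [h1]
    exact (softPos_le k j _).trans (max_le (by linarith) (by positivity))

theorem softSq_of_le {s : ℝ} (hs : s ≤ k) : softSq k j s = 0 := by
  rw [softSq, intervalIntegral.integral_symm, neg_eq_zero]
  refine intervalIntegral.integral_zero_ae (Eventually.of_forall fun t ht => ?_)
  rw [uIoc_of_le hs] at ht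
  exact softPos_of_le k j ht.2

theorem softSq_nonneg (s : ℝ) : 0 ≤ softSq k j s := by
  rcases le_total s k with hs | hs
  · rw [softSq_of_le k j hs]
  · exact intervalIntegral.integral_nonneg hs fun t _ => softPos_nonneg k j t

theorem integral_posPart_sub {k s : ℝ} (hs : k ≤ s) :
    ∫ t in k..s, max (t - k) 0 = max (s - k) 0 ^ 2 / 2 := by
  have h1 : ∫ t in k..s, max (t - k) 0 = ∫ t in k..s, (t - k) := by
    refine intervalIntegral.integral_congr fun t ht => ?_
    rw [uIcc_of_le hs] at ht
    exact max_eq_left (by linarith [ht.1])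
  rw [h1, max_eq_left (by linarith)]
  simp only [intervalIntegral.integral_comp_sub_right (fun t => t), integral_id]
  ring

theorem softSq_le (s : ℝ) : softSq k j s ≤ max (s - k) 0 ^ 2 / 2 := by
  rcases le_total s k with hs | hs
  · rw [softSq_of_le k j hs]; positivity
  · rw [← integral_posPart_sub hs]
    refine intervalIntegral.integral_mono_on hs ((continuous_softPos k j).intervalIntegrable _ _)
      (Continuous.intervalIntegrable (by fun_prop) _ _) fun t _ => softPos_le k j t

theorem lipschitz_softSq (s t : ℝ) : |softSq k j s - softSq k j t| ≤ (j + 1) * |s - t| := by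
  have := Convex.norm_image_sub_le_of_norm_hasDerivWithin_le (f := softSq k j) (s := univ)
    (C := (j : ℝ) + 1) (fun x _ => (hasDerivAt_softSq k j x).hasDerivWithinAt) (fun x _ => ?_)
    convex_univ (mem_univ t) (mem_univ s)
  · simpa using this
  · rw [Real.norm_of_nonneg (softPos_nonneg k j x)]; exact softPos_le_const k j x

theorem tendsto_softPos (s : ℝ) :
    Tendsto (fun j => softPos k j s) atTop (𝓝 (max (s - k) 0)) := by
  rcases le_total s k with hs | hs
  · rw [max_eq_right (by linarith)]
    exact tendsto_const_nhds.congr fun j => (softPos_of_le k j hs).symm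
  · have h := intervalIntegral.tendsto_integral_filter_of_dominated_convergence (μ := volume)
      (a := k) (b := s) (F := fun j => softStep k j) (f := (Ioi k).indicator 1) (l := atTop)
      (fun _ => 1) (Eventually.of_forall fun j => (continuous_softStep k j).aestronglyMeasurable)
      (Eventually.of_forall fun j => Eventually.of_forall fun t _ => by
        rw [Real.norm_of_nonneg (softStep_nonneg k j t)]; exact softStep_le_one k j t)
      (continuous_const.intervalIntegrable _ _)
      (Eventually.of_forall fun t _ => tendsto_softStep k t)
    have e : ∫ t in k..s, (Ioi k).indicator (1 : ℝ → ℝ) t = max (s - k) 0 := by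
      have : ∫ t in k..s, (Ioi k).indicator (1 : ℝ → ℝ) t = ∫ t in k..s, (1 : ℝ) := by
        refine intervalIntegral.integral_congr_ae (Eventually.of_forall fun t ht => ?_)
        rw [uIoc_of_le hs] at ht
        rw [indicator_of_mem (by exact ht.1)]; rfl
      rw [this, max_eq_left (by linarith)]; simp
    rw [← e]; exact h

theorem tendsto_softSq (s : ℝ) :
    Tendsto (fun j => softSq k j s) atTop (𝓝 (max (s - k) 0 ^ 2 / 2)) := by
  rcases le_total s k with hs | hs
  · rw [max_eq_right (by linarith)]
    refine tendsto_const_nhds.congr fun j => ?_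
    rw [softSq_of_le k j hs]; simp
  · rw [← integral_posPart_sub hs]
    refine intervalIntegral.tendsto_integral_filter_of_dominated_convergence (μ := volume)
      (a := k) (b := s) (F := fun j => softPos k j) (l := atTop)
      (fun t => max (t - k) 0)
      (Eventually.of_forall fun j => (continuous_softPos k j).aestronglyMeasurable)
      (Eventually.of_forall fun j => Eventually.of_forall fun t _ => by
        rw [Real.norm_of_nonneg (softPos_nonneg k j t)]; exact softPos_le k j t)
      (Continuous.intervalIntegrable (by fun_prop) _ _)
      (Eventually.of_forall fun t _ => tendsto_softPos k t)

end Truncation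

/-! ### Passage to the limit in L^p norms and integrals -/

section LpLimits

open Filter
open scoped Topology

variable {α : Type*} [MeasurableSpace α] {μ : Measure α}

theorem eLpNorm_ofReal_rpow {p : ℝ} (hp : 0 < p) (f : α → ℝ) :
    eLpNorm f (ENNReal.ofReal p) μ ^ p = ∫⁻ x, ‖f x‖ₑ ^ p ∂μ := by
  rw [eLpNorm_eq_lintegral_rpow_enorm_toReal (by simpa using hp) ENNReal.ofReal_ne_top,
    ENNReal.toReal_ofReal hp.le, ← ENNReal.rpow_mul, one_div_mul_cancel hp.ne', ENNReal.rpow_one]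

theorem eLpNorm_ofReal_eq {p : ℝ} (hp : 0 < p) (f : α → ℝ) :
    eLpNorm f (ENNReal.ofReal p) μ = (∫⁻ x, ‖f x‖ₑ ^ p ∂μ) ^ (1 / p) := by
  rw [eLpNorm_eq_lintegral_rpow_enorm_toReal (by simpa using hp) ENNReal.ofReal_ne_top,
    ENNReal.toReal_ofReal hp.le]

/-- If `F j → F` in `L^p` and `c j → c` boundedly almost everywhere, then `c j F j → c F` in
`L^p`. -/
theorem tendsto_eLpNorm_mul_sub {p : ℝ} (hp : 1 ≤ p) {F : ℕ → α → ℝ} {G : α → ℝ}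
    {c : ℕ → α → ℝ} {d : α → ℝ} {M : ℝ} (hF : ∀ j, AEStronglyMeasurable (F j) μ)
    (hG : MemLp G (ENNReal.ofReal p) μ) (hc : ∀ j, AEStronglyMeasurable (c j) μ)
    (hcM : ∀ j x, |c j x| ≤ M)
    (hFG : Tendsto (fun j => eLpNorm (F j - G) (ENNReal.ofReal p) μ) atTop (𝓝 0))
    (hcd : ∀ᵐ x ∂μ, Tendsto (fun j => c j x) atTop (𝓝 (d x))) :
    Tendsto (fun j => eLpNorm (c j * F j - d * G) (ENNReal.ofReal p) μ) atTop (𝓝 0) := by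
  have hp0 : 0 < p := by linarith
  have hp1 : (1 : ℝ≥0∞) ≤ ENNReal.ofReal p := by simpa using hp
  have hdm : AEStronglyMeasurable d μ := aestronglyMeasurable_of_tendsto_ae atTop hc hcd
  -- The difference is c_j(F_j - G) + (c_j - d)G: the first term is small by the uniform bound on
  -- c_j, the second by dominated convergence with majorant 2M|G|.
  have h1 : Tendsto (fun j => eLpNorm (c j * (F j - G)) (ENNReal.ofReal p) μ) atTop (𝓝 0) := by
    have hle : ∀ j, eLpNorm (c j * (F j - G)) (ENNReal.ofReal p) μ ≤
        ENNReal.ofReal M * eLpNorm (F j - G) (ENNReal.ofReal p) μ := fun j =>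
      eLpNorm_le_mul_eLpNorm_of_ae_le_mul (Eventually.of_forall fun x => by
        rw [Pi.mul_apply, norm_mul]
        exact mul_le_mul_of_nonneg_right (hcM j x) (norm_nonneg _)) _
    have h0 := ENNReal.Tendsto.const_mul (a := ENNReal.ofReal M) hFG (Or.inr ENNReal.ofReal_ne_top)
    rw [mul_zero] at h0
    exact tendsto_of_tendsto_of_tendsto_of_le_of_le tendsto_const_nhds h0 (fun _ => zero_le) hle
  have h2 : Tendsto (fun j => eLpNorm ((c j - d) * G) (ENNReal.ofReal p) μ) atTop (𝓝 0) := by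
    have hlim : Tendsto (fun j => ∫⁻ x, ‖((c j - d) * G) x‖ₑ ^ p ∂μ) atTop
        (𝓝 (∫⁻ x, 0 ∂μ)) := by
      refine tendsto_lintegral_of_dominated_convergence'
        (fun x => (ENNReal.ofReal (2 * M) * ‖G x‖ₑ) ^ p) (fun j => ?_) (fun j => ?_) ?_ ?_
      · exact (((hc j).sub hdm).mul hG.1).enorm.pow_const p
      · filter_upwards [hcd] with x hx
        have hd : |d x| ≤ M := le_of_tendsto hx.abs (Eventually.of_forall fun j => hcM j x)
        refine ENNReal.rpow_le_rpow ?_ hp0.le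
        rw [Pi.mul_apply, enorm_mul]
        gcongr
        rw [← ofReal_norm]
        refine ENNReal.ofReal_le_ofReal ?_
        rw [Pi.sub_apply, Real.norm_eq_abs]
        exact (abs_sub _ _).trans (by linarith [hcM j x])
      · simp_rw [ENNReal.mul_rpow_of_nonneg _ _ hp0.le]
        rw [lintegral_const_mul' _ _ (ENNReal.rpow_ne_top_of_nonneg hp0.le ENNReal.ofReal_ne_top),
          ← eLpNorm_ofReal_rpow hp0]
        exact ENNReal.mul_ne_top (ENNReal.rpow_ne_top_of_nonneg hp0.le ENNReal.ofReal_ne_top)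
          (ENNReal.rpow_ne_top_of_nonneg hp0.le hG.2.ne)
      · filter_upwards [hcd] with x hx
        have h3 : Tendsto (fun j => ((c j - d) * G) x) atTop (𝓝 0) := by
          have := (hx.sub_const (d x)).mul_const (G x)
          simpa using this
        have h4 := (h3.enorm).ennrpow_const p
        simpa [ENNReal.zero_rpow_of_pos hp0] using h4
    rw [lintegral_zero] at hlim
    have h5 := hlim.ennrpow_const (1 / p)
    rw [ENNReal.zero_rpow_of_pos (by positivity)] at h5
    refine h5.congr fun j => ?_
    rw [eLpNorm_ofReal_eq hp0]
  have h3 := h1.add h2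
  rw [add_zero] at h3
  refine tendsto_of_tendsto_of_tendsto_of_le_of_le tendsto_const_nhds h3 (fun _ => zero_le)
    fun j => ?_
  have e : c j * F j - d * G = c j * (F j - G) + (c j - d) * G := by ring
  simp only [e]
  exact eLpNorm_add_le ((hc j).mul ((hF j).sub hG.1)) (((hc j).sub hdm).mul hG.1) hp1

theorem tendsto_eLpNorm_of_sub {p : ℝ≥0∞} (hp : 1 ≤ p) {F : ℕ → α → ℝ} {G : α → ℝ}
    (hF : ∀ j, AEStronglyMeasurable (F j) μ) (hG : MemLp G p μ)
    (hFG : Tendsto (fun j => eLpNorm (F j - G) p μ) atTop (𝓝 0)) :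
    Tendsto (fun j => eLpNorm (F j) p μ) atTop (𝓝 (eLpNorm G p μ)) := by
  have hup : Tendsto (fun j => eLpNorm (F j - G) p μ + eLpNorm G p μ) atTop
      (𝓝 (eLpNorm G p μ)) := by simpa using hFG.add_const (eLpNorm G p μ)
  have hlo : Tendsto (fun j => eLpNorm G p μ - eLpNorm (F j - G) p μ) atTop
      (𝓝 (eLpNorm G p μ)) := by
    simpa using ENNReal.Tendsto.sub tendsto_const_nhds hFG (Or.inl hG.2.ne)
  refine tendsto_of_tendsto_of_tendsto_of_le_of_le hlo hup (fun j => ?_) (fun j => ?_)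
  · simp only [tsub_le_iff_right]
    have := eLpNorm_add_le (hF j) (hG.1.sub (hF j)) hp
    rw [add_sub_cancel, eLpNorm_sub_comm] at this
    exact this
  · have := eLpNorm_add_le ((hF j).sub hG.1) hG.1 hp
    rwa [sub_add_cancel] at this

theorem tendsto_lintegral_rpow_of_sub {p : ℝ} (hp : 1 ≤ p) {F : ℕ → α → ℝ} {G : α → ℝ}
    (hF : ∀ j, AEStronglyMeasurable (F j) μ) (hG : MemLp G (ENNReal.ofReal p) μ)
    (hFG : Tendsto (fun j => eLpNorm (F j - G) (ENNReal.ofReal p) μ) atTop (𝓝 0)) :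
    Tendsto (fun j => ∫⁻ x, ‖F j x‖ₑ ^ p ∂μ) atTop (𝓝 (∫⁻ x, ‖G x‖ₑ ^ p ∂μ)) := by
  have hp0 : 0 < p := by linarith
  have h := (tendsto_eLpNorm_of_sub (by simpa using hp) hF hG hFG).ennrpow_const p
  simpa only [eLpNorm_ofReal_rpow hp0] using h

theorem tendsto_integral_of_eLpNorm_sub {F : ℕ → α → ℝ} {G : α → ℝ}
    (hF : ∀ j, Integrable (F j) μ) (hG : Integrable G μ)
    (hFG : Tendsto (fun j => eLpNorm (F j - G) 1 μ) atTop (𝓝 0)) :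
    Tendsto (fun j => ∫ x, F j x ∂μ) atTop (𝓝 (∫ x, G x ∂μ)) :=
  tendsto_integral_of_L1' G hG.1 (Eventually.of_forall hF) hFG

end LpLimits

/-! ### Coordinate derivatives in terms of the Fréchet derivative -/

section Derivatives

open Function

variable {n : ℕ}

theorem partialDeriv_eq_fderiv {f : (Fin n → ℝ) → ℝ} {x : Fin n → ℝ}
    (hf : DifferentiableAt ℝ f x) (i : Fin n) :
    partialDeriv i f x = fderiv ℝ f x (Pi.single i 1) := by
  have h1 : HasFDerivAt f (fderiv ℝ f x) (update x i (x i)) := by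
    rw [update_eq_self]; exact hf.hasFDerivAt
  exact (h1.comp_hasDerivAt (x i) (hasDerivAt_update x i (x i))).deriv

theorem spaceDeriv_eq_fderiv {f : (Fin n → ℝ) × ℝ → ℝ} {z : (Fin n → ℝ) × ℝ}
    (hf : DifferentiableAt ℝ f z) (i : Fin n) :
    spaceDeriv i f z = fderiv ℝ f z (Pi.single i 1, 0) := by
  have h0 : HasFDerivAt (fun x : Fin n → ℝ => (x, z.2))
      ((ContinuousLinearMap.id ℝ _).prod 0) z.1 :=
    (hasFDerivAt_id z.1).prodMk (hasFDerivAt_const z.2 z.1)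
  have h1 : HasFDerivAt f (fderiv ℝ f z) (z.1, z.2) := hf.hasFDerivAt
  have h2 : HasFDerivAt (fun x => f (x, z.2)) _ z.1 := h1.comp z.1 h0
  rw [spaceDeriv, partialDeriv_eq_fderiv h2.differentiableAt, h2.fderiv]
  simp

theorem timeDeriv_eq_fderiv {f : (Fin n → ℝ) × ℝ → ℝ} {z : (Fin n → ℝ) × ℝ}
    (hf : DifferentiableAt ℝ f z) : timeDeriv f z = fderiv ℝ f z (0, 1) := by
  have h1 : HasFDerivAt f (fderiv ℝ f z) (z.1, z.2) := hf.hasFDerivAt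
  exact (h1.comp_hasDerivAt z.2 ((hasDerivAt_const z.2 z.1).prodMk (hasDerivAt_id z.2))).deriv

end Derivatives

/-! ### The Gagliardo-Nirenberg inequality for truncations of weakly differentiable functions -/

section Slice

open Filter Function
open scoped Topology

variable {n : ℕ}

theorem eq_zero_of_notMem_tsupport {X : Type*} [TopologicalSpace X] {f : X → ℝ} {x : X}
    (hx : x ∉ tsupport f) : f x = 0 := image_eq_zero_of_notMem_tsupport hx

theorem fderiv_eq_zero_of_notMem_tsupport {E : Type*} [NormedAddCommGroup E] [NormedSpace ℝ E]
    {f : E → ℝ} {x : E} (hx : x ∉ tsupport f) : fderiv ℝ f x = 0 :=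
  image_eq_zero_of_notMem_tsupport fun h => hx (tsupport_fderiv_subset ℝ h)

theorem IsTestFunction.mono {E : Type*} [NormedAddCommGroup E] [NormedSpace ℝ E] {U V : Set E}
    {φ : E → ℝ} (h : IsTestFunction U φ) (hUV : U ⊆ V) : IsTestFunction V φ :=
  ⟨h.1, h.2.1, h.2.2.trans hUV⟩

theorem MemLpLoc.integrable_indicator {E : Type*} [TopologicalSpace E] [T2Space E]
    [MeasureSpace E] [OpensMeasurableSpace E] {f : E → ℝ} {U K : Set E} (h : MemLpLoc f 1 U)
    (hK : IsCompact K) (hKU : K ⊆ U) : Integrable (K.indicator f) := by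
  rw [integrable_indicator_iff hK.measurableSet]
  exact memLp_one_iff_integrable.1 (h K hK hKU)

/-- The weak derivative of the restriction to a compact set `K`, tested in the interior of `K`. -/
theorem HasWeakPartialDeriv.integral_indicator {Ω : Set (Fin n → ℝ)} {i : Fin n}
    {f g : (Fin n → ℝ) → ℝ} (h : HasWeakPartialDeriv Ω i f g) {K : Set (Fin n → ℝ)}
    (hK : IsCompact K) (hKΩ : K ⊆ Ω) {η : (Fin n → ℝ) → ℝ}
    (hη : IsTestFunction (interior K) η) :
    ∫ x, (∑ _j : Unit, K.indicator f x * fderiv ℝ η x (Pi.single i 1) +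
      K.indicator g x * η x) = 0 := by
  have hd : Differentiable ℝ η := hη.1.differentiable (by simp)
  have hηK : ∀ x, x ∉ K → η x = 0 ∧ fderiv ℝ η x = 0 := fun x hx => by
    have : x ∉ tsupport η := fun hx' => hx (interior_subset (hη.2.2 hx'))
    exact ⟨eq_zero_of_notMem_tsupport this, fderiv_eq_zero_of_notMem_tsupport this⟩
  have h1 := h.2.2 η (hη.mono (interior_subset.trans hKΩ))
  rw [setIntegral_eq_integral_of_forall_compl_eq_zero,
    setIntegral_eq_integral_of_forall_compl_eq_zero] at h1
  · have e1 : ∀ x, K.indicator f x * fderiv ℝ η x (Pi.single i 1) = f x * partialDeriv i η x := by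
      intro x
      rw [partialDeriv_eq_fderiv hd.differentiableAt]
      by_cases hx : x ∈ K
      · rw [indicator_of_mem hx]
      · rw [(hηK x hx).2]; simp
    have e2 : ∀ x, K.indicator g x * η x = g x * η x := by
      intro x
      by_cases hx : x ∈ K
      · rw [indicator_of_mem hx]
      · rw [(hηK x hx).1]; simp
    have i1 : Integrable fun x => K.indicator f x * fderiv ℝ η x (Pi.single i 1) := by
      have hb := ((hη.2.1.fderiv ℝ).norm).exists_bound_of_continuous
        (hη.1.continuous_fderiv (by simp)).norm
      obtain ⟨B, hB⟩ := hb
      refine (h.1.integrable_indicator hK hKΩ).mul_bdd (c := B * ‖(Pi.single i 1 : Fin n → ℝ)‖)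
        ((hη.1.continuous_fderiv (by simp)).clm_apply continuous_const).aestronglyMeasurable
        (Eventually.of_forall fun x => ?_)
      refine (ContinuousLinearMap.le_opNorm _ _).trans ?_
      gcongr
      exact (le_abs_self _).trans (hB x)
    have i2 : Integrable fun x => K.indicator g x * η x := by
      obtain ⟨B, hB⟩ := hη.2.1.exists_bound_of_continuous hη.1.continuous
      exact (h.2.1.integrable_indicator hK hKΩ).mul_bdd (c := B)
        hη.1.continuous.aestronglyMeasurable (Eventually.of_forall hB)
    -- The sum over `Unit` is a single term; it is written as a sum to match the hypothesis of
    -- `sum_fderiv_mollify_eq`.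
    simp only [Finset.univ_unique, Finset.sum_const, Finset.card_singleton, one_smul]
    rw [integral_add i1 i2]
    simp only [e1, e2]
    linarith
  · intro x hx
    rw [(hηK x fun h => hx (hKΩ h)).1, mul_zero]
  · intro x hx
    rw [partialDeriv_eq_fderiv hd.differentiableAt, (hηK x fun h => hx (hKΩ h)).2]
    simp

/-- The inequality for C¹ functions is applied to truncations of mollifications of `f`, then the
mollification is removed. Bounded truncations with continuous derivative make this limit possible:
the factors in front of the mollified gradients are bounded and converge almost everywhere, while
the gradients converge in L^p. -/
theorem lintegral_softPos_mul_le {p : Fin n → ℝ} (hp : ∀ i, 1 < p i) {C : ℝ≥0∞} {q κ : ℝ}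
    (hq : 0 < q) (hκ : 0 ≤ κ) (hC : C ≠ ⊤)
    (hGN : ∀ f : (Fin n → ℝ) → ℝ, ContDiff ℝ 1 f → HasCompactSupport f →
      ∫⁻ x, ‖f x‖ₑ ^ q ≤ C * ((∫⁻ x, ‖f x‖ₑ ^ (2 : ℝ)) ^ κ *
          ∑ i, ∫⁻ x, ‖fderiv ℝ f x (Pi.single i 1)‖ₑ ^ p i))
    {Ω K : Set (Fin n → ℝ)} {f : (Fin n → ℝ) → ℝ} {g : Fin n → (Fin n → ℝ) → ℝ}
    (hfg : ∀ i, HasWeakPartialDeriv Ω i f (g i)) (hfm : MemLpLoc f 1 Ω)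
    (hK : IsCompact K) (hKΩ : K ⊆ Ω)
    (hg : ∀ i, MemLp (g i) (ENNReal.ofReal (p i)) (volume.restrict K))
    {ξ : (Fin n → ℝ) → ℝ} (hξ : IsTestFunction (interior K) ξ) (k : ℝ) (j : ℕ) :
    ∫⁻ x, ‖softPos k j (K.indicator f x) * ξ x‖ₑ ^ q ≤
      C * ((∫⁻ x, ‖softPos k j (K.indicator f x) * ξ x‖ₑ ^ (2 : ℝ)) ^ κ *
        ∑ i, ∫⁻ x, ‖softStep k j (K.indicator f x) * ξ x * K.indicator (g i) x +
          softPos k j (K.indicator f x) * fderiv ℝ ξ x (Pi.single i 1)‖ₑ ^ p i) := by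
  obtain ⟨φ, hφ, h'φ⟩ := exists_contDiffBump_seq (Fin n → ℝ)
  set U := K.indicator f with hU
  set G : Fin n → (Fin n → ℝ) → ℝ := fun i => K.indicator (g i) with hG
  have hUi : Integrable U := hfm.integrable_indicator hK hKΩ
  have hGp : ∀ i, MemLp (G i) (ENNReal.ofReal (p i)) volume := fun i =>
    (memLp_indicator_iff_restrict hK.measurableSet).2 (hg i)
  have hGi : ∀ i, Integrable (G i) := fun i => (hfg i).2.1.integrable_indicator hK hKΩ
  have hξ1 : ContDiff ℝ 1 ξ := hξ.1.of_le (by simp)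
  -- The first `N` mollifiers are discarded, so that on the support of `ξ` the mollification only
  -- sees the interior of `K`, where the weak derivative is available.
  obtain ⟨δ, hδ, hδK⟩ := hξ.2.1.isCompact.exists_cthickening_subset_open isOpen_interior hξ.2.2
  obtain ⟨N, hN⟩ := eventually_atTop.1 (hφ.eventually (gt_mem_nhds hδ))
  set Uh : ℕ → (Fin n → ℝ) → ℝ := fun h => mollify volume (φ (h + N)) U with hUh
  set Gh : ℕ → Fin n → (Fin n → ℝ) → ℝ := fun h i => mollify volume (φ (h + N)) (G i) with hGh
  have hφ' : Tendsto (fun h => (φ (h + N)).rOut) atTop (𝓝 0) := hφ.comp (tendsto_add_atTop_nat N)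
  have hUc : ∀ h, ContDiff ℝ 1 (Uh h) := fun h => contDiff_mollify _ hUi.locallyIntegrable
  have hGc : ∀ h i, Continuous (Gh h i) := fun h i =>
    (contDiff_mollify _ (hGi i).locallyIntegrable).continuous
  have hUae : ∀ᵐ x, Tendsto (fun h => Uh h x) atTop (𝓝 (U x)) :=
    ae_tendsto_mollify hφ' (fun h => h'φ _) hUi.locallyIntegrable
  have hGlim : ∀ i, Tendsto (fun h => eLpNorm (Gh h i - G i) (ENNReal.ofReal (p i)) volume) atTop
      (𝓝 0) := fun i => tendsto_eLpNorm_mollify_sub hφ' (hp i).le (hGp i)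
  have hder : ∀ h i x, x ∈ tsupport ξ → fderiv ℝ (Uh h) x (Pi.single i 1) = Gh h i x := by
    intro h i x hx
    have h1 := sum_fderiv_mollify_eq (μ := volume) (W := interior K) (F := fun _ : Unit => U)
      (g := G i) (v := fun _ => Pi.single i 1) (fun _ => hUi) (hGi i)
      (fun η hη => (hfg i).integral_indicator hK hKΩ hη) (φ (h + N)) (x := x) ?_
    · simpa using h1
    · refine subset_trans ?_ hδK
      refine (Metric.closedBall_subset_closedBall (hN (h + N) (by omega)).le).trans ?_
      exact Metric.closedBall_subset_cthickening hx δ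
  set v : ℕ → (Fin n → ℝ) → ℝ := fun h x => softPos k j (Uh h x) * ξ x with hv
  have hvc : ∀ h, ContDiff ℝ 1 (v h) := fun h => ((contDiff_softPos k j).comp (hUc h)).mul hξ1
  have hvs : ∀ h, HasCompactSupport (v h) := fun h => hξ.2.1.mul_left
  have hvd : ∀ h i x, fderiv ℝ (v h) x (Pi.single i 1) =
      softStep k j (Uh h x) * ξ x * Gh h i x +
        softPos k j (Uh h x) * fderiv ℝ ξ x (Pi.single i 1) := by
    intro h i x
    have h1 : HasFDerivAt (fun x => softPos k j (Uh h x))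
        (softStep k j (Uh h x) • fderiv ℝ (Uh h) x) x :=
      (hasDerivAt_softPos k j _).comp_hasFDerivAt x
        ((hUc h).differentiable one_ne_zero).differentiableAt.hasFDerivAt
    have h2 : HasFDerivAt ξ (fderiv ℝ ξ x) x :=
      (hξ1.differentiable one_ne_zero).differentiableAt.hasFDerivAt
    have h3 : fderiv ℝ (v h) x = _ := (h1.mul h2).fderiv
    rw [h3]
    simp only [add_apply, smul_apply, smul_eq_mul]
    -- Away from the support of `ξ` the gradient of the mollification is not identified, but there
    -- it is multiplied by 0.
    by_cases hx : x ∈ tsupport ξ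
    · rw [hder h i x hx]; ring
    · rw [eq_zero_of_notMem_tsupport hx]; ring
  have hξB := hξ.2.1.exists_bound_of_continuous hξ.1.continuous
  obtain ⟨B, hB⟩ := hξB
  have hlimv : ∀ r : ℝ, 0 < r → Tendsto (fun h => ∫⁻ x, ‖v h x‖ₑ ^ r) atTop
      (𝓝 (∫⁻ x, ‖softPos k j (U x) * ξ x‖ₑ ^ r)) ∧
      ∫⁻ x, ‖softPos k j (U x) * ξ x‖ₑ ^ r ≠ ⊤ := by
    intro r hr
    have hbd : ∀ s x, ‖softPos k j s * ξ x‖ₑ ^ r ≤ ENNReal.ofReal ((((j : ℝ) + 1) * ‖ξ x‖) ^ r) := by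
      intro s x
      rw [← ENNReal.ofReal_rpow_of_nonneg (by positivity) hr.le]
      refine ENNReal.rpow_le_rpow ?_ hr.le
      rw [← ofReal_norm]
      refine ENNReal.ofReal_le_ofReal ?_
      rw [norm_mul, Real.norm_of_nonneg (softPos_nonneg k j s)]
      exact mul_le_mul_of_nonneg_right (softPos_le_const k j s) (norm_nonneg _)
    have hfin : ∫⁻ x, ENNReal.ofReal ((((j : ℝ) + 1) * ‖ξ x‖) ^ r) ≠ ⊤ := by
      refine (Continuous.integrable_of_hasCompactSupport ?_ ?_).lintegral_lt_top.ne
      · exact (continuous_const.mul hξ.1.continuous.norm).rpow_const fun _ => Or.inr hr.le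
      · refine hξ.2.1.comp_left (g := fun y : ℝ => (((j : ℝ) + 1) * ‖y‖) ^ r) ?_
        simp [Real.zero_rpow hr.ne']
    refine ⟨?_, ne_top_of_le_ne_top hfin (lintegral_mono fun x => hbd _ x)⟩
    refine tendsto_lintegral_of_dominated_convergence' _
      (fun h => ((hvc h).continuous.aestronglyMeasurable.enorm.pow_const r))
      (fun h => Eventually.of_forall fun x => hbd _ x) hfin ?_
    filter_upwards [hUae] with x hx
    refine Tendsto.ennrpow_const r (Tendsto.enorm ?_)
    exact (((continuous_softPos k j).tendsto _).comp hx).mul_const _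
  have hlimD : ∀ i, Tendsto (fun h => ∫⁻ x, ‖fderiv ℝ (v h) x (Pi.single i 1)‖ₑ ^ p i) atTop
      (𝓝 (∫⁻ x, ‖softStep k j (U x) * ξ x * G i x +
          softPos k j (U x) * fderiv ℝ ξ x (Pi.single i 1)‖ₑ ^ p i)) ∧
      ∫⁻ x, ‖softStep k j (U x) * ξ x * G i x +
          softPos k j (U x) * fderiv ℝ ξ x (Pi.single i 1)‖ₑ ^ p i ≠ ⊤ := by
    intro i
    have hp0 : 0 < p i := by linarith [hp i]
    have hp1 : (1 : ℝ≥0∞) ≤ ENNReal.ofReal (p i) := by simpa using (hp i).le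
    have hdc : Continuous fun x => fderiv ℝ ξ x (Pi.single i 1) :=
      (hξ1.continuous_fderiv one_ne_zero).clm_apply continuous_const
    have hds : HasCompactSupport fun x => fderiv ℝ ξ x (Pi.single i 1) :=
      (hξ.2.1.fderiv ℝ).comp_left (g := fun L : (Fin n → ℝ) →L[ℝ] ℝ => L (Pi.single i 1)) (by simp)
    have hdp : MemLp (fun x => fderiv ℝ ξ x (Pi.single i 1)) (ENNReal.ofReal (p i)) volume :=
      hdc.memLp_of_hasCompactSupport hds
    have c1m : ∀ h, AEStronglyMeasurable (fun x => softStep k j (Uh h x) * ξ x) volume := fun h =>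
      (((continuous_softStep k j).comp (hUc h).continuous).mul
        hξ.1.continuous).aestronglyMeasurable
    have c2m : ∀ h, AEStronglyMeasurable (fun x => softPos k j (Uh h x)) volume := fun h =>
      ((continuous_softPos k j).comp (hUc h).continuous).aestronglyMeasurable
    have l1 := tendsto_eLpNorm_mul_sub (hp i).le (F := fun h => Gh h i) (G := G i)
      (c := fun h x => softStep k j (Uh h x) * ξ x) (d := fun x => softStep k j (U x) * ξ x)
      (M := B) (fun h => (hGc h i).aestronglyMeasurable) (hGp i) c1m (fun h x => by
        rw [abs_mul, abs_of_nonneg (softStep_nonneg k j _)]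
        exact (mul_le_of_le_one_left (abs_nonneg _) (softStep_le_one k j _)).trans (hB x))
      (hGlim i) (by
        filter_upwards [hUae] with x hx
        exact (((continuous_softStep k j).tendsto _).comp hx).mul_const _)
    have l2 := tendsto_eLpNorm_mul_sub (μ := volume) (hp i).le
      (F := fun _ x => fderiv ℝ ξ x (Pi.single i 1)) (G := fun x => fderiv ℝ ξ x (Pi.single i 1))
      (c := fun h x => softPos k j (Uh h x)) (d := fun x => softPos k j (U x))
      (M := (j : ℝ) + 1) (fun h => hdc.aestronglyMeasurable) hdp c2m (fun h x => by
        rw [abs_of_nonneg (softPos_nonneg k j _)]; exact softPos_le_const k j _)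
      (by simp) (by
        filter_upwards [hUae] with x hx
        exact ((continuous_softPos k j).tendsto _).comp hx)
    have hUm := hUi.aestronglyMeasurable
    have m1 : MemLp ((fun x => softStep k j (U x) * ξ x) * G i) (ENNReal.ofReal (p i)) volume := by
      refine (hGp i).of_le_mul (c := B) ((((continuous_softStep k j).comp_aestronglyMeasurable
        hUm).mul hξ.1.continuous.aestronglyMeasurable).mul (hGp i).1)
        (Eventually.of_forall fun x => ?_)
      rw [Pi.mul_apply, norm_mul]
      refine mul_le_mul_of_nonneg_right ?_ (norm_nonneg _)
      rw [norm_mul, Real.norm_of_nonneg (softStep_nonneg k j _)]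
      exact (mul_le_of_le_one_left (norm_nonneg _) (softStep_le_one k j _)).trans (hB x)
    have m2 : MemLp ((fun x => softPos k j (U x)) * fun x => fderiv ℝ ξ x (Pi.single i 1))
        (ENNReal.ofReal (p i)) volume := by
      refine hdp.of_le_mul (c := (j : ℝ) + 1) (((continuous_softPos k j).comp_aestronglyMeasurable
        hUm).mul hdp.1) (Eventually.of_forall fun x => ?_)
      rw [Pi.mul_apply, norm_mul]
      refine mul_le_mul_of_nonneg_right ?_ (norm_nonneg _)
      rw [Real.norm_of_nonneg (softPos_nonneg k j _)]
      exact softPos_le_const k j _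
    have l3 := l1.add l2
    rw [add_zero] at l3
    have hFm : ∀ h, AEStronglyMeasurable (fun x => fderiv ℝ (v h) x (Pi.single i 1)) volume :=
      fun h => (((hvc h).continuous_fderiv one_ne_zero).clm_apply
        continuous_const).aestronglyMeasurable
    have m3 := m1.add m2
    have l4 : Tendsto (fun h => eLpNorm ((fun x => fderiv ℝ (v h) x (Pi.single i 1)) -
        ((fun x => softStep k j (U x) * ξ x) * G i +
          (fun x => softPos k j (U x)) * fun x => fderiv ℝ ξ x (Pi.single i 1)))
        (ENNReal.ofReal (p i)) volume) atTop (𝓝 0) := by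
      refine tendsto_of_tendsto_of_tendsto_of_le_of_le tendsto_const_nhds l3 (fun _ => zero_le)
        fun h => ?_
      refine le_trans (le_of_eq ?_) (eLpNorm_add_le
        (((c1m h).mul (hGc h i).aestronglyMeasurable).sub m1.1)
        (((c2m h).mul hdc.aestronglyMeasurable).sub m2.1) hp1)
      congr 1
      ext x
      simp only [Pi.sub_apply, Pi.add_apply, Pi.mul_apply, hvd]
      ring
    refine ⟨tendsto_lintegral_rpow_of_sub (hp i).le hFm m3 l4, ?_⟩
    have := (ENNReal.rpow_lt_top_of_nonneg hp0.le m3.2.ne).ne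
    rwa [eLpNorm_ofReal_rpow hp0] at this
  refine le_of_tendsto_of_tendsto' (hlimv q hq).1 ?_ fun h => hGN (v h) (hvc h) (hvs h)
  refine ENNReal.Tendsto.const_mul ?_ (Or.inr hC)
  refine ENNReal.Tendsto.mul ((hlimv 2 two_pos).1.ennrpow_const κ) (Or.inr ?_)
    (tendsto_finsetSum _ fun i _ => (hlimD i).1) (Or.inr ?_)
  · exact ENNReal.sum_ne_top.2 fun i _ => (hlimD i).2
  · exact ENNReal.rpow_ne_top_of_nonneg hκ (hlimv 2 two_pos).2

/-- The anisotropic Gagliardo-Nirenberg inequality for truncations `(f - k)₊ ξ` of weakly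
differentiable functions. -/
theorem exists_gagliardo_nirenberg_posPart (hn : 2 ≤ n) {p : Fin n → ℝ} (hp : ∀ i, 1 < p i)
    (hpn : harmonicAvg p < n) :
    ∃ C : ℝ≥0∞, C ≠ ⊤ ∧ ∀ {Ω K : Set (Fin n → ℝ)} {f : (Fin n → ℝ) → ℝ}
      {g : Fin n → (Fin n → ℝ) → ℝ}, (∀ i, HasWeakPartialDeriv Ω i f (g i)) →
      IsCompact K → K ⊆ Ω →
      (∀ i, MemLp (g i) (ENNReal.ofReal (p i)) (volume.restrict K)) →
      ∀ {ξ : (Fin n → ℝ) → ℝ}, IsTestFunction (interior K) ξ → ∀ k : ℝ,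
      ∫⁻ x, ENNReal.ofReal (max (f x - k) 0 * |ξ x|) ^ (harmonicAvg p * (1 + 2 / n)) ≤
        C * ((∫⁻ x, ENNReal.ofReal (max (f x - k) 0 * |ξ x|) ^ (2 : ℝ)) ^ (harmonicAvg p / n) *
          ∑ i, ∫⁻ x, ENNReal.ofReal ({y | k < f y}.indicator 1 x * |ξ x| * |g i x| +
            max (f x - k) 0 * |fderiv ℝ ξ x (Pi.single i 1)|) ^ p i) := by
  obtain ⟨C, hC, hGN⟩ := exists_gagliardo_nirenberg hn hp hpn
  refine ⟨C, hC, fun {Ω K f g} hfg hK hKΩ hg {ξ} hξ k => ?_⟩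
  have hP0 : 0 < harmonicAvg p := harmonicAvg_pos (by omega) fun i => by linarith [hp i]
  have i₀ : Fin n := ⟨0, by omega⟩
  have hq : 0 < harmonicAvg p * (1 + 2 / n) := by positivity
  set q := harmonicAvg p * (1 + 2 / n) with hq_def
  set U := K.indicator f with hU
  have hUi : Integrable U := (hfg i₀).1.integrable_indicator hK hKΩ
  have hKξ : ∀ x, x ∉ K → ξ x = 0 ∧ fderiv ℝ ξ x = 0 := fun x hx => by
    have : x ∉ tsupport ξ := fun hx' => hx (interior_subset (hξ.2.2 hx'))
    exact ⟨eq_zero_of_notMem_tsupport this, fderiv_eq_zero_of_notMem_tsupport this⟩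
  have hle : ∀ j x, ‖softPos k j (U x) * ξ x‖ₑ ≤ ENNReal.ofReal (max (f x - k) 0 * |ξ x|) := by
    intro j x
    rw [← ofReal_norm]
    refine ENNReal.ofReal_le_ofReal ?_
    by_cases hx : x ∈ K
    · rw [norm_mul, Real.norm_of_nonneg (softPos_nonneg k j _), hU, indicator_of_mem hx]
      exact mul_le_mul_of_nonneg_right (softPos_le k j _) (norm_nonneg _)
    · rw [(hKξ x hx).1]; simp
  have hlim : ∀ x, Tendsto (fun j => ‖softPos k j (U x) * ξ x‖ₑ ^ q) atTop
      (𝓝 (ENNReal.ofReal (max (f x - k) 0 * |ξ x|) ^ q)) := by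
    intro x
    refine Tendsto.ennrpow_const q ?_
    have e : ENNReal.ofReal (max (f x - k) 0 * |ξ x|) = ‖max (U x - k) 0 * ξ x‖ₑ := by
      rw [← ofReal_norm, norm_mul, Real.norm_of_nonneg (le_max_right _ _)]
      by_cases hx : x ∈ K
      · rw [hU, indicator_of_mem hx]; rfl
      · rw [(hKξ x hx).1]; simp
    rw [e]
    exact ((tendsto_softPos k (U x)).mul_const _).enorm
  -- Only the left side needs a limit in `j`, and Fatou's lemma gives the right direction; on the
  -- right each truncation is bounded by the full positive part, uniformly in `j`.
  have hfatou : ∫⁻ x, ENNReal.ofReal (max (f x - k) 0 * |ξ x|) ^ q ≤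
      liminf (fun j => ∫⁻ x, ‖softPos k j (U x) * ξ x‖ₑ ^ q) atTop := by
    have := lintegral_liminf_le' (μ := volume) (u := atTop) (f := fun j x => ‖softPos k j (U x) * ξ x‖ₑ ^ q)
      fun j => ((((continuous_softPos k j).comp_aestronglyMeasurable
        hUi.aestronglyMeasurable).mul hξ.1.continuous.aestronglyMeasurable).enorm.pow_const q)
    refine le_trans (le_of_eq (lintegral_congr fun x => ?_)) this
    exact (hlim x).liminf_eq.symm
  refine hfatou.trans (liminf_le_of_le (by isBoundedDefault) fun b hb => ?_)
  obtain ⟨j, hj⟩ := hb.exists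
  refine hj.trans ((lintegral_softPos_mul_le hp hq (by positivity) hC hGN hfg (hfg i₀).1 hK hKΩ hg
    hξ k j).trans ?_)
  gcongr with x i _ x
  · exact hle j x
  · linarith [hp i]
  · rw [← ofReal_norm]
    refine ENNReal.ofReal_le_ofReal ?_
    by_cases hx : x ∈ K
    · simp only [indicator_of_mem hx]
      refine (norm_add_le _ _).trans ?_
      simp only [norm_mul, Real.norm_of_nonneg (softPos_nonneg k j _),
        Real.norm_of_nonneg (softStep_nonneg k j _), Real.norm_eq_abs]
      gcongr
      · exact softStep_le_indicator k j _
      · exact softPos_le k j _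
    · rw [(hKξ x hx).1, (hKξ x hx).2]; simp

end Slice

/-! ### Cut-off functions between nested cylinders -/

section Cutoffs

open Function

/-- exp(-1/x)^p = exp(-1/(x/p)): a positive power only rescales the argument and so remains smooth
at 0. -/
theorem expNegInvGlue_rpow {p : ℝ} (hp : 0 < p) (x : ℝ) :
    expNegInvGlue x ^ p = expNegInvGlue (x / p) := by
  rcases le_or_gt x 0 with hx | hx
  · rw [expNegInvGlue.zero_of_nonpos hx, Real.zero_rpow hp.ne',
      expNegInvGlue.zero_of_nonpos (div_nonpos_of_nonpos_of_nonneg hx hp.le)]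
  · have h : 0 < x / p := div_pos hx hp
    rw [expNegInvGlue, if_neg hx.not_ge, expNegInvGlue, if_neg h.not_ge, ← Real.exp_mul]
    congr 1
    field_simp

/-- A real power of a smooth function may lose smoothness at its zeros. For this profile it does
not, which is what allows the factors η^{p_i} of the admissible cut-offs to be smooth. -/
theorem contDiff_smoothTransition_rpow {p : ℝ} (hp : 0 < p) :
    ContDiff ℝ ∞ fun x => Real.smoothTransition x ^ p := by
  have h : (fun x => Real.smoothTransition x ^ p) = fun x => expNegInvGlue (x / p) /
      (expNegInvGlue x + expNegInvGlue (1 - x)) ^ p := by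
    funext x
    rw [Real.smoothTransition, Real.div_rpow (expNegInvGlue.nonneg x)
      (Real.smoothTransition.pos_denom x).le, expNegInvGlue_rpow hp]
  rw [h]
  have hd : ContDiff ℝ ∞ fun x => expNegInvGlue x + expNegInvGlue (1 - x) :=
    expNegInvGlue.contDiff.add (expNegInvGlue.contDiff.comp (contDiff_const.sub contDiff_id))
  refine ContDiff.div (expNegInvGlue.contDiff.comp (contDiff_id.div_const p))
    (hd.rpow_const_of_ne fun x => (Real.smoothTransition.pos_denom x).ne') fun x => ?_
  exact (Real.rpow_pos_of_pos (Real.smoothTransition.pos_denom x) p).ne'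

theorem exists_deriv_smoothTransition_le :
    ∃ M : ℝ, 1 ≤ M ∧ ∀ x, |deriv Real.smoothTransition x| ≤ M := by
  have hc : Continuous (deriv Real.smoothTransition) :=
    (Real.smoothTransition.contDiff (n := 1)).continuous_deriv le_rfl
  obtain ⟨M, hM⟩ := (isCompact_Icc (a := (0 : ℝ)) (b := 1)).exists_bound_of_continuousOn
    hc.continuousOn
  refine ⟨max M 1, le_max_right _ _, fun x => ?_⟩
  by_cases hx : x ∈ Icc (0 : ℝ) 1
  · exact (hM x hx).trans (le_max_left _ _)
  · have h0 : deriv Real.smoothTransition x = 0 := by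
      rw [mem_Icc, not_and_or, not_le, not_le] at hx
      rcases hx with hx | hx
      · have : Real.smoothTransition =ᶠ[nhds x] fun _ => 0 := by
          filter_upwards [Iio_mem_nhds hx] with y hy
          exact Real.smoothTransition.zero_of_nonpos (le_of_lt hy)
        rw [this.deriv_eq, deriv_const]
      · have : Real.smoothTransition =ᶠ[nhds x] fun _ => 1 := by
          filter_upwards [Ioi_mem_nhds hx] with y hy
          exact Real.smoothTransition.one_of_one_le (le_of_lt hy)
        rw [this.deriv_eq, deriv_const]
    rw [h0, abs_zero]
    exact zero_le_one.trans (le_max_right _ _)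

/-- A smooth function that equals `1` on `[-a, a]` and vanishes outside `[-b, b]`. -/
def plateau (a b s : ℝ) : ℝ :=
  Real.smoothTransition ((b - s) / (b - a)) * Real.smoothTransition ((b + s) / (b - a))

variable {a b : ℝ}

theorem contDiff_plateau_rpow {p : ℝ} (hp : 0 < p) : ContDiff ℝ ∞ fun s => plateau a b s ^ p := by
  have h : (fun s => plateau a b s ^ p) = fun s =>
      Real.smoothTransition ((b - s) / (b - a)) ^ p *
        Real.smoothTransition ((b + s) / (b - a)) ^ p := by
    funext s
    exact Real.mul_rpow (Real.smoothTransition.nonneg _) (Real.smoothTransition.nonneg _)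
  rw [h]
  exact ((contDiff_smoothTransition_rpow hp).comp
    ((contDiff_const.sub contDiff_id).div_const _)).mul
    ((contDiff_smoothTransition_rpow hp).comp ((contDiff_const.add contDiff_id).div_const _))

theorem contDiff_plateau : ContDiff ℝ ∞ (plateau a b) := by
  simpa using contDiff_plateau_rpow (a := a) (b := b) one_pos

theorem plateau_mem_Icc (s : ℝ) : plateau a b s ∈ Icc (0 : ℝ) 1 :=
  ⟨mul_nonneg (Real.smoothTransition.nonneg _) (Real.smoothTransition.nonneg _),
    mul_le_one₀ (Real.smoothTransition.le_one _) (Real.smoothTransition.nonneg _)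
      (Real.smoothTransition.le_one _)⟩

theorem plateau_eq_one (hab : a < b) {s : ℝ} (hs : |s| ≤ a) : plateau a b s = 1 := by
  rw [abs_le] at hs
  rw [plateau, Real.smoothTransition.one_of_one_le, Real.smoothTransition.one_of_one_le, one_mul]
  · rw [le_div_iff₀ (by linarith)]; linarith
  · rw [le_div_iff₀ (by linarith)]; linarith

theorem plateau_eq_zero (hab : a < b) {s : ℝ} (hs : b ≤ |s|) : plateau a b s = 0 := by
  rw [plateau, mul_eq_zero]
  rcases le_abs.1 hs with hs | hs
  · left
    exact Real.smoothTransition.zero_of_nonpos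
      (div_nonpos_of_nonpos_of_nonneg (by linarith) (by linarith))
  · right
    exact Real.smoothTransition.zero_of_nonpos
      (div_nonpos_of_nonpos_of_nonneg (by linarith) (by linarith))

theorem abs_deriv_plateau_le (hab : a < b) {M : ℝ}
    (hM : ∀ x, |deriv Real.smoothTransition x| ≤ M) (s : ℝ) :
    |deriv (plateau a b) s| ≤ 2 * M / (b - a) := by
  have hba : 0 < b - a := by linarith
  have hd : ∀ x, HasDerivAt Real.smoothTransition (deriv Real.smoothTransition x) x := fun x =>
    ((Real.smoothTransition.contDiff (n := 1)).differentiable one_ne_zero).differentiableAt.hasDerivAt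
  have h1 : HasDerivAt (fun s => (b - s) / (b - a)) (-1 / (b - a)) s :=
    ((hasDerivAt_id s).const_sub b).div_const _
  have h2 : HasDerivAt (fun s => (b + s) / (b - a)) (1 / (b - a)) s :=
    ((hasDerivAt_id s).const_add b).div_const _
  have h3 : HasDerivAt (plateau a b) _ s := ((hd _).comp s h1).mul ((hd _).comp s h2)
  rw [h3.deriv]
  have key : ∀ x y : ℝ, |deriv Real.smoothTransition x * (1 / (b - a)) *
      Real.smoothTransition y| ≤ M / (b - a) := fun x y => by
    rw [abs_mul, abs_mul, abs_of_nonneg (Real.smoothTransition.nonneg y),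
      abs_of_pos (one_div_pos.2 hba), mul_one_div]
    exact (mul_le_of_le_one_right (by positivity) (Real.smoothTransition.le_one y)).trans
      (div_le_div_of_nonneg_right (hM x) hba.le)
  have k1 := key ((b - s) / (b - a)) ((b + s) / (b - a))
  have k2 := key ((b + s) / (b - a)) ((b - s) / (b - a))
  rw [abs_le] at k1 k2 ⊢
  have e : 2 * M / (b - a) = M / (b - a) + M / (b - a) := by ring
  have e2 : ∀ x : ℝ, x * (-1 / (b - a)) = -(x * (1 / (b - a))) := fun x => by ring
  simp only [comp_apply, e, e2]
  constructor <;> nlinarith [k1.1, k1.2, k2.1, k2.2]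

theorem deriv_plateau_eq_zero (hab : a < b) {s : ℝ} (hs : b < |s|) :
    deriv (plateau a b) s = 0 := by
  have : plateau a b =ᶠ[nhds s] fun _ => 0 := by
    filter_upwards [continuous_abs.continuousAt.eventually (lt_mem_nhds hs)] with y hy
    exact plateau_eq_zero hab (le_of_lt hy)
  rw [this.deriv_eq, deriv_const]

variable {n : ℕ}

/-- The half side lengths of the boxes that shrink from `K_{2ρ}` to `K_ρ`. -/
def nestedRadius (p : Fin n → ℝ) (ρ : ℝ) (j : ℕ) (i : Fin n) : ℝ :=
  ρ ^ (1 / p i) * (1 + (2 ^ (1 / p i) - 1) * (1 / 2) ^ j)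

/-- A decreasing sequence of cylinders between `Q_{2ρ}(x₀, t₀)` and `Q_ρ(x₀, t₀)`. -/
def nestedCyl (p : Fin n → ℝ) (x₀ : Fin n → ℝ) (t₀ ρ : ℝ) (j : ℕ) : Set ((Fin n → ℝ) × ℝ) :=
  (Set.univ.pi fun i => Ioo (x₀ i - nestedRadius p ρ j i) (x₀ i + nestedRadius p ρ j i)) ×ˢ
    Ioo (t₀ - ρ * (1 + (1 / 2) ^ j)) t₀

theorem one_lt_two_rpow_one_div {p : ℝ} (hp : 0 < p) : 1 < (2 : ℝ) ^ (1 / p) :=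
  Real.one_lt_rpow one_lt_two (by positivity)

variable {p : Fin n → ℝ} {ρ : ℝ}

theorem nestedRadius_zero (hρ : 0 < ρ) (i : Fin n) :
    nestedRadius p ρ 0 i = (2 * ρ) ^ (1 / p i) := by
  rw [nestedRadius, Real.mul_rpow two_pos.le hρ.le]; ring

theorem nestedRadius_antitone (hp : ∀ i, 1 < p i) (hρ : 0 < ρ) (i : Fin n) :
    Antitone fun j => nestedRadius p ρ j i := by
  intro j l hjl
  have h1 := one_lt_two_rpow_one_div (by linarith [hp i] : 0 < p i)
  have h2 : ((1 : ℝ) / 2) ^ l ≤ (1 / 2) ^ j :=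
    pow_le_pow_of_le_one (by norm_num) (by norm_num) hjl
  have h3 := Real.rpow_pos_of_pos hρ (1 / p i)
  refine mul_le_mul_of_nonneg_left ?_ h3.le
  have := mul_le_mul_of_nonneg_left h2 (by linarith : 0 ≤ (2 : ℝ) ^ (1 / p i) - 1)
  linarith

theorem le_nestedRadius (hp : ∀ i, 1 < p i) (hρ : 0 < ρ) (j : ℕ) (i : Fin n) :
    ρ ^ (1 / p i) ≤ nestedRadius p ρ j i := by
  have h1 := one_lt_two_rpow_one_div (by linarith [hp i] : 0 < p i)
  have h3 := Real.rpow_pos_of_pos hρ (1 / p i)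
  refine le_mul_of_one_le_right h3.le ?_
  have : 0 ≤ (2 ^ (1 / p i) - 1) * ((1 : ℝ) / 2) ^ j := mul_nonneg (by linarith) (by positivity)
  linarith

theorem measurableSet_nestedCyl (x₀ : Fin n → ℝ) (t₀ : ℝ) (j : ℕ) :
    MeasurableSet (nestedCyl p x₀ t₀ ρ j) :=
  (MeasurableSet.univ_pi fun _ => measurableSet_Ioo).prod measurableSet_Ioo

theorem nestedCyl_antitone (hp : ∀ i, 1 < p i) (hρ : 0 < ρ) (x₀ : Fin n → ℝ) (t₀ : ℝ) :
    Antitone (nestedCyl p x₀ t₀ ρ) := by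
  intro j l hjl
  have h2 : ((1 : ℝ) / 2) ^ l ≤ (1 / 2) ^ j :=
    pow_le_pow_of_le_one (by norm_num) (by norm_num) hjl
  refine prod_mono (pi_mono fun i _ => ?_) (Ioo_subset_Ioo_left ?_)
  · have := nestedRadius_antitone hp hρ i hjl
    exact Ioo_subset_Ioo (by simp only at this; linarith) (by simp only at this; linarith)
  · nlinarith

theorem nestedCyl_zero (hρ : 0 < ρ) (x₀ : Fin n → ℝ) (t₀ : ℝ) :
    nestedCyl p x₀ t₀ ρ 0 = cyl p x₀ t₀ (2 * ρ) := by
  unfold nestedCyl cyl box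
  simp only [nestedRadius_zero hρ]
  norm_num [mul_comm]

theorem cyl_subset_nestedCyl (hp : ∀ i, 1 < p i) (hρ : 0 < ρ) (x₀ : Fin n → ℝ) (t₀ : ℝ) (j : ℕ) :
    cyl p x₀ t₀ ρ ⊆ nestedCyl p x₀ t₀ ρ j := by
  refine prod_mono (pi_mono fun i _ => ?_) (Ioo_subset_Ioo_left ?_)
  · have := le_nestedRadius hp hρ j i
    exact Ioo_subset_Ioo (by linarith) (by linarith)
  · have : 0 < ((1 : ℝ) / 2) ^ j := by positivity
    nlinarith

/-- The gaps between consecutive cylinders are of order ρ^{1/p_i} 2⁻ʲ in space and ρ 2⁻ʲ in time.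
Hence derivatives, raised to the power p_i < 2 in space, are at most of order 4ʲ/ρ: the anisotropic
scaling makes ρ appear to the same power in every direction and in time. -/
theorem exists_cutoff (hp : ∀ i, 1 < p i) (hp2 : ∀ i, p i < 2) :
    ∃ M : ℝ, 1 ≤ M ∧ ∀ (x₀ : Fin n → ℝ) (t₀ ρ : ℝ), 0 < ρ → ∀ j : ℕ,
      ∃ ζ : (Fin n → ℝ) × ℝ → ℝ, IsCutoff p x₀ t₀ (2 * ρ) ζ ∧
        (∀ z, 0 ≤ ζ z ∧ ζ z ≤ 1) ∧
        (∀ z ∈ nestedCyl p x₀ t₀ ρ (j + 1), ζ z = 1) ∧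
        (∀ z ∈ cyl p x₀ t₀ (2 * ρ), z ∉ nestedCyl p x₀ t₀ ρ j → ζ z = 0 ∧ timeDeriv ζ z = 0 ∧
          ∀ i, spaceDeriv i ζ z = 0 ∧ spaceDeriv i (fun y => ζ y ^ (1 / p i)) z = 0) ∧
        (∀ z, timeDeriv ζ z ≤ M * 4 ^ j / ρ ∧ ∀ i, |spaceDeriv i ζ z| ^ p i ≤ M * 4 ^ j / ρ ∧
          |spaceDeriv i (fun y => ζ y ^ (1 / p i)) z| ^ p i ≤ M * 4 ^ j / ρ) ∧
        ∀ t, tsupport (fun x => ζ (x, t)) ⊆ box p x₀ (2 * ρ) := by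
  obtain ⟨M, hM1, hM⟩ := exists_deriv_smoothTransition_le
  refine ⟨(128 * M) ^ 2, by nlinarith, fun x₀ t₀ ρ hρ j => ?_⟩
  set r := nestedRadius p ρ j with hr
  set r' := nestedRadius p ρ (j + 1) with hr'
  set h : ℝ := (1 / 2) ^ j with hh
  have hh0 : 0 < h := by positivity
  have hh1 : h ≤ 1 := pow_le_one₀ (by norm_num) (by norm_num)
  have hh2 : ((1 : ℝ) / 2) ^ (j + 1) = h / 2 := by rw [pow_succ]; ring
  have hl : ∀ i, 0 < ρ ^ (1 / p i) := fun i => Real.rpow_pos_of_pos hρ _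
  -- Since p_i < 2, 2^{1/p_i} ≥ √2 ≥ 5/4; the gap (2^{1/p_i} - 1)h/2 is therefore at least h/8
  -- uniformly in the exponents.
  have hgap : ∀ i, ρ ^ (1 / p i) * h / 8 ≤ r i - r' i := by
    intro i
    have h1 : (5 / 4 : ℝ) ≤ 2 ^ (1 / p i) := by
      have h2 : (2 : ℝ) ^ (1 / 2 : ℝ) ≤ 2 ^ (1 / p i) := by
        refine Real.rpow_le_rpow_of_exponent_le one_le_two ?_
        exact one_div_le_one_div_of_le (by linarith [hp i]) (hp2 i).le
      rw [← Real.sqrt_eq_rpow] at h2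
      have h3 : (5 / 4 : ℝ) ≤ √2 := Real.le_sqrt_of_sq_le (by norm_num)
      linarith
    simp only [hr, hr', nestedRadius, hh2, ← hh]
    have := mul_pos (hl i) hh0
    nlinarith
  have hr'0 : ∀ i, 0 < r' i := fun i => (hl i).trans_le (le_nestedRadius hp hρ _ i)
  -- The profile reaches 0 at the midpoint of the gap, so that its derivatives, too, vanish outside
  -- the larger box.
  set b : Fin n → ℝ := fun i => (r i + r' i) / 2 with hb
  have hab : ∀ i, r' i < b i := fun i => by
    have := mul_pos (hl i) hh0
    simp only [hb]; linarith [hgap i]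
  have hbr : ∀ i, b i < r i := fun i => by
    have := mul_pos (hl i) hh0
    simp only [hb]; linarith [hgap i]
  have hrL : ∀ i, r i ≤ (2 * ρ) ^ (1 / p i) := fun i => by
    rw [← nestedRadius_zero hρ]; exact nestedRadius_antitone hp hρ i (Nat.zero_le j)
  set η : Fin n → ℝ → ℝ := fun i s => plateau (r' i) (b i) (s - x₀ i) with hη
  have hηI : ∀ i s, η i s ∈ Icc (0 : ℝ) 1 := fun i s => plateau_mem_Icc _
  have hηc : ∀ i, ContDiff ℝ ∞ (η i) := fun i =>
    contDiff_plateau.comp (contDiff_id.sub contDiff_const)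
  have hηp : ∀ i, ContDiff ℝ ∞ fun s => η i s ^ p i := fun i =>
    (contDiff_plateau_rpow (by linarith [hp i])).comp (contDiff_id.sub contDiff_const)
  have hηs : ∀ i, tsupport (η i) ⊆ Icc (x₀ i - b i) (x₀ i + b i) := fun i => by
    refine closure_minimal (fun s hs => ?_) isClosed_Icc
    by_contra hne
    refine hs (plateau_eq_zero (hab i) ?_)
    by_contra hlt
    rw [not_le, abs_lt] at hlt
    exact hne ⟨by linarith [hlt.1], by linarith [hlt.2]⟩
  have hηd : ∀ i s, HasDerivAt (η i) (deriv (plateau (r' i) (b i)) (s - x₀ i)) s := fun i s => by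
    have h1 : HasDerivAt (plateau (r' i) (b i)) (deriv (plateau (r' i) (b i)) (s - x₀ i))
        (s - x₀ i) :=
      (contDiff_plateau.differentiable (by simp)).differentiableAt.hasDerivAt
    have h2 := h1.comp s ((hasDerivAt_id' s).sub_const (x₀ i))
    rwa [mul_one] at h2
  set d : Fin n → ℝ → ℝ := fun i s => deriv (plateau (r' i) (b i)) (s - x₀ i) with hd
  have hdB : ∀ i s, |d i s| ≤ 32 * M * 2 ^ j / ρ ^ (1 / p i) := fun i s => by
    refine (abs_deriv_plateau_le (hab i) hM _).trans ?_
    have e : b i - r' i = (r i - r' i) / 2 := by simp only [hb]; ring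
    have h2j : (2 : ℝ) ^ j = 1 / h := by rw [hh, one_div_pow, one_div_one_div]
    rw [e, h2j, div_le_div_iff₀ (by linarith [hab i]) (hl i)]
    have := hgap i
    have h4 : ρ ^ (1 / p i) ≤ 8 / h * (r i - r' i) := by
      rw [div_mul_eq_mul_div, le_div_iff₀ hh0]; linarith
    have : 2 * M * ρ ^ (1 / p i) ≤ 2 * M * (8 / h * (r i - r' i)) := by gcongr
    refine this.trans (le_of_eq ?_)
    field_simp; ring
  set A : ℝ := t₀ - ρ * (1 + h) with hA
  set B : ℝ := t₀ - ρ * (1 + h / 2) with hB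
  -- Likewise in time: the rise from 0 to 1 happens between the midpoint `m` and `B`, and everything
  -- vanishes up to time `A`.
  set m : ℝ := (A + B) / 2 with hm
  have hBm : B - m = ρ * h / 4 := by simp only [hm, hA, hB]; ring
  have hBm0 : 0 < B - m := by rw [hBm]; positivity
  have hAm : A < m := by simp only [hm]; simp only [hm] at hBm0; linarith
  set ψ : ℝ → ℝ := fun t => Real.smoothTransition ((t - m) / (B - m)) with hψ
  have hψc : ContDiff ℝ ∞ ψ :=
    Real.smoothTransition.contDiff.comp ((contDiff_id.sub contDiff_const).div_const _)
  have hψI : ∀ t, ψ t ∈ Icc (0 : ℝ) 1 := fun t =>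
    ⟨Real.smoothTransition.nonneg _, Real.smoothTransition.le_one _⟩
  have hψ0 : ∀ t, t ≤ m → ψ t = 0 := fun t ht =>
    Real.smoothTransition.zero_of_nonpos
      (div_nonpos_of_nonpos_of_nonneg (by linarith) hBm0.le)
  have hψ1 : ∀ t, B ≤ t → ψ t = 1 := fun t ht =>
    Real.smoothTransition.one_of_one_le (by rw [le_div_iff₀ hBm0]; linarith)
  have hψd : ∀ t, HasDerivAt ψ (deriv ψ t) t := fun t =>
    (hψc.differentiable (by simp)).differentiableAt.hasDerivAt
  have hψB : ∀ t, deriv ψ t ≤ 4 * M * 2 ^ j / ρ := fun t => by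
    have h1 : HasDerivAt Real.smoothTransition (deriv Real.smoothTransition ((t - m) / (B - m)))
        ((t - m) / (B - m)) :=
      ((Real.smoothTransition.contDiff (n := 1)).differentiable
        one_ne_zero).differentiableAt.hasDerivAt
    have h2 : HasDerivAt (fun t => (t - m) / (B - m)) (1 / (B - m)) t :=
      ((hasDerivAt_id t).sub_const m).div_const _
    have h3 : HasDerivAt ψ (deriv Real.smoothTransition ((t - m) / (B - m)) * (1 / (B - m))) t :=
      HasDerivAt.comp (h₂ := Real.smoothTransition) (h := fun t => (t - m) / (B - m)) t h1 h2
    have h2j : (2 : ℝ) ^ j = 1 / h := by rw [hh, one_div_pow, one_div_one_div]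
    rw [h3.deriv, hBm, h2j]
    have h4 := (le_abs_self _).trans (hM ((t - m) / (B - m)))
    rw [hBm] at h4
    calc _ ≤ M * (1 / (ρ * h / 4)) := by gcongr
      _ = _ := by field_simp
  set ζ : (Fin n → ℝ) × ℝ → ℝ := fun z => ψ z.2 * ∏ i, η i (z.1 i) ^ p i with hζ
  have hprodI : ∀ (s : Finset (Fin n)) (x : Fin n → ℝ),
      0 ≤ ∏ i ∈ s, η i (x i) ^ p i ∧ ∏ i ∈ s, η i (x i) ^ p i ≤ 1 := fun s x =>
    ⟨Finset.prod_nonneg fun i _ => Real.rpow_nonneg (hηI i _).1 _,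
      Finset.prod_le_one (fun i _ => Real.rpow_nonneg (hηI i _).1 _) fun i _ =>
        Real.rpow_le_one (hηI i _).1 (hηI i _).2 (by linarith [hp i])⟩
  have hζc : ContDiff ℝ ∞ ζ := by
    refine (hψc.comp contDiff_snd).mul (contDiff_prod fun i _ => ?_)
    exact (hηp i).comp ((contDiff_apply ℝ ℝ i).comp contDiff_fst)
  have hζI : ∀ z, 0 ≤ ζ z ∧ ζ z ≤ 1 := fun z =>
    ⟨mul_nonneg (hψI _).1 (hprodI _ _).1,
      mul_le_one₀ (hψI _).2 (hprodI _ _).1 (hprodI _ _).2⟩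
  -- the functions of one variable
  set c : Fin n → (Fin n → ℝ) × ℝ → ℝ := fun i z =>
    ψ z.2 * ∏ m ∈ Finset.univ.erase i, η m (z.1 m) ^ p m with hc
  have hcI : ∀ i z, 0 ≤ c i z ∧ c i z ≤ 1 := fun i z =>
    ⟨mul_nonneg (hψI _).1 (hprodI _ _).1,
      mul_le_one₀ (hψI _).2 (hprodI _ _).1 (hprodI _ _).2⟩
  have hupd : ∀ i z s, ζ (update z.1 i s, z.2) = c i z * η i s ^ p i := fun i z s => by
    simp only [hζ, hc]
    rw [← Finset.mul_prod_erase Finset.univ _ (Finset.mem_univ i), update_self]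
    have : ∏ m ∈ Finset.univ.erase i, η m (update z.1 i s m) ^ p m =
        ∏ m ∈ Finset.univ.erase i, η m (z.1 m) ^ p m :=
      Finset.prod_congr rfl fun m hm => by rw [update_of_ne (Finset.ne_of_mem_erase hm)]
    rw [this]; ring
  have hsd : ∀ i z, spaceDeriv i ζ z =
      c i z * (d i (z.1 i) * p i * η i (z.1 i) ^ (p i - 1)) := fun i z => by
    have h1 : HasDerivAt (fun s => c i z * η i s ^ p i) _ (z.1 i) :=
      ((hηd i (z.1 i)).rpow_const (Or.inr (hp i).le)).const_mul (c i z)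
    unfold spaceDeriv partialDeriv
    simp only [hupd]
    exact h1.deriv
  -- The root 1/p_i exactly undoes the power of the i-th factor, so this derivative is bounded
  -- without any lower bound on the cut-off.
  have hsd' : ∀ i z, spaceDeriv i (fun y => ζ y ^ (1 / p i)) z =
      c i z ^ (1 / p i) * d i (z.1 i) := fun i z => by
    have hpi : 0 < p i := by linarith [hp i]
    have h1 : HasDerivAt (fun s => c i z ^ (1 / p i) * η i s) _ (z.1 i) :=
      (hηd i (z.1 i)).const_mul (c i z ^ (1 / p i))
    unfold spaceDeriv partialDeriv
    have e : (fun s => ζ (update z.1 i s, z.2) ^ (1 / p i)) =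
        fun s => c i z ^ (1 / p i) * η i s := by
      funext s
      rw [hupd, Real.mul_rpow (hcI i z).1 (Real.rpow_nonneg (hηI i s).1 _),
        ← Real.rpow_mul (hηI i s).1, mul_one_div_cancel hpi.ne', Real.rpow_one]
    rw [e]
    exact h1.deriv
  have htd : ∀ z, timeDeriv ζ z = deriv ψ z.2 * ∏ i, η i (z.1 i) ^ p i := fun z => by
    have h1 : HasDerivAt (fun t => ψ t * ∏ i, η i (z.1 i) ^ p i) _ z.2 :=
      (hψd z.2).mul_const _
    exact h1.deriv
  have hsupp : ∀ x t, ζ (x, t) ≠ 0 → ∀ i, |x i - x₀ i| < b i := by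
    intro x t hne i
    by_contra hlt
    refine hne ?_
    simp only [hζ]
    rw [Finset.prod_eq_zero (Finset.mem_univ i), mul_zero]
    simp only [hη]
    rw [plateau_eq_zero (hab i) (not_lt.1 hlt), Real.zero_rpow (by linarith [hp i])]
  -- The parameter ε = ρ(1 - h/2) solves t₀ - 2ρ + ε = B; then t₀ - 2ρ + ε/2 ≤ m because h ≤ 1.
  refine ⟨ζ, ⟨hζc, ρ * (1 - h / 2), ψ, η, ?_, ?_, hψc, hψI, ?_, ?_, ?_, fun i => ⟨hηc i, hηI i,
    ?_, ?_⟩, fun x t => rfl⟩, hζI, ?_, ?_, fun z => ⟨?_, fun i => ?_⟩, fun t => ?_⟩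
  · apply mul_pos hρ; linarith
  · nlinarith
  · intro s t hst
    exact Real.smoothTransition.monotone (by gcongr)
  · intro t ht
    refine hψ0 t (ht.trans ?_)
    simp only [hm, hA, hB]
    nlinarith
  · intro t ht
    refine hψ1 t (le_trans (le_of_eq ?_) ht)
    simp only [hB]; ring
  · exact HasCompactSupport.of_support_subset_isCompact isCompact_Icc
      ((subset_tsupport _).trans (hηs i))
  · refine (hηs i).trans fun s hs => ?_
    have := hrL i
    have := hbr i
    exact ⟨by linarith [hs.1], by linarith [hs.2]⟩
  · intro z hz
    obtain ⟨hz1, hz2⟩ := hz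
    simp only [hζ]
    rw [hψ1 z.2 (by rw [hh2] at hz2; exact hz2.1.le), one_mul]
    refine Finset.prod_eq_one fun i _ => ?_
    have := hz1 i (mem_univ i)
    simp only [hη]
    rw [plateau_eq_one (hab i), Real.one_rpow]
    rw [abs_le]
    exact ⟨by linarith [this.1], by linarith [this.2]⟩
  · intro z hz hz'
    -- Either some coordinate leaves its interval or the time is at most `A`. Times from t₀ on,
    -- where the cut-off need not vanish, are excluded by membership in Q_{2ρ}.
    rw [nestedCyl, mem_prod, not_and_or] at hz'
    rcases hz' with hz' | hz'
    · rw [mem_univ_pi, not_forall] at hz'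
      obtain ⟨l, hl'⟩ := hz'
      have hbl : b l < |z.1 l - x₀ l| := by
        by_contra hlt
        rw [not_lt, abs_le] at hlt
        exact hl' ⟨by linarith [hlt.1, hbr l], by linarith [hlt.2, hbr l]⟩
      have hη0 : η l (z.1 l) ^ p l = 0 := by
        simp only [hη]
        rw [plateau_eq_zero (hab l) hbl.le, Real.zero_rpow (by linarith [hp l])]
      have hd0 : d l (z.1 l) = 0 := deriv_plateau_eq_zero (hab l) hbl
      have hprod : ∏ i, η i (z.1 i) ^ p i = 0 := Finset.prod_eq_zero (Finset.mem_univ l) hη0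
      have hci : ∀ i, i ≠ l → c i z = 0 := fun i hi => by
        simp only [hc]
        rw [Finset.prod_eq_zero (Finset.mem_erase.2 ⟨hi.symm, Finset.mem_univ l⟩) hη0, mul_zero]
      refine ⟨by simp only [hζ, hprod, mul_zero], by rw [htd, hprod, mul_zero], fun i => ?_⟩
      rw [hsd, hsd']
      by_cases hi : i = l
      · subst hi; rw [hd0]; simp
      · rw [hci i hi, Real.zero_rpow (one_div_pos.2 (by linarith [hp i])).ne']; simp
    · have ht : z.2 ≤ A := by
        by_contra hlt
        exact hz' ⟨not_le.1 hlt, hz.2.2⟩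
      have hψz : ψ z.2 = 0 := hψ0 _ (by linarith)
      have hψz' : deriv ψ z.2 = 0 := by
        have : ψ =ᶠ[nhds z.2] fun _ => 0 := by
          filter_upwards [Iio_mem_nhds (by linarith : z.2 < m)] with y hy
          exact hψ0 y (le_of_lt hy)
        rw [this.deriv_eq, deriv_const]
      have hci : ∀ i, c i z = 0 := fun i => by simp only [hc, hψz, zero_mul]
      refine ⟨by simp only [hζ, hψz, zero_mul], by rw [htd, hψz', zero_mul], fun i => ?_⟩
      rw [hsd, hsd', hci i, Real.zero_rpow (one_div_pos.2 (by linarith [hp i])).ne']; simp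
  · rw [htd]
    have h1 : deriv ψ z.2 * ∏ i, η i (z.1 i) ^ p i ≤ 4 * M * 2 ^ j / ρ * 1 := by
      refine (mul_le_mul_of_nonneg_right (hψB z.2) (hprodI _ _).1).trans ?_
      exact mul_le_mul_of_nonneg_left (hprodI _ _).2 (by positivity)
    refine h1.trans ?_
    rw [mul_one]
    gcongr
    · nlinarith
    · norm_num
  · have hpi : 0 < p i := by linarith [hp i]
    have hfin : ∀ x : ℝ, 0 ≤ x → x ≤ 64 * M * 2 ^ j / ρ ^ (1 / p i) →
        x ^ p i ≤ (128 * M) ^ 2 * 4 ^ j / ρ := by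
      intro x hx0 hx
      calc x ^ p i ≤ (64 * M * 2 ^ j / ρ ^ (1 / p i)) ^ p i :=
            Real.rpow_le_rpow hx0 hx hpi.le
        _ = (64 * M * 2 ^ j) ^ p i / ρ := by
            rw [Real.div_rpow (by positivity) (hl i).le, ← Real.rpow_mul hρ.le,
              one_div_mul_cancel hpi.ne', Real.rpow_one]
        -- The base is at least 1, so the exponent p_i can be raised to 2; this produces 4ʲ for all
        -- directions at once.
        _ ≤ (64 * M * 2 ^ j) ^ (2 : ℝ) / ρ := by
            have h2j : (1 : ℝ) ≤ 2 ^ j := one_le_pow₀ (by norm_num)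
            gcongr
            · nlinarith
            · exact (hp2 i).le
        _ ≤ (128 * M) ^ 2 * 4 ^ j / ρ := by
            rw [Real.rpow_two, mul_pow, ← pow_mul, mul_comm j 2, pow_mul]
            norm_num
            gcongr
            linarith
    constructor
    · rw [hsd]
      refine hfin _ (abs_nonneg _) ?_
      have h1 : |η i (z.1 i) ^ (p i - 1)| ≤ 1 := by
        rw [abs_of_nonneg (Real.rpow_nonneg (hηI i _).1 _)]
        exact Real.rpow_le_one (hηI i _).1 (hηI i _).2 (by linarith [hp i])
      have hc0 := hcI i z
      generalize c i z = γ at hc0 ⊢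
      rw [abs_mul γ, abs_of_nonneg hc0.1, abs_mul, abs_mul, abs_of_pos hpi]
      calc γ * (|d i (z.1 i)| * p i * |η i (z.1 i) ^ (p i - 1)|)
          ≤ 1 * ((32 * M * 2 ^ j / ρ ^ (1 / p i)) * 2 * 1) := by
            gcongr
            · exact hc0.2
            · exact hdB i _
            · exact (hp2 i).le
        _ = _ := by ring
    · rw [hsd']
      refine hfin _ (abs_nonneg _) ?_
      rw [abs_mul, abs_of_nonneg (Real.rpow_nonneg (hcI i z).1 _)]
      calc c i z ^ (1 / p i) * |d i (z.1 i)| ≤ 1 * (32 * M * 2 ^ j / ρ ^ (1 / p i)) := by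
            gcongr
            · exact Real.rpow_le_one (hcI i z).1 (hcI i z).2 (by positivity)
            · exact hdB i _
        _ ≤ _ := by
            rw [one_mul]
            gcongr
            linarith
  · have h1 : tsupport (fun x => ζ (x, t)) ⊆
        Set.univ.pi fun i => Icc (x₀ i - b i) (x₀ i + b i) := by
      refine closure_minimal (fun x hx => ?_) (isClosed_set_pi fun i _ => isClosed_Icc)
      intro i _
      have := hsupp x t hx i
      rw [abs_lt] at this
      exact ⟨by linarith [this.1], by linarith [this.2]⟩
    refine h1.trans (pi_mono fun i _ s hs => ?_)
    have := hrL i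
    have := hbr i
    exact ⟨by linarith [hs.1], by linarith [hs.2]⟩

end Cutoffs

/-! ### Geometry of the cylinders, time slices, and the parabolic embedding -/

section Slices

variable {n : ℕ} {p : Fin n → ℝ}

theorem measurableSet_box (x₀ : Fin n → ℝ) (r : ℝ) : MeasurableSet (box p x₀ r) :=
  MeasurableSet.univ_pi fun _ => measurableSet_Ioo

theorem measurableSet_cyl (x₀ : Fin n → ℝ) (t₀ r : ℝ) : MeasurableSet (cyl p x₀ t₀ r) :=
  (measurableSet_box x₀ r).prod measurableSet_Ioo

/-- The closed hyper-rectangle. -/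
def closedBox (p : Fin n → ℝ) (x₀ : Fin n → ℝ) (r : ℝ) : Set (Fin n → ℝ) :=
  Set.univ.pi fun i => Icc (x₀ i - r ^ (1 / p i)) (x₀ i + r ^ (1 / p i))

theorem isCompact_closedBox (x₀ : Fin n → ℝ) (r : ℝ) : IsCompact (closedBox p x₀ r) :=
  isCompact_univ_pi fun _ => isCompact_Icc

theorem interior_closedBox (x₀ : Fin n → ℝ) (r : ℝ) :
    interior (closedBox p x₀ r) = box p x₀ r := by
  rw [closedBox, interior_pi_set (Set.finite_univ)]
  simp only [interior_Icc]
  rfl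

theorem closure_cyl (x₀ : Fin n → ℝ) (t₀ : ℝ) {r : ℝ} (hr : 0 < r) :
    closure (cyl p x₀ t₀ r) = closedBox p x₀ r ×ˢ Icc (t₀ - r) t₀ := by
  have h : ∀ i, 0 < r ^ (1 / p i) := fun i => Real.rpow_pos_of_pos hr _
  rw [cyl, box, closure_prod_eq, closure_pi_set, closure_Ioo (by linarith)]
  congr 1
  refine pi_congr rfl fun i _ => closure_Ioo ?_
  have := h i
  linarith

theorem isCompact_closure_cyl (x₀ : Fin n → ℝ) (t₀ : ℝ) {r : ℝ} (hr : 0 < r) :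
    IsCompact (closure (cyl p x₀ t₀ r)) := by
  rw [closure_cyl x₀ t₀ hr]
  exact (isCompact_closedBox x₀ r).prod isCompact_Icc

theorem closedBox_subset_and_Icc_subset {x₀ : Fin n → ℝ} {t₀ r T : ℝ} {Ω : Set (Fin n → ℝ)}
    (hr : 0 < r) (h : closure (cyl p x₀ t₀ r) ⊆ spaceTime Ω T) :
    closedBox p x₀ r ⊆ Ω ∧ Icc (t₀ - r) t₀ ⊆ Ioo 0 T := by
  rw [closure_cyl x₀ t₀ hr] at h
  have h1 : x₀ ∈ closedBox p x₀ r := fun i _ => by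
    have := Real.rpow_pos_of_pos hr (1 / p i)
    exact ⟨by linarith, by linarith⟩
  have h2 : t₀ ∈ Icc (t₀ - r) t₀ := ⟨by linarith, le_rfl⟩
  exact ⟨fun x hx => (h (mk_mem_prod hx h2)).1, fun t ht => (h (mk_mem_prod h1 ht)).2⟩

/-- The sides contribute r^{∑ 1/p_i} = r^{n/p̄} and the height contributes r. -/
theorem volume_cyl (hn : 0 < n) (x₀ : Fin n → ℝ) (t₀ : ℝ) {r : ℝ}
    (hr : 0 < r) :
    volume (cyl p x₀ t₀ r) = ENNReal.ofReal (2 ^ n * r ^ (1 + n / harmonicAvg p)) := by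
  rw [cyl, box, Measure.volume_eq_prod, Measure.prod_prod, Real.volume_Ioo, volume_pi_pi]
  simp only [Real.volume_Ioo]
  have h : ∀ i, 0 < r ^ (1 / p i) := fun i => Real.rpow_pos_of_pos hr _
  have e : ∀ i, x₀ i + r ^ (1 / p i) - (x₀ i - r ^ (1 / p i)) = 2 * r ^ (1 / p i) :=
    fun i => by ring
  simp only [e]
  rw [← ENNReal.ofReal_prod_of_nonneg fun i _ => by have := h i; positivity,
    ← ENNReal.ofReal_mul (Finset.prod_nonneg fun i _ => by have := h i; positivity),
    Finset.prod_mul_distrib, ← Real.rpow_sum_of_pos hr, sum_one_div_eq_div_harmonicAvg hn p]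
  congr 1
  rw [Real.rpow_add hr]
  simp
  ring

/-- `L^p` functions of two variables have `L^p` slices. -/
theorem MemLp.ae_slice {α β : Type*} [MeasurableSpace α] [MeasurableSpace β] {μ : Measure α}
    {ν : Measure β} [SFinite μ] [SFinite ν] {q : ℝ≥0∞} (hq0 : q ≠ 0) (hq : q ≠ ⊤)
    {f : α × β → ℝ} (hf : MemLp f q (μ.prod ν)) : ∀ᵐ y ∂ν, MemLp (fun x => f (x, y)) q μ := by
  have h1 := hf.1.prod_swap.prodMk_left
  have h2 := (hf.integrable_norm_rpow hq0 hq).prod_left_ae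
  filter_upwards [h1, h2] with y hy1 hy2
  exact (integrable_norm_rpow_iff hy1 hq0 hq).1 hy2

/-- The parabolic embedding. -/
theorem exists_parabolic_embedding (hn : 2 ≤ n) (hp : ∀ i, 1 < p i) (hpn : harmonicAvg p < n) :
    ∃ C : ℝ≥0∞, C ≠ ⊤ ∧ ∀ {Ω : Set (Fin n → ℝ)} {T : ℝ} {u : (Fin n → ℝ) × ℝ → ℝ}
      {Du : Fin n → (Fin n → ℝ) × ℝ → ℝ}, MemSobolevLoc p Ω T u Du →
      ∀ {x₀ : Fin n → ℝ} {t₀ r : ℝ}, 0 < r → closure (cyl p x₀ t₀ r) ⊆ spaceTime Ω T →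
      ∀ {ζ : (Fin n → ℝ) × ℝ → ℝ}, ContDiff ℝ ∞ ζ → (∀ z, 0 ≤ ζ z) →
        (∀ t, tsupport (fun x => ζ (x, t)) ⊆ box p x₀ r) → ∀ k : ℝ,
      ∫⁻ z in cyl p x₀ t₀ r, ENNReal.ofReal (max (u z - k) 0 * ζ z) ^
          (harmonicAvg p * (1 + 2 / n)) ≤
        C * ((essSup (fun t => ∫⁻ x in box p x₀ r,
              ENNReal.ofReal (max (u (x, t) - k) 0 * ζ (x, t)) ^ (2 : ℝ))
            (volume.restrict (Ioo (t₀ - r) t₀))) ^ (harmonicAvg p / n) *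
          ∑ i, ∫⁻ z in cyl p x₀ t₀ r, ENNReal.ofReal ({z | k < u z}.indicator 1 z * ζ z *
            |Du i z| + max (u z - k) 0 * |spaceDeriv i ζ z|) ^ p i) := by
  obtain ⟨C, hC, H⟩ := exists_gagliardo_nirenberg_posPart hn hp hpn
  refine ⟨C, hC, fun {Ω T u Du} hu {x₀ t₀ r} hr hQ {ζ} hζ hζ0 hζs k => ?_⟩
  have hP : 0 < harmonicAvg p := harmonicAvg_pos (by omega) fun i => by linarith [hp i]
  obtain ⟨hKΩ, hIT⟩ := closedBox_subset_and_Icc_subset hr hQ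
  have hKc := isCompact_closure_cyl (p := p) x₀ t₀ hr
  have hum : AEStronglyMeasurable u (volume.restrict (cyl p x₀ t₀ r)) :=
    (hu.1 _ hKc hQ).1.mono_measure (Measure.restrict_mono subset_closure le_rfl)
  have hDm : ∀ i, AEStronglyMeasurable (Du i) (volume.restrict (cyl p x₀ t₀ r)) := fun i =>
    ((hu.2 i).1 _ hKc hQ).1.mono_measure (Measure.restrict_mono subset_closure le_rfl)
  have hprod : (volume.restrict (cyl p x₀ t₀ r) : Measure ((Fin n → ℝ) × ℝ)) =
      (volume.restrict (box p x₀ r)).prod (volume.restrict (Ioo (t₀ - r) t₀)) := by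
    rw [Measure.prod_restrict]; rfl
  have hind : AEStronglyMeasurable ({z | k < u z}.indicator (1 : (Fin n → ℝ) × ℝ → ℝ))
      (volume.restrict (cyl p x₀ t₀ r)) := by
    refine (aestronglyMeasurable_const (b := (1 : ℝ))).indicator₀ ?_
    exact nullMeasurableSet_lt aemeasurable_const hum.aemeasurable
  have hsdc : ∀ i, Continuous fun z => spaceDeriv i ζ z := fun i => by
    have : (fun z => spaceDeriv i ζ z) = fun z => fderiv ℝ ζ z (Pi.single i 1, 0) := by
      funext z
      exact spaceDeriv_eq_fderiv (hζ.differentiable (by simp) z) i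
    rw [this]
    exact (hζ.continuous_fderiv (by simp)).clm_apply continuous_const
  have hm1 : AEMeasurable (fun z => ENNReal.ofReal (max (u z - k) 0 * ζ z) ^
      (harmonicAvg p * (1 + 2 / n))) (volume.restrict (cyl p x₀ t₀ r)) :=
    ((((hum.aemeasurable.sub_const k).max aemeasurable_const).mul
      hζ.continuous.measurable.aemeasurable).ennreal_ofReal).pow_const _
  have hm2 : ∀ i, AEMeasurable (fun z => ENNReal.ofReal ({z | k < u z}.indicator 1 z * ζ z *
            |Du i z| + max (u z - k) 0 * |spaceDeriv i ζ z|) ^ p i)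
            (volume.restrict (cyl p x₀ t₀ r)) := fun i =>
    ((((hind.aemeasurable.mul hζ.continuous.measurable.aemeasurable).mul
      (measurable_norm.comp_aemeasurable (hDm i).aemeasurable)).add
      (((hum.aemeasurable.sub_const k).max aemeasurable_const).mul
        (measurable_norm.comp_aemeasurable
          (hsdc i).measurable.aemeasurable))).ennreal_ofReal).pow_const _
  have hw : ∀ᵐ t ∂(volume.restrict (Ioo (t₀ - r) t₀)), ∀ i,
      HasWeakPartialDeriv Ω i (fun x => u (x, t)) (fun x => Du i (x, t)) := by
    rw [ae_all_iff]
    intro i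
    exact ae_restrict_of_ae_restrict_of_subset (Ioo_subset_Icc_self.trans hIT) (hu.2 i).2
  have hs : ∀ᵐ t ∂(volume.restrict (Ioo (t₀ - r) t₀)), ∀ i,
      MemLp (fun x => Du i (x, t)) (ENNReal.ofReal (p i)) (volume.restrict (closedBox p x₀ r)) := by
    rw [ae_all_iff]
    intro i
    have h1 := (hu.2 i).1 _ hKc hQ
    rw [closure_cyl x₀ t₀ hr, Measure.volume_eq_prod, ← Measure.prod_restrict] at h1
    have h2 := MemLp.ae_slice (by simpa using (by linarith [hp i] : 0 < p i))
      ENNReal.ofReal_ne_top h1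
    exact ae_restrict_of_ae_restrict_of_subset Ioo_subset_Icc_self h2
  set S : ℝ≥0∞ := essSup (fun t => ∫⁻ x in box p x₀ r,
              ENNReal.ofReal (max (u (x, t) - k) 0 * ζ (x, t)) ^ (2 : ℝ))
            (volume.restrict (Ioo (t₀ - r) t₀)) with hS
  -- For almost every time the slice inequality applies; its L² factor is replaced by the essential
  -- supremum over time, leaving a factor independent of `t`.
  have key : ∀ᵐ t ∂(volume.restrict (Ioo (t₀ - r) t₀)),
      ∫⁻ x in box p x₀ r, ENNReal.ofReal (max (u (x, t) - k) 0 * ζ (x, t)) ^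
          (harmonicAvg p * (1 + 2 / n)) ≤ C * (S ^ (harmonicAvg p / n) *
        ∑ i, ∫⁻ x in box p x₀ r, ENNReal.ofReal ({z | k < u z}.indicator 1 (x, t) * ζ (x, t) *
            |Du i (x, t)| + max (u (x, t) - k) 0 * |spaceDeriv i ζ (x, t)|) ^ p i) := by
    filter_upwards [hw, hs, ENNReal.ae_le_essSup (fun t => ∫⁻ x in box p x₀ r,
              ENNReal.ofReal (max (u (x, t) - k) 0 * ζ (x, t)) ^ (2 : ℝ))] with t ht1 ht2 ht3
    have hζt : ContDiff ℝ ∞ fun x => ζ (x, t) := hζ.comp (contDiff_id.prodMk contDiff_const)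
    have hts : IsTestFunction (interior (closedBox p x₀ r)) fun x => ζ (x, t) := by
      rw [interior_closedBox]
      refine ⟨hζt, ?_, hζs t⟩
      refine (isCompact_closedBox (p := p) x₀ r).of_isClosed_subset (isClosed_tsupport _) ?_
      refine (hζs t).trans ?_
      rw [← interior_closedBox]; exact interior_subset
    have h := H ht1 (isCompact_closedBox x₀ r) hKΩ ht2 hts k
    have hz : ∀ x, x ∉ box p x₀ r → ζ (x, t) = 0 := fun x hx =>
      eq_zero_of_notMem_tsupport (f := fun x => ζ (x, t)) fun h' => hx (hζs t h')
    have hz' : ∀ i x, x ∉ box p x₀ r → spaceDeriv i ζ (x, t) = 0 := fun i x hx => by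
      rw [spaceDeriv, partialDeriv_eq_fderiv (hζt.differentiable (by simp) x),
        fderiv_eq_zero_of_notMem_tsupport (fun h' => hx (hζs t h'))]
      rfl
    have hres : ∀ F : (Fin n → ℝ) → ℝ≥0∞, (∀ x, x ∉ box p x₀ r → F x = 0) →
        ∫⁻ x, F x = ∫⁻ x in box p x₀ r, F x := fun F hF => by
      rw [setLIntegral_eq_of_support_subset]
      intro x hx
      by_contra hne
      exact hx (hF x hne)
    have hq : 0 < harmonicAvg p * (1 + 2 / n) := by positivity
    have hsd : ∀ i x, |fderiv ℝ (fun x => ζ (x, t)) x (Pi.single i 1)| =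
        |spaceDeriv i ζ (x, t)| := fun i x => by
      rw [spaceDeriv, partialDeriv_eq_fderiv (hζt.differentiable (by simp) x)]
    simp only [abs_of_nonneg (hζ0 _), hsd] at h
    rw [hres _ fun x hx => by simp [hz x hx, hq], hres _ fun x hx => by simp [hz x hx]] at h
    have e : ∀ i, ∫⁻ x, ENNReal.ofReal ({y | k < u (y, t)}.indicator 1 x * ζ (x, t) *
          |Du i (x, t)| + max (u (x, t) - k) 0 * |spaceDeriv i ζ (x, t)|) ^ p i =
        ∫⁻ x in box p x₀ r, ENNReal.ofReal ({z | k < u z}.indicator 1 (x, t) * ζ (x, t) *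
            |Du i (x, t)| + max (u (x, t) - k) 0 * |spaceDeriv i ζ (x, t)|) ^ p i := fun i => by
      have hpi : 0 < p i := by linarith [hp i]
      rw [hres _ fun x hx => by simp [hz x hx, hz' i x hx, hpi]]
      rfl
    simp only [e] at h
    refine h.trans ?_
    gcongr
  -- Tonelli's theorem: the slice inequality is integrated in time, the essential supremum being a
  -- constant.
  rw [hprod] at hm1 hm2 ⊢
  rw [lintegral_prod_symm _ hm1]
  refine (lintegral_mono_ae key).trans (le_of_eq ?_)
  have hm3 : ∀ i, AEMeasurable (fun t => ∫⁻ x in box p x₀ r,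
      ENNReal.ofReal ({z | k < u z}.indicator 1 (x, t) * ζ (x, t) *
            |Du i (x, t)| + max (u (x, t) - k) 0 * |spaceDeriv i ζ (x, t)|) ^ p i)
      (volume.restrict (Ioo (t₀ - r) t₀)) := fun i => (hm2 i).prod_swap.lintegral_prod_right'
  rw [lintegral_const_mul'' _ ((Finset.aemeasurable_fun_sum _ fun i _ => hm3 i).const_mul _),
    lintegral_const_mul'' _ (Finset.aemeasurable_fun_sum _ fun i _ => hm3 i),
    lintegral_finsetSum' _ fun i _ => hm3 i]
  congr 2
  exact Finset.sum_congr rfl fun i _ => (lintegral_prod_symm _ (hm2 i)).symm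

end Slices

/-! ### One level step: from the energy inequality to an L^q bound -/

section LevelStep

variable {n : ℕ} {p : Fin n → ℝ}

theorem add_three_rpow_le {r : ℝ} (hr : 1 ≤ r) (hr2 : r ≤ 2) {a b c : ℝ} (ha : 0 ≤ a)
    (hb : 0 ≤ b) (hc : 0 ≤ c) : (a + b + c) ^ r ≤ 9 * (a ^ r + b ^ r + c ^ r) := by
  set M := max a (max b c) with hM
  have hM0 : 0 ≤ M := ha.trans (le_max_left _ _)
  have haM : a ≤ M := le_max_left _ _
  have hbM : b ≤ M := (le_max_left _ _).trans (le_max_right _ _)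
  have hcM : c ≤ M := (le_max_right _ _).trans (le_max_right _ _)
  have h3 : (3 : ℝ) ^ r ≤ 9 := by
    calc (3 : ℝ) ^ r ≤ 3 ^ (2 : ℝ) := Real.rpow_le_rpow_of_exponent_le (by norm_num) hr2
      _ = 9 := by norm_num
  have hMs : M ^ r ≤ a ^ r + b ^ r + c ^ r := by
    have h1 := Real.rpow_nonneg ha r
    have h2 := Real.rpow_nonneg hb r
    have h3 := Real.rpow_nonneg hc r
    rcases max_choice a (max b c) with h | h
    · rw [hM, h]; linarith
    · rcases max_choice b c with h' | h'
      · rw [hM, h, h']; linarith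
      · rw [hM, h, h']; linarith
  calc (a + b + c) ^ r ≤ (3 * M) ^ r :=
        Real.rpow_le_rpow (by positivity) (by linarith) (by linarith)
    _ = 3 ^ r * M ^ r := Real.mul_rpow (by norm_num) hM0
    _ ≤ 9 * (a ^ r + b ^ r + c ^ r) := by gcongr

theorem rpow_le_one_add_sq {r : ℝ} (hr : 0 < r) (hr2 : r ≤ 2) {w : ℝ} (hw : 0 < w) :
    w ^ r ≤ 1 + w ^ 2 := by
  rcases le_total w 1 with h | h
  · have := Real.rpow_le_one hw.le h hr.le
    nlinarith
  · have : w ^ r ≤ w ^ (2 : ℝ) := Real.rpow_le_rpow_of_exponent_le h hr2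
    rw [Real.rpow_two] at this
    linarith

/-- Chebyshev's inequality in pointwise form: above the higher level the distance to the lower one
is at least `d`. -/
theorem indicator_le_posPart_sq {l d s : ℝ} (hd : 0 < d) :
    (Ioi (l + d)).indicator (1 : ℝ → ℝ) s ≤ 1 / d ^ 2 * max (s - l) 0 ^ 2 := by
  by_cases h : l + d < s
  · rw [indicator_of_mem (by exact h), one_div_mul_eq_div, Pi.one_apply,
      le_div_iff₀ (by positivity), one_mul]
    exact pow_le_pow_left₀ hd.le (by rw [le_max_iff]; left; linarith) 2
  · rw [indicator_of_notMem (by exact h)]; positivity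

theorem posPart_sq_le {l d s : ℝ} (hd : 0 < d) :
    max (s - (l + d)) 0 ^ 2 ≤ max (s - l) 0 ^ 2 :=
  pow_le_pow_left₀ (le_max_right _ _) (max_le_max (by linarith) le_rfl) 2

/-- For r < 2 the power w^r exceeds w² when w is small. Bounding it by 1 + w² and paying for the 1
with Chebyshev's inequality at the lower level leaves only the square. -/
theorem posPart_rpow_le {l d s r : ℝ} (hd : 0 < d) (hr : 0 < r) (hr2 : r ≤ 2) :
    max (s - (l + d)) 0 ^ r ≤ (1 + 1 / d ^ 2) * max (s - l) 0 ^ 2 := by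
  by_cases h : l + d < s
  · have h1 : 0 < max (s - (l + d)) 0 := by rw [lt_max_iff]; left; linarith
    have h2 := rpow_le_one_add_sq hr hr2 h1
    have h3 := indicator_le_posPart_sq (l := l) (s := s) hd
    rw [indicator_of_mem (by exact h), Pi.one_apply] at h3
    have h4 := posPart_sq_le (l := l) (s := s) hd
    linarith
  · rw [max_eq_right (by linarith), Real.zero_rpow hr.ne']; positivity

theorem setLIntegral_ofReal_le_of_le {α : Type*} [MeasurableSpace α] {μ : Measure α}
    {Q N : Set α} (hQ : MeasurableSet Q) (hN : MeasurableSet N) {F V : α → ℝ} {c : ℝ} (hc : 0 ≤ c)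
    (h1 : ∀ z ∈ Q, z ∈ N → F z ≤ c * V z) (h2 : ∀ z ∈ Q, z ∉ N → F z ≤ 0) :
    ∫⁻ z in Q, ENNReal.ofReal (F z) ∂μ ≤
      ENNReal.ofReal c * ∫⁻ z in N, ENNReal.ofReal (V z) ∂μ := by
  rw [← lintegral_const_mul' _ _ ENNReal.ofReal_ne_top, ← lintegral_indicator hN]
  refine (setLIntegral_mono' hQ fun z hz => ?_).trans (setLIntegral_le_lintegral _ _)
  by_cases hzN : z ∈ N
  · rw [indicator_of_mem hzN, ← ENNReal.ofReal_mul hc]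
    exact ENNReal.ofReal_le_ofReal (h1 z hz hzN)
  · rw [indicator_of_notMem hzN, ENNReal.ofReal_of_nonpos (h2 z hz hzN)]

/-- The integral of `(u - k_j)₊²`, `k_j = k (2 - 2⁻ʲ)`, over the `j`-th nested cylinder. -/
def levelIntegral (p : Fin n → ℝ) (x₀ : Fin n → ℝ) (t₀ ρ : ℝ) (u : (Fin n → ℝ) × ℝ → ℝ) (k : ℝ)
    (j : ℕ) : ℝ≥0∞ :=
  ∫⁻ z in nestedCyl p x₀ t₀ ρ j, ENNReal.ofReal (max (u z - k * (2 - (1 / 2) ^ j)) 0 ^ 2)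

/-- The energy inequality and the parabolic embedding, combined. -/
theorem exists_embedding_step (hn : 2 ≤ n) (hp : ∀ i, 1 < p i) (hp2 : ∀ i, p i < 2)
    (hpn : harmonicAvg p < n) {𝒞 : ℝ} (h𝒞 : 0 < 𝒞) {δmax : ℝ} :
    ∃ C : ℝ≥0∞, C ≠ ⊤ ∧ ∀ {δ : Fin n → ℝ}, (∀ i, 0 ≤ δ i ∧ δ i ≤ δmax) →
      ∀ {Ω : Set (Fin n → ℝ)} {T : ℝ} {u : (Fin n → ℝ) × ℝ → ℝ}
      {Du : Fin n → (Fin n → ℝ) × ℝ → ℝ}, MemSobolevLoc p Ω T u Du →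
      ∀ {x₀ : Fin n → ℝ} {t₀ r : ℝ}, 0 < r → closure (cyl p x₀ t₀ r) ⊆ spaceTime Ω T →
      ∀ {N : Set ((Fin n → ℝ) × ℝ)}, MeasurableSet N →
      ∀ {ζ : (Fin n → ℝ) × ℝ → ℝ} {D : ℝ}, 0 ≤ D → IsCutoff p x₀ t₀ r ζ →
        (∀ z, 0 ≤ ζ z ∧ ζ z ≤ 1) →
        (∀ z ∈ cyl p x₀ t₀ r, z ∉ N → ζ z = 0 ∧ timeDeriv ζ z = 0 ∧
          ∀ i, spaceDeriv i ζ z = 0 ∧ spaceDeriv i (fun y => ζ y ^ (1 / p i)) z = 0) →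
        (∀ z, timeDeriv ζ z ≤ D ∧ ∀ i, |spaceDeriv i ζ z| ^ p i ≤ D ∧
          |spaceDeriv i (fun y => ζ y ^ (1 / p i)) z| ^ p i ≤ D) →
        (∀ t, tsupport (fun x => ζ (x, t)) ⊆ box p x₀ r) →
      ∀ {l d : ℝ}, 0 < d →
        EnergyInequality p δ 𝒞 x₀ t₀ r ζ Du (fun z => max (u z - (l + d)) 0) {z | l + d < u z} →
      ∫⁻ z in cyl p x₀ t₀ r, ENNReal.ofReal (max (u z - (l + d)) 0 * ζ z) ^
          (harmonicAvg p * (1 + 2 / n)) ≤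
        C * (ENNReal.ofReal ((1 + 1 / d ^ 2) * D + 1 / d ^ 2) *
          ∫⁻ z in N, ENNReal.ofReal (max (u z - l) 0 ^ 2)) ^ (1 + harmonicAvg p / n) := by
  obtain ⟨C, hC, H⟩ := exists_parabolic_embedding hn hp hpn
  have hP : 0 < harmonicAvg p := harmonicAvg_pos (by omega) fun i => by linarith [hp i]
  refine ⟨C * (ENNReal.ofReal (𝒞 * (1 + n)) ^ (harmonicAvg p / n) *
    (ENNReal.ofReal (9 * (𝒞 * (1 + n) + n * (2 + δmax) ^ 2)))), ?_, ?_⟩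
  · exact ENNReal.mul_ne_top hC (ENNReal.mul_ne_top
      (ENNReal.rpow_ne_top_of_nonneg (by positivity) ENNReal.ofReal_ne_top) ENNReal.ofReal_ne_top)
  intro δ hδ Ω T u Du hu x₀ t₀ r hr hQ N hN ζ D hD hcut hζ hζN hζD hζs l d hd hE
  have hn0 : (0 : ℝ) < n := by positivity
  set Y : ℝ≥0∞ := ∫⁻ z in N, ENNReal.ofReal (max (u z - l) 0 ^ 2) with hY
  set A : ℝ := (1 + 1 / d ^ 2) * D + 1 / d ^ 2 with hA
  have hd2 : 0 < 1 / d ^ 2 := by positivity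
  have hA0 : 0 < A := by positivity
  have hDA : D ≤ A := by rw [hA]; nlinarith [mul_nonneg hd2.le hD]
  have hmQ := measurableSet_cyl (p := p) x₀ t₀ r
  -- the right-hand side of the energy inequality
  have hR1 : ∫⁻ z in cyl p x₀ t₀ r, ENNReal.ofReal (max (u z - (l + d)) 0 ^ 2 * timeDeriv ζ z) ≤
      ENNReal.ofReal A * Y := by
    refine setLIntegral_ofReal_le_of_le hmQ hN hA0.le (fun z _ _ => ?_) fun z hz hzN => ?_
    · calc _ ≤ max (u z - (l + d)) 0 ^ 2 * D :=
            mul_le_mul_of_nonneg_left (hζD z).1 (by positivity)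
        _ ≤ max (u z - l) 0 ^ 2 * A :=
            mul_le_mul (posPart_sq_le hd) hDA hD (by positivity)
        _ = _ := mul_comm _ _
    · rw [(hζN z hz hzN).2.1, mul_zero]
  have hR2 : ∀ i, ∫⁻ z in cyl p x₀ t₀ r, ENNReal.ofReal (max (u z - (l + d)) 0 ^ p i *
      |spaceDeriv i (fun y => ζ y ^ (1 / p i)) z| ^ p i) ≤ ENNReal.ofReal A * Y := fun i => by
    have hpi : 0 < p i := by linarith [hp i]
    refine setLIntegral_ofReal_le_of_le hmQ hN hA0.le (fun z _ _ => ?_) fun z hz hzN => ?_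
    · calc _ ≤ ((1 + 1 / d ^ 2) * max (u z - l) 0 ^ 2) * D :=
            mul_le_mul (posPart_rpow_le hd hpi (hp2 i).le) ((hζD z).2 i).2
              (by positivity) (by positivity)
        _ = ((1 + 1 / d ^ 2) * D) * max (u z - l) 0 ^ 2 := by ring
        _ ≤ _ := by
            apply mul_le_mul_of_nonneg_right _ (by positivity)
            rw [hA]; linarith
    · rw [((hζN z hz hzN).2.2 i).2, abs_zero, Real.zero_rpow hpi.ne', mul_zero]
  have hRHS : ENNReal.ofReal 𝒞 *
        (∫⁻ z in cyl p x₀ t₀ r, ENNReal.ofReal (max (u z - (l + d)) 0 ^ 2 * timeDeriv ζ z)) +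
      ENNReal.ofReal 𝒞 * ∑ i, ∫⁻ z in cyl p x₀ t₀ r, ENNReal.ofReal (max (u z - (l + d)) 0 ^ p i *
        |spaceDeriv i (fun y => ζ y ^ (1 / p i)) z| ^ p i) ≤
      ENNReal.ofReal (𝒞 * (1 + n)) * (ENNReal.ofReal A * Y) := by
    calc _ ≤ ENNReal.ofReal 𝒞 * (ENNReal.ofReal A * Y) +
          ENNReal.ofReal 𝒞 * ∑ _i : Fin n, (ENNReal.ofReal A * Y) := by
          gcongr with i
          exact hR2 i
      _ = _ := by
          rw [Finset.sum_const, Finset.card_univ, Fintype.card_fin, nsmul_eq_mul,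
            ENNReal.ofReal_mul h𝒞.le, ENNReal.ofReal_add zero_le_one hn0.le, ENNReal.ofReal_one,
            ENNReal.ofReal_natCast]
          ring
  have hE' := hE.trans hRHS
  have hES := (le_self_add).trans hE'
  have hEG := (le_add_self).trans hE'
  -- the factors of the embedding
  have hS : essSup (fun t => ∫⁻ x in box p x₀ r,
        ENNReal.ofReal (max (u (x, t) - (l + d)) 0 * ζ (x, t)) ^ (2 : ℝ))
        (volume.restrict (Ioo (t₀ - r) t₀)) ≤
      ENNReal.ofReal (𝒞 * (1 + n)) * (ENNReal.ofReal A * Y) := by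
    refine le_trans (essSup_mono_ae (Filter.Eventually.of_forall fun t => ?_)) hES
    refine lintegral_mono fun x => ?_
    have hw : 0 ≤ max (u (x, t) - (l + d)) 0 := le_max_right _ _
    obtain ⟨h0, h1⟩ := hζ (x, t)
    simp only
    -- The embedding involves ζ² and the energy inequality ζ; as 0 ≤ ζ ≤ 1, the former is smaller.
    rw [ENNReal.rpow_two, ← ENNReal.ofReal_pow (mul_nonneg hw h0), mul_pow]
    apply ENNReal.ofReal_le_ofReal
    apply mul_le_mul_of_nonneg_left _ (by positivity)
    nlinarith
  -- With |∂_i u| ≤ (|∂_i u| - δ_i)₊ + δ_i there are three contributions: the energy term, the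
  -- measure of the superlevel set times a power of δ_i (controlled by Chebyshev's inequality), and
  -- the gradient of the cut-off.
  have hG : ∀ i, ∫⁻ z in cyl p x₀ t₀ r, ENNReal.ofReal ({z | l + d < u z}.indicator 1 z * ζ z *
            |Du i z| + max (u z - (l + d)) 0 * |spaceDeriv i ζ z|) ^ p i ≤
      ENNReal.ofReal 9 * (∫⁻ z in cyl p x₀ t₀ r, ENNReal.ofReal (max (|Du i z| - δ i) 0 ^ p i *
        ζ z * {z | l + d < u z}.indicator 1 z)) +
      ENNReal.ofReal (9 * (2 + δmax) ^ 2) * (ENNReal.ofReal A * Y) := fun i => by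
    have hpi : 0 < p i := by linarith [hp i]
    set X := {z | l + d < u z} with hX
    have hX01 : ∀ z, X.indicator (1 : (Fin n → ℝ) × ℝ → ℝ) z = 0 ∨
        X.indicator (1 : (Fin n → ℝ) × ℝ → ℝ) z = 1 := fun z => by
      by_cases h : z ∈ X
      · right; rw [indicator_of_mem h]; rfl
      · left; rw [indicator_of_notMem h]
    have hX0 : ∀ z, 0 ≤ X.indicator (1 : (Fin n → ℝ) × ℝ → ℝ) z := fun z => by
      rcases hX01 z with h | h <;> simp [h]
    have hXV : ∀ z, X.indicator (1 : (Fin n → ℝ) × ℝ → ℝ) z ≤ 1 / d ^ 2 * max (u z - l) 0 ^ 2 :=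
      fun z => indicator_le_posPart_sq (l := l) (s := u z) hd
    have hpt : ∀ z, ENNReal.ofReal (X.indicator 1 z * ζ z * |Du i z| +
          max (u z - (l + d)) 0 * |spaceDeriv i ζ z|) ^ p i ≤
        ENNReal.ofReal 9 * ENNReal.ofReal (max (|Du i z| - δ i) 0 ^ p i * ζ z * X.indicator 1 z) +
        ENNReal.ofReal (9 * (X.indicator 1 z * ζ z * (1 + δ i) ^ 2 +
          max (u z - (l + d)) 0 ^ p i * |spaceDeriv i ζ z| ^ p i)) := fun z => by
      obtain ⟨h0, h1⟩ := hζ z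
      have hw : 0 ≤ max (u z - (l + d)) 0 := le_max_right _ _
      have hv : 0 ≤ max (|Du i z| - δ i) 0 := le_max_right _ _
      have hδ0 := (hδ i).1
      have hDv : |Du i z| ≤ max (|Du i z| - δ i) 0 + δ i := by
        linarith [le_max_left (|Du i z| - δ i) 0]
      have hχ := hX0 z
      rw [ENNReal.ofReal_rpow_of_nonneg (by positivity) hpi.le,
        ← ENNReal.ofReal_mul (by norm_num), ← ENNReal.ofReal_add (by positivity) (by positivity)]
      apply ENNReal.ofReal_le_ofReal
      -- The gradient of the product carries ζ^{p_i} and the energy term only ζ; since p_i > 1 and 0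
      -- ≤ ζ ≤ 1 this costs nothing.
      have hζp : ζ z ^ p i ≤ ζ z := by
        calc ζ z ^ p i ≤ ζ z ^ (1 : ℝ) :=
              Real.rpow_le_rpow_of_exponent_ge' h0 h1 zero_le_one (hp i).le
          _ = ζ z := Real.rpow_one _
      have hχp : X.indicator (1 : (Fin n → ℝ) × ℝ → ℝ) z ^ p i = X.indicator 1 z := by
        rcases hX01 z with h | h
        · rw [h, Real.zero_rpow hpi.ne']
        · rw [h, Real.one_rpow]
      have hδp : δ i ^ p i ≤ (1 + δ i) ^ 2 := by
        calc δ i ^ p i ≤ (1 + δ i) ^ p i := Real.rpow_le_rpow hδ0 (by linarith) hpi.le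
          _ ≤ (1 + δ i) ^ (2 : ℝ) :=
              Real.rpow_le_rpow_of_exponent_le (by linarith) (hp2 i).le
          _ = _ := Real.rpow_two _
      generalize X.indicator (1 : (Fin n → ℝ) × ℝ → ℝ) z = s at hχ hχp ⊢
      generalize max (u z - (l + d)) 0 = w at hw ⊢
      generalize max (|Du i z| - δ i) 0 = v at hv hDv ⊢
      calc (s * ζ z * |Du i z| + w * |spaceDeriv i ζ z|) ^ p i
          ≤ (s * ζ z * v + s * ζ z * δ i + w * |spaceDeriv i ζ z|) ^ p i := by
            refine Real.rpow_le_rpow (by positivity) ?_ hpi.le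
            have := mul_le_mul_of_nonneg_left hDv (mul_nonneg hχ h0)
            linarith
        _ ≤ 9 * ((s * ζ z * v) ^ p i + (s * ζ z * δ i) ^ p i + (w * |spaceDeriv i ζ z|) ^ p i) :=
            add_three_rpow_le (hp i).le (hp2 i).le (by positivity) (by positivity) (by positivity)
        _ = 9 * (s * ζ z ^ p i * v ^ p i + s * ζ z ^ p i * δ i ^ p i +
              w ^ p i * |spaceDeriv i ζ z| ^ p i) := by
            rw [Real.mul_rpow (by positivity) hv, Real.mul_rpow hχ h0,
              Real.mul_rpow (by positivity) hδ0, Real.mul_rpow hχ h0,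
              Real.mul_rpow hw (abs_nonneg _), hχp]
        _ ≤ 9 * (s * ζ z * v ^ p i + s * ζ z * (1 + δ i) ^ 2 +
              w ^ p i * |spaceDeriv i ζ z| ^ p i) := by gcongr
        _ = _ := by ring
    refine (lintegral_mono hpt).trans ?_
    have hm : AEMeasurable (fun z => ENNReal.ofReal 9 *
        ENNReal.ofReal (max (|Du i z| - δ i) 0 ^ p i * ζ z * X.indicator 1 z))
        (volume.restrict (cyl p x₀ t₀ r)) := by
      have hKc := isCompact_closure_cyl (p := p) x₀ t₀ hr
      have hum : AEMeasurable u (volume.restrict (cyl p x₀ t₀ r)) :=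
        ((hu.1 _ hKc hQ).1.mono_measure
          (Measure.restrict_mono subset_closure le_rfl)).aemeasurable
      have hDm : AEMeasurable (Du i) (volume.restrict (cyl p x₀ t₀ r)) :=
        (((hu.2 i).1 _ hKc hQ).1.mono_measure
          (Measure.restrict_mono subset_closure le_rfl)).aemeasurable
      have hind : AEMeasurable (X.indicator (1 : (Fin n → ℝ) × ℝ → ℝ))
          (volume.restrict (cyl p x₀ t₀ r)) :=
        (aemeasurable_const (b := (1 : ℝ))).indicator₀ (nullMeasurableSet_lt aemeasurable_const hum)
      refine (((((measurable_norm.comp_aemeasurable hDm).sub_const (δ i)).max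
        aemeasurable_const).pow_const (p i)).mul
          hcut.1.continuous.measurable.aemeasurable |>.mul hind).ennreal_ofReal.const_mul _
    rw [lintegral_add_left' hm, lintegral_const_mul' _ _ ENNReal.ofReal_ne_top]
    gcongr
    rw [← mul_assoc, ← ENNReal.ofReal_mul (by positivity)]
    refine setLIntegral_ofReal_le_of_le hmQ hN (by positivity) (fun z _ _ => ?_)
      fun z hz hzN => ?_
    · have hδ1 : (1 + δ i) ^ 2 ≤ (2 + δmax) ^ 2 - 1 := by nlinarith [hδ i]
      have h1 : X.indicator 1 z * ζ z * (1 + δ i) ^ 2 ≤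
          (1 / d ^ 2 * max (u z - l) 0 ^ 2) * 1 * ((2 + δmax) ^ 2 - 1) := by
        gcongr
        · exact (hζ z).1
        · exact hXV z
        · exact (hζ z).2
      have h2 : max (u z - (l + d)) 0 ^ p i * |spaceDeriv i ζ z| ^ p i ≤
          ((1 + 1 / d ^ 2) * max (u z - l) 0 ^ 2) * D :=
        mul_le_mul (posPart_rpow_le hd hpi (hp2 i).le) ((hζD z).2 i).1
              (by positivity) (by positivity)
      have h3 : 1 ≤ (2 + δmax) ^ 2 := by nlinarith [hδ i]
      have hV : 0 ≤ max (u z - l) 0 ^ 2 := by positivity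
      calc _ ≤ 9 * (1 / d ^ 2 * max (u z - l) 0 ^ 2 * 1 * ((2 + δmax) ^ 2 - 1) +
            (1 + 1 / d ^ 2) * max (u z - l) 0 ^ 2 * D) := by gcongr
        _ ≤ 9 * (1 / d ^ 2 * max (u z - l) 0 ^ 2 * (2 + δmax) ^ 2 +
            (1 + 1 / d ^ 2) * max (u z - l) 0 ^ 2 * D * (2 + δmax) ^ 2) := by
            have h5 : 0 ≤ (1 + 1 / d ^ 2) * max (u z - l) 0 ^ 2 * D := by positivity
            have h6 : 0 ≤ 1 / d ^ 2 * max (u z - l) 0 ^ 2 := by positivity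
            nlinarith [mul_le_mul_of_nonneg_left h3 h5]
        _ = _ := by rw [hA]; ring
    · rw [(hζN z hz hzN).1, ((hζN z hz hzN).2.2 i).1]
      simp [hpi.ne']
  have hGs : ∑ i, ∫⁻ z in cyl p x₀ t₀ r, ENNReal.ofReal ({z | l + d < u z}.indicator 1 z * ζ z *
            |Du i z| + max (u z - (l + d)) 0 * |spaceDeriv i ζ z|) ^ p i ≤
      ENNReal.ofReal (9 * (𝒞 * (1 + n) + n * (2 + δmax) ^ 2)) * (ENNReal.ofReal A * Y) := by
    refine (Finset.sum_le_sum fun i _ => hG i).trans ?_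
    rw [Finset.sum_add_distrib, ← Finset.mul_sum, Finset.sum_const, Finset.card_univ,
      Fintype.card_fin, nsmul_eq_mul]
    refine (add_le_add_left (mul_le_mul_right hEG _) _).trans (le_of_eq ?_)
    generalize ENNReal.ofReal A * Y = B
    have e : ENNReal.ofReal (9 * (𝒞 * (1 + n) + n * (2 + δmax) ^ 2)) =
        ENNReal.ofReal 9 * (ENNReal.ofReal (𝒞 * (1 + n)) +
          n * ENNReal.ofReal ((2 + δmax) ^ 2)) := by
      rw [ENNReal.ofReal_mul (by norm_num), ENNReal.ofReal_add (by positivity) (by positivity),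
        ENNReal.ofReal_mul hn0.le, ENNReal.ofReal_natCast]
    rw [e, ENNReal.ofReal_mul (by norm_num : (0 : ℝ) ≤ 9)]
    ring
  refine (H hu hr hQ hcut.1 (fun z => (hζ z).1) hζs (l + d)).trans ?_
  have hPn : 0 ≤ harmonicAvg p / n := by positivity
  -- Both factors of the embedding are multiples of the same quantity, the first to the power P/n,
  -- the second to the power 1; this is the gain 1 + P/n.
  calc _ ≤ C * ((ENNReal.ofReal (𝒞 * (1 + n)) * (ENNReal.ofReal A * Y)) ^ (harmonicAvg p / n) *
        (ENNReal.ofReal (9 * (𝒞 * (1 + n) + n * (2 + δmax) ^ 2)) * (ENNReal.ofReal A * Y))) := by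
        gcongr
    _ = _ := by
        rw [ENNReal.mul_rpow_of_nonneg _ _ hPn, add_comm (1 : ℝ) (harmonicAvg p / n),
          ENNReal.rpow_add_of_nonneg _ _ hPn zero_le_one, ENNReal.rpow_one]
        ring

end LevelStep

/-! ### The De Giorgi iteration -/

section Iteration

variable {n : ℕ} {p : Fin n → ℝ}

/-- Fast geometric convergence. -/
theorem tendsto_zero_of_le_mul_rpow {Y : ℕ → ℝ≥0∞} {B b : ℝ≥0∞} {ε : ℝ} (hε : 0 < ε) (hb : 1 < b)
    (hb' : b ≠ ⊤) (hY : Y 0 ≠ ⊤) (h : ∀ j, Y (j + 1) ≤ B * b ^ j * Y j ^ (1 + ε))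
    (h0 : B * Y 0 ^ ε * b ^ (1 / ε) ≤ 1) : Filter.Tendsto Y Filter.atTop (nhds 0) := by
  set s := b ^ (1 / ε) with hs
  have hs1 : 1 < s := ENNReal.one_lt_rpow hb (by positivity)
  have hs0 : s ≠ 0 := (zero_lt_one.trans hs1).ne'
  have hst : s ≠ ⊤ := ENNReal.rpow_ne_top_of_nonneg (by positivity) hb'
  have hse : s ^ ε = b := by rw [hs, ← ENNReal.rpow_mul, one_div_mul_cancel hε.ne', ENNReal.rpow_one]
  -- With s = b^{1/ε} the factor s^{-jε} of the induction hypothesis cancels b^j, and the smallness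
  -- of `Y 0` supplies exactly one further factor 1/s.
  have key : ∀ j, Y j ≤ Y 0 * s⁻¹ ^ j := by
    intro j
    induction j with
    | zero => simp
    | succ j ih =>
      have e1 : b ^ j * (s⁻¹ ^ j) ^ ε = 1 := by
        rw [← ENNReal.rpow_natCast_mul, mul_comm (j : ℝ), ENNReal.rpow_mul_natCast, ENNReal.inv_rpow, hse,
          ← mul_pow, ENNReal.mul_inv_cancel (zero_lt_one.trans hb).ne' hb', one_pow]
      calc Y (j + 1) ≤ B * b ^ j * (Y 0 * s⁻¹ ^ j) ^ (1 + ε) := (h j).trans (by gcongr)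
        _ = B * b ^ j * ((Y 0 * s⁻¹ ^ j) * (Y 0 ^ ε * (s⁻¹ ^ j) ^ ε)) := by
            rw [ENNReal.rpow_add_of_nonneg _ _ zero_le_one hε.le, ENNReal.rpow_one,
              ENNReal.mul_rpow_of_nonneg _ _ hε.le]
        _ = (B * Y 0 ^ ε) * (Y 0 * s⁻¹ ^ j) * (b ^ j * (s⁻¹ ^ j) ^ ε) := by ring
        _ = (B * Y 0 ^ ε) * (s * s⁻¹) * (Y 0 * s⁻¹ ^ j) := by
            rw [e1, ENNReal.mul_inv_cancel hs0 hst]; ring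
        _ = (B * Y 0 ^ ε * s) * (Y 0 * s⁻¹ ^ (j + 1)) := by ring
        _ ≤ 1 * (Y 0 * s⁻¹ ^ (j + 1)) := by gcongr
        _ = _ := one_mul _
  refine tendsto_of_tendsto_of_tendsto_of_le_of_le tendsto_const_nhds ?_ (fun _ => zero_le)
    key
  have h1 : Filter.Tendsto (fun j => s⁻¹ ^ j) Filter.atTop (nhds 0) :=
    ENNReal.tendsto_pow_atTop_nhds_zero_of_lt_one (ENNReal.inv_lt_one.2 hs1)
  simpa using ENNReal.Tendsto.const_mul h1 (Or.inr hY)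

/-- Because q ≤ 2, the L^q bound of `exists_embedding_step` does not by itself control the L²
integral at the next level. Hölder's inequality places L² between L^q, with weight `θ`, and L^m; the
L^m factor is simply bounded by the norm of `u` on the largest cylinder. -/
theorem exists_iteration_step (hn : 2 ≤ n) (hp : ∀ i, 1 < p i) (hp2 : ∀ i, p i < 2)
    (hpn : harmonicAvg p < n) {m : ℝ} (hm : 2 < m) (hq : harmonicAvg p * (1 + 2 / n) ≤ 2)
    {θ : ℝ} (hθ : θ = (m - 2) / (m - harmonicAvg p * (1 + 2 / n)))
    {𝒞 : ℝ} (h𝒞 : 0 < 𝒞) (δmax : ℝ) :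
    ∃ C : ℝ≥0∞, C ≠ ⊤ ∧ ∀ {δ : Fin n → ℝ}, (∀ i, 0 ≤ δ i ∧ δ i ≤ δmax) →
      ∀ {Ω : Set (Fin n → ℝ)} {T : ℝ} {u : (Fin n → ℝ) × ℝ → ℝ}
      {Du : Fin n → (Fin n → ℝ) × ℝ → ℝ}, MemSobolevLoc p Ω T u Du →
      ∀ {x₀ : Fin n → ℝ} {t₀ ρ : ℝ}, 0 < ρ → closure (cyl p x₀ t₀ (2 * ρ)) ⊆ spaceTime Ω T →
      (∀ ζ, IsCutoff p x₀ t₀ (2 * ρ) ζ → ∀ k : ℝ,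
        EnergyInequality p δ 𝒞 x₀ t₀ (2 * ρ) ζ Du (fun z => max (u z - k) 0) {z | k < u z}) →
      ∀ {k : ℝ}, 1 + √ρ ≤ k → ∀ j,
      levelIntegral p x₀ t₀ ρ u k (j + 1) ≤ C * (ENNReal.ofReal (16 ^ j / ρ) *
        levelIntegral p x₀ t₀ ρ u k j) ^ ((1 + harmonicAvg p / n) * θ) *
        (∫⁻ z in cyl p x₀ t₀ (2 * ρ), ENNReal.ofReal |u z| ^ m) ^ (1 - θ) := by
  obtain ⟨M, hM1, hM⟩ := exists_cutoff hp hp2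
  obtain ⟨C, hC, H⟩ := exists_embedding_step hn hp hp2 hpn h𝒞 (δmax := δmax)
  have hP : 0 < harmonicAvg p := harmonicAvg_pos (by omega) fun i => by linarith [hp i]
  set q := harmonicAvg p * (1 + 2 / n) with hqdef
  have hq0 : 0 < q := by positivity
  have hχ : 0 ≤ 1 + harmonicAvg p / n := by positivity
  have hmq : 0 < m - q := by linarith
  have hθ0 : 0 ≤ θ := by rw [hθ]; apply div_nonneg <;> linarith
  have hθ1 : 0 ≤ 1 - θ := by rw [hθ, sub_nonneg, div_le_one hmq]; linarith
  refine ⟨(C * ENNReal.ofReal (9 * M) ^ (1 + harmonicAvg p / n)) ^ θ,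
    ENNReal.rpow_ne_top_of_nonneg hθ0 (ENNReal.mul_ne_top hC
      (ENNReal.rpow_ne_top_of_nonneg hχ ENNReal.ofReal_ne_top)), ?_⟩
  intro δ hδ Ω T u Du hu x₀ t₀ ρ hρ hQ hE k hk j
  have hsρ := Real.sqrt_nonneg ρ
  have hk0 : 0 < k := by linarith
  -- The reason for requiring k ≥ 1 + √ρ, and the origin of these two terms in the final bound: k² ≥
  -- 1 tames the Chebyshev factor 1/d² where it multiplies 1/ρ, and k² ≥ ρ where it stands alone.
  have hk1 : 1 ≤ k ^ 2 := by nlinarith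
  have hkρ : ρ ≤ k ^ 2 := by nlinarith [Real.sq_sqrt hρ.le]
  obtain ⟨ζ, hcut, hζ, hζ1, hζN, hζD, hζs⟩ := hM x₀ t₀ ρ hρ j
  -- `l` is the j-th level and `d` its distance to the next one, so that 1/d² = 4·4ʲ/k².
  set l := k * (2 - (1 / 2) ^ j) with hl
  set d := k * (1 / 2) ^ (j + 1) with hd
  have hd0 : 0 < d := by positivity
  have hld : k * (2 - (1 / 2) ^ (j + 1)) = l + d := by rw [hl, hd, pow_succ]; ring
  have hl0 : 0 ≤ l + d := by
    rw [← hld]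
    have : ((1 : ℝ) / 2) ^ (j + 1) ≤ 1 := pow_le_one₀ (by norm_num) (by norm_num)
    exact mul_nonneg hk0.le (by linarith)
  have h := H hδ hu (by linarith) hQ (measurableSet_nestedCyl (p := p) (ρ := ρ) x₀ t₀ j)
    (by positivity : 0 ≤ M * 4 ^ j / ρ) hcut hζ hζN hζD hζs hd0 (hE ζ hcut (l + d))
  -- the size of the constants
  have hd2 : 1 / d ^ 2 = 4 * 4 ^ j / k ^ 2 := by
    rw [hd, mul_pow, ← pow_mul, mul_comm (j + 1) 2, pow_mul, one_div_pow, one_div_pow, pow_succ]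
    norm_num
    field_simp
    ring
  have h4 : (1 : ℝ) ≤ 4 ^ j := one_le_pow₀ (by norm_num)
  have h16 : (16 : ℝ) ^ j = 4 ^ j * 4 ^ j := by rw [← mul_pow]; norm_num
  -- The product of 4ʲ from the level gap and 4ʲ from the cut-off gives 16ʲ.
  have hA : (1 + 1 / d ^ 2) * (M * 4 ^ j / ρ) + 1 / d ^ 2 ≤ 9 * M * (16 ^ j / ρ) := by
    have h1 : 1 / d ^ 2 ≤ 4 * 4 ^ j := by
      rw [hd2]; exact div_le_self (by positivity) hk1
    have h2 : 1 / d ^ 2 ≤ 4 * 4 ^ j / ρ := by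
      rw [hd2]; gcongr
    calc _ ≤ (1 + 4 * 4 ^ j) * (M * 4 ^ j / ρ) + 4 * 4 ^ j / ρ := by gcongr
      _ ≤ (4 ^ j + 4 * 4 ^ j) * (M * 4 ^ j / ρ) + 4 * (M * (4 ^ j * 4 ^ j)) / ρ := by
          gcongr
          nlinarith [mul_le_mul_of_nonneg_left h4 (by positivity : (0:ℝ) ≤ 4 ^ j)]
      _ = _ := by rw [h16]; ring
  have hstep : ∫⁻ z in cyl p x₀ t₀ (2 * ρ), ENNReal.ofReal (max (u z - (l + d)) 0 * ζ z) ^ q ≤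
      C * ENNReal.ofReal (9 * M) ^ (1 + harmonicAvg p / n) *
        (ENNReal.ofReal (16 ^ j / ρ) * levelIntegral p x₀ t₀ ρ u k j) ^
          (1 + harmonicAvg p / n) := by
    refine h.trans ?_
    rw [mul_assoc, ← ENNReal.mul_rpow_of_nonneg _ _ hχ, ← mul_assoc (ENNReal.ofReal (9 * M)),
      ← ENNReal.ofReal_mul (by positivity)]
    gcongr
    exact le_rfl
  -- interpolation
  have hsub : nestedCyl p x₀ t₀ ρ (j + 1) ⊆ cyl p x₀ t₀ (2 * ρ) := by
    rw [← nestedCyl_zero hρ]; exact nestedCyl_antitone hp hρ x₀ t₀ (Nat.zero_le _)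
  have hKc := isCompact_closure_cyl (p := p) x₀ t₀ (by linarith : 0 < 2 * ρ)
  have hum : AEMeasurable u (volume.restrict (cyl p x₀ t₀ (2 * ρ))) :=
    ((hu.1 _ hKc hQ).1.mono_measure
      (Measure.restrict_mono subset_closure le_rfl)).aemeasurable
  have hF : AEMeasurable (fun z => ENNReal.ofReal (max (u z - (l + d)) 0 * ζ z))
      (volume.restrict (cyl p x₀ t₀ (2 * ρ))) :=
    (((hum.sub_const _).max aemeasurable_const).mul
      hcut.1.continuous.measurable.aemeasurable).ennreal_ofReal
  -- This identity is what the value of `θ` is chosen for.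
  have hexp : q * θ + m * (1 - θ) = 2 := by rw [hθ]; field_simp; ring
  calc levelIntegral p x₀ t₀ ρ u k (j + 1)
      = ∫⁻ z in nestedCyl p x₀ t₀ ρ (j + 1),
          ENNReal.ofReal (max (u z - (l + d)) 0 * ζ z) ^ (2 : ℝ) := by
        unfold levelIntegral
        refine setLIntegral_congr_fun (measurableSet_nestedCyl x₀ t₀ _) fun z hz => ?_
        rw [hζ1 z hz, mul_one, hld, ENNReal.rpow_two, ENNReal.ofReal_pow (le_max_right _ _)]
    _ ≤ ∫⁻ z in cyl p x₀ t₀ (2 * ρ), ENNReal.ofReal (max (u z - (l + d)) 0 * ζ z) ^ (2 : ℝ) :=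
        lintegral_mono_set hsub
    _ = ∫⁻ z in cyl p x₀ t₀ (2 * ρ), (ENNReal.ofReal (max (u z - (l + d)) 0 * ζ z) ^ q) ^ θ *
          (ENNReal.ofReal (max (u z - (l + d)) 0 * ζ z) ^ m) ^ (1 - θ) := by
        congr with z
        rw [← ENNReal.rpow_mul, ← ENNReal.rpow_mul, ← ENNReal.rpow_add_of_nonneg _ _
          (mul_nonneg hq0.le hθ0) (mul_nonneg (by linarith) hθ1), hexp]
    _ ≤ (∫⁻ z in cyl p x₀ t₀ (2 * ρ), ENNReal.ofReal (max (u z - (l + d)) 0 * ζ z) ^ q) ^ θ *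
        (∫⁻ z in cyl p x₀ t₀ (2 * ρ), ENNReal.ofReal (max (u z - (l + d)) 0 * ζ z) ^ m) ^
          (1 - θ) :=
        ENNReal.lintegral_mul_norm_pow_le (hF.pow_const _) (hF.pow_const _) hθ0 hθ1 (by ring)
    _ ≤ (C * ENNReal.ofReal (9 * M) ^ (1 + harmonicAvg p / n) *
        (ENNReal.ofReal (16 ^ j / ρ) * levelIntegral p x₀ t₀ ρ u k j) ^
          (1 + harmonicAvg p / n)) ^ θ *
        (∫⁻ z in cyl p x₀ t₀ (2 * ρ), ENNReal.ofReal |u z| ^ m) ^ (1 - θ) := by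
        gcongr with z
        have h1 : max (u z - (l + d)) 0 ≤ |u z| :=
          max_le (by linarith [le_abs_self (u z)]) (abs_nonneg _)
        calc max (u z - (l + d)) 0 * ζ z ≤ |u z| * 1 :=
              mul_le_mul h1 (hζ z).2 (hζ z).1 (abs_nonneg _)
          _ = _ := mul_one _
    _ = _ := by rw [ENNReal.mul_rpow_of_nonneg _ _ hθ0, ← ENNReal.rpow_mul]

/-- Since m > 2, raising the level makes the quadratic integral small: this is how Y_0 is controlled
by a negative power of k and the L^m norm. -/
theorem sq_posPart_le_rpow {k s m : ℝ} (hk : 0 < k) (hm : 2 < m) :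
    max (s - k) 0 ^ 2 ≤ k ^ (2 - m) * |s| ^ m := by
  rcases le_or_gt s k with h | h
  · rw [max_eq_right (by linarith), zero_pow two_ne_zero]
    exact mul_nonneg (Real.rpow_nonneg hk.le _) (Real.rpow_nonneg (abs_nonneg _) _)
  · have hs : 0 < s := hk.trans h
    rw [max_eq_left (by linarith), abs_of_pos hs]
    calc (s - k) ^ 2 ≤ s ^ 2 := pow_le_pow_left₀ (by linarith) (by linarith) 2
      _ = s ^ (2 - m) * s ^ m := by
          rw [← Real.rpow_add hs, ← Real.rpow_two]; congr 1; ring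
      _ ≤ k ^ (2 - m) * s ^ m := by
          refine mul_le_mul_of_nonneg_right ?_ (Real.rpow_nonneg hs.le _)
          exact Real.rpow_le_rpow_of_nonpos hk h.le (by linarith)

-- The recursion of `exists_iteration_step` is superlinear with exponent 1 + ε. The level `k` is
-- chosen so that the smallness condition of `tendsto_zero_of_le_mul_rpow` holds, all powers of ρ
-- cancelling; then (u - 2k)₊ vanishes on the inner cylinder.
set_option maxHeartbeats 1000000 in
theorem exists_ae_le (hn : 2 ≤ n) (hp : ∀ i, 1 < p i) (hp2 : ∀ i, p i < 2)
    (hpn : harmonicAvg p < n) {m : ℝ} (hm : 2 < m) (hq : harmonicAvg p * (1 + 2 / n) ≤ 2)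
    (hm0 : (n : ℝ) / harmonicAvg p * (2 - harmonicAvg p) < m) {𝒞 : ℝ} (h𝒞 : 0 < 𝒞) (δmax : ℝ) :
    ∃ C : ℝ, 0 < C ∧ ∀ {δ : Fin n → ℝ}, (∀ i, 0 ≤ δ i ∧ δ i ≤ δmax) →
      ∀ {Ω : Set (Fin n → ℝ)} {T : ℝ} {u : (Fin n → ℝ) × ℝ → ℝ}
      {Du : Fin n → (Fin n → ℝ) × ℝ → ℝ}, MemSobolevLoc p Ω T u Du →
      MemLpLoc u (ENNReal.ofReal m) (spaceTime Ω T) →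
      ∀ {x₀ : Fin n → ℝ} {t₀ ρ : ℝ}, 0 < ρ → closure (cyl p x₀ t₀ (2 * ρ)) ⊆ spaceTime Ω T →
      (∀ ζ, IsCutoff p x₀ t₀ (2 * ρ) ζ → ∀ k : ℝ,
        EnergyInequality p δ 𝒞 x₀ t₀ (2 * ρ) ζ Du (fun z => max (u z - k) 0) {z | k < u z}) →
      ∀ᵐ z ∂(volume.restrict (cyl p x₀ t₀ ρ)),
        u z ≤ C * ((⨍ z in cyl p x₀ t₀ (2 * ρ), |u z| ^ m) ^
          (1 / (m - (n : ℝ) / harmonicAvg p * (2 - harmonicAvg p))) + 1 + √ρ) := by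
  have hn0 : (0 : ℝ) < n := by positivity
  have hP : 0 < harmonicAvg p := harmonicAvg_pos (by omega) fun i => by linarith [hp i]
  obtain ⟨θ, hθ⟩ : ∃ θ, θ = (m - 2) / (m - harmonicAvg p * (1 + 2 / n)) := ⟨_, rfl⟩
  obtain ⟨C, hC, H⟩ := exists_iteration_step hn hp hp2 hpn hm hq hθ h𝒞 δmax
  obtain ⟨c, hc0, rfl⟩ : ∃ c : ℝ, 0 ≤ c ∧ C = ENNReal.ofReal c :=
    ⟨C.toReal, ENNReal.toReal_nonneg, (ENNReal.ofReal_toReal hC).symm⟩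
  set P := harmonicAvg p with hPdef
  have hmq : 0 < m - P * (1 + 2 / n) := by linarith
  have hθm : θ * (m - P * (1 + 2 / n)) = m - 2 := by rw [hθ, div_mul_cancel₀ _ hmq.ne']
  have hθ0 : 0 < θ := by rw [hθ]; apply div_pos <;> linarith
  have hθ1 : 0 ≤ 1 - θ := by rw [hθ, sub_nonneg, div_le_one hmq]; linarith
  set μ := m - n / P * (2 - P) with hμ
  have hμ0 : 0 < μ := by linarith
  set ε := (1 + P / n) * θ - 1 with hε
  -- The decisive computation: ε and μ have the same sign, so superlinearity is exactly the lower
  -- bound on `m`.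
  have hεμ : ε * (m - P * (1 + 2 / n)) = P / n * μ := by
    have h1 : ε * (m - P * (1 + 2 / n)) = (1 + P / n) * (m - 2) - (m - P * (1 + 2 / n)) := by
      rw [hε, ← hθm]; ring
    rw [h1, hμ]
    field_simp
    ring
  have hε0 : 0 < ε := by
    have : 0 < P / n * μ := by positivity
    rw [← hεμ] at this
    exact pos_of_mul_pos_left this hmq.le
  -- The total power of ∫|u|^m in the smallness condition: 1 - θ from the interpolation and ε from
  -- the bound of the first integral.
  set κ := θ * P / n with hκ
  have hκ0 : 0 < κ := by positivity
  -- The smallness condition compares the mean value of |u|^m to the power κ with k to the power (m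
  -- - 2)ε; their quotient κ/((m - 2)ε) = 1/μ is the exponent of the theorem.
  have hσ : (m - 2) * ε = κ * μ := by
    rw [← hθm, mul_assoc, mul_comm _ ε, hεμ, hκ]; ring
  have hκε : 1 - θ + ε = κ := by rw [hε, hκ]; ring
  have hσ0 : 0 < (m - 2) * ε := by rw [hσ]; positivity
  set b : ℝ := 16 ^ (1 + ε) with hb
  have hb0 : 0 < b := by positivity
  -- The measure of Q_{2ρ} is V ρ^{1 + n/P}.
  set V : ℝ := 2 ^ n * 2 ^ (1 + n / P) with hV
  have hV0 : 0 < V := by positivity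
  set G : ℝ := c * b ^ (1 / ε) * V ^ κ with hG
  have hG0 : 0 ≤ G := by positivity
  -- `G` collects the constants of the smallness condition G a^κ ≤ k^{(m-2)ε}, where `a` is the mean
  -- value of |u|^m; `L` solves it for k ≥ L a^{1/μ}.
  set L : ℝ := G ^ (1 / ((m - 2) * ε)) with hL
  have hL0 : 0 ≤ L := by positivity
  refine ⟨2 * (1 + L), by positivity, ?_⟩
  intro δ hδ Ω T u Du hu hum x₀ t₀ ρ hρ hQ hE
  have hKc := isCompact_closure_cyl (p := p) x₀ t₀ (by linarith : 0 < 2 * ρ)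
  have huL : MemLp u (ENNReal.ofReal m) (volume.restrict (cyl p x₀ t₀ (2 * ρ))) :=
    (hum _ hKc hQ).mono_measure (Measure.restrict_mono subset_closure le_rfl)
  have huI : Integrable (fun z => |u z| ^ m) (volume.restrict (cyl p x₀ t₀ (2 * ρ))) := by
    have := huL.integrable_norm_rpow (by simpa using (by linarith : 0 < m)) ENNReal.ofReal_ne_top
    rwa [ENNReal.toReal_ofReal (by linarith)] at this
  set I : ℝ := ∫ z in cyl p x₀ t₀ (2 * ρ), |u z| ^ m with hI
  have hI0 : 0 ≤ I := integral_nonneg fun z => by positivity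
  have hIl : ∫⁻ z in cyl p x₀ t₀ (2 * ρ), ENNReal.ofReal |u z| ^ m = ENNReal.ofReal I := by
    rw [hI, ofReal_integral_eq_lintegral_ofReal huI
      (Filter.Eventually.of_forall fun z => by positivity)]
    congr with z
    exact ENNReal.ofReal_rpow_of_nonneg (abs_nonneg _) (by linarith)
  set a : ℝ := ⨍ z in cyl p x₀ t₀ (2 * ρ), |u z| ^ m with ha
  have haI : I = a * V * ρ ^ (1 + n / P) := by
    have hv : volume.real (cyl p x₀ t₀ (2 * ρ)) = V * ρ ^ (1 + n / P) := by
      rw [Measure.real, volume_cyl (by omega) x₀ t₀ (by linarith),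
        ENNReal.toReal_ofReal (by positivity), Real.mul_rpow (by norm_num) hρ.le, hV]
      ring
    rw [ha, setAverage_eq, hv, smul_eq_mul, ← hI]
    have : 0 < ρ ^ (1 + n / P) := by positivity
    field_simp
  have ha0 : 0 ≤ a := by
    rw [ha, setAverage_eq, smul_eq_mul, ← hI]; positivity
  set k : ℝ := 1 + √ρ + L * a ^ (1 / μ) with hk
  have hLa : 0 ≤ L * a ^ (1 / μ) := by positivity
  have hk1 : 1 + √ρ ≤ k := by linarith
  have hk0 : 0 < k := by linarith [Real.sqrt_nonneg ρ]
  have hstep := H hδ hu hρ hQ hE hk1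
  rw [hIl] at hstep
  -- smallness of the first integral
  have hGk : G * a ^ κ ≤ k ^ ((m - 2) * ε) := by
    calc G * a ^ κ = (L * a ^ (1 / μ)) ^ ((m - 2) * ε) := by
          rw [Real.mul_rpow hL0 (by positivity), hL, ← Real.rpow_mul hG0,
            one_div_mul_cancel hσ0.ne', Real.rpow_one, ← Real.rpow_mul ha0, hσ]
          congr 2
          field_simp
      _ ≤ k ^ ((m - 2) * ε) :=
          Real.rpow_le_rpow hLa (by linarith [Real.sqrt_nonneg ρ]) hσ0.le
  have hY0 : levelIntegral p x₀ t₀ ρ u k 0 ≤ ENNReal.ofReal (k ^ (2 - m) * I) := by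
    unfold levelIntegral
    rw [nestedCyl_zero hρ, ENNReal.ofReal_mul (by positivity), ← hIl,
      ← lintegral_const_mul' _ _ ENNReal.ofReal_ne_top]
    refine lintegral_mono fun z => ?_
    rw [ENNReal.ofReal_rpow_of_nonneg (abs_nonneg _) (by linarith),
      ← ENNReal.ofReal_mul (by positivity)]
    apply ENNReal.ofReal_le_ofReal
    have := sq_posPart_le_rpow (s := u z) hk0 hm
    -- The level of index 0 is k(2 - 1) = k.
    norm_num at this ⊢
    exact this
  set B : ℝ≥0∞ := ENNReal.ofReal c * ENNReal.ofReal (1 / ρ) ^ (1 + ε) * ENNReal.ofReal I ^ (1 - θ) with hB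
  have hχθ : (1 + P / n) * θ = 1 + ε := by rw [hε]; ring
  have hiter : ∀ j, levelIntegral p x₀ t₀ ρ u k (j + 1) ≤
      B * ENNReal.ofReal b ^ j * levelIntegral p x₀ t₀ ρ u k j ^ (1 + ε) := by
    intro j
    refine (hstep j).trans (le_of_eq ?_)
    have h16 : ENNReal.ofReal (16 ^ j / ρ) ^ (1 + ε) =
        ENNReal.ofReal b ^ j * ENNReal.ofReal (1 / ρ) ^ (1 + ε) := by
      rw [div_eq_mul_one_div, ENNReal.ofReal_mul (by positivity),
        ENNReal.mul_rpow_of_nonneg _ _ (by positivity), hb,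
        ← ENNReal.ofReal_rpow_of_pos (by norm_num : (0 : ℝ) < 16),
        ENNReal.ofReal_pow (by norm_num), ← ENNReal.rpow_natCast_mul, mul_comm (j : ℝ),
        ENNReal.rpow_mul_natCast]
    rw [hχθ, ENNReal.mul_rpow_of_nonneg _ _ (by positivity), h16, hB]
    ring
  have hsmall : B * levelIntegral p x₀ t₀ ρ u k 0 ^ ε * ENNReal.ofReal b ^ (1 / ε) ≤ 1 := by
    calc _ ≤ B * ENNReal.ofReal (k ^ (2 - m) * I) ^ ε * ENNReal.ofReal b ^ (1 / ε) := by gcongr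
      _ = ENNReal.ofReal (c * (1 / ρ) ^ (1 + ε) * I ^ (1 - θ) * (k ^ (2 - m) * I) ^ ε *
            b ^ (1 / ε)) := by
          rw [hB, ENNReal.ofReal_rpow_of_nonneg (by positivity) (by positivity),
            ENNReal.ofReal_rpow_of_nonneg hI0 hθ1,
            ENNReal.ofReal_rpow_of_nonneg (by positivity) hε0.le,
            ENNReal.ofReal_rpow_of_nonneg hb0.le (by positivity),
            ← ENNReal.ofReal_mul (by positivity), ← ENNReal.ofReal_mul (by positivity),
            ← ENNReal.ofReal_mul (by positivity), ← ENNReal.ofReal_mul (by positivity)]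
      _ ≤ ENNReal.ofReal 1 := by
          apply ENNReal.ofReal_le_ofReal
          -- Scale invariance: the power of ρ from the measure of the cylinder is the reciprocal of
          -- the factor ρ^{-(1+ε)} of the cut-offs.
          have hρe : (ρ ^ (1 + n / P)) ^ κ = ρ ^ (1 + ε) := by
            rw [← Real.rpow_mul hρ.le, ← hχθ, hκ]
            congr 1
            field_simp
            ring
          have hIκ : I ^ (1 - θ) * I ^ ε = a ^ κ * V ^ κ * ρ ^ (1 + ε) := by
            rw [← Real.rpow_add_of_nonneg hI0 hθ1 hε0.le, hκε, haI,
              Real.mul_rpow (by positivity) (by positivity), Real.mul_rpow ha0 hV0.le, hρe]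
          have hkk : (k ^ (2 - m)) ^ ε * k ^ ((m - 2) * ε) = 1 := by
            rw [← Real.rpow_mul hk0.le, ← Real.rpow_add hk0]
            ring_nf
            exact Real.rpow_zero _
          calc _ = c * b ^ (1 / ε) * (1 / ρ) ^ (1 + ε) * (I ^ (1 - θ) * I ^ ε) *
                (k ^ (2 - m)) ^ ε := by
                rw [Real.mul_rpow (by positivity) hI0]; ring
            _ = G * a ^ κ * (k ^ (2 - m)) ^ ε * ((1 / ρ) ^ (1 + ε) * ρ ^ (1 + ε)) := by
                rw [hIκ, hG]; ring
            _ = G * a ^ κ * (k ^ (2 - m)) ^ ε := by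
                rw [← Real.mul_rpow (by positivity) hρ.le, one_div_mul_cancel hρ.ne',
                  Real.one_rpow, mul_one]
            _ ≤ k ^ ((m - 2) * ε) * (k ^ (2 - m)) ^ ε := by gcongr
            _ = 1 := by rw [mul_comm, hkk]
      _ = 1 := ENNReal.ofReal_one
  have hlim := tendsto_zero_of_le_mul_rpow hε0
    (by rw [← ENNReal.ofReal_one, ENNReal.ofReal_lt_ofReal_iff hb0, hb]
        exact Real.one_lt_rpow (by norm_num) (by linarith))
    ENNReal.ofReal_ne_top (ne_top_of_le_ne_top ENNReal.ofReal_ne_top hY0) hiter hsmall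
  -- conclusion
  have hle : ∀ j, ∫⁻ z in cyl p x₀ t₀ ρ, ENNReal.ofReal (max (u z - k * 2) 0 ^ 2) ≤
      levelIntegral p x₀ t₀ ρ u k j := fun j => by
    unfold levelIntegral
    refine (lintegral_mono_set (cyl_subset_nestedCyl hp hρ x₀ t₀ j)).trans
      (lintegral_mono fun z => ?_)
    apply ENNReal.ofReal_le_ofReal
    refine pow_le_pow_left₀ (le_max_right _ _) (max_le_max ?_ le_rfl) 2
    have : 0 < k * (1 / 2) ^ j := by positivity
    linarith
  have hzero : ∫⁻ z in cyl p x₀ t₀ ρ, ENNReal.ofReal (max (u z - k * 2) 0 ^ 2) = 0 :=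
    le_antisymm (ge_of_tendsto' hlim hle) zero_le
  have hsub : cyl p x₀ t₀ ρ ⊆ cyl p x₀ t₀ (2 * ρ) := by
    rw [← nestedCyl_zero hρ]; exact cyl_subset_nestedCyl hp hρ x₀ t₀ 0
  have humeas : AEMeasurable u (volume.restrict (cyl p x₀ t₀ ρ)) :=
    (huL.1.mono_measure (Measure.restrict_mono hsub le_rfl)).aemeasurable
  rw [lintegral_eq_zero_iff' (((humeas.sub_const _).max aemeasurable_const).pow_const
    2).ennreal_ofReal] at hzero
  filter_upwards [hzero] with z hz
  have h1 : max (u z - k * 2) 0 ^ 2 ≤ 0 := by simpa using hz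
  have h2 : u z ≤ k * 2 := by
    by_contra hlt
    rw [not_le] at hlt
    rw [max_eq_left (by linarith)] at h1
    have : 0 < u z - k * 2 := by linarith
    nlinarith
  have h3 : 0 ≤ a ^ (1 / μ) := by positivity
  rw [hk] at h2
  -- The bound obtained is u ≤ 2k; the constant 2(1 + L) dominates all coefficients of 2k.
  have h4 : 2 * (1 + L) * (a ^ (1 / μ) + 1 + √ρ) =
      (1 + √ρ + L * a ^ (1 / μ)) * 2 + (2 * a ^ (1 / μ) + 2 * L + 2 * (L * √ρ)) := by ring
  have h5 := mul_nonneg hL0 (Real.sqrt_nonneg ρ)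
  rw [h4]
  linarith

end Iteration

/-! ### Local boundedness in the De Giorgi classes -/

section SupBound

variable {n : ℕ} {p : Fin n → ℝ}

theorem MemLpLoc.neg {α : Type*} [TopologicalSpace α] [MeasureSpace α] {f : α → ℝ} {q : ℝ≥0∞}
    {U : Set α} (h : MemLpLoc f q U) : MemLpLoc (fun z => -f z) q U :=
  fun K hK hKU => (h K hK hKU).neg

theorem MemSobolevLoc.neg {Ω : Set (Fin n → ℝ)} {T : ℝ} {u : (Fin n → ℝ) × ℝ → ℝ}
    {Du : Fin n → (Fin n → ℝ) × ℝ → ℝ} (h : MemSobolevLoc p Ω T u Du) :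
    MemSobolevLoc p Ω T (fun z => -u z) (fun i z => -Du i z) := by
  refine ⟨h.1.neg, fun i => ⟨(h.2 i).1.neg, ?_⟩⟩
  filter_upwards [(h.2 i).2] with t ht
  refine ⟨ht.1.neg, ht.2.1.neg, fun φ hφ => ?_⟩
  have := ht.2.2 φ hφ
  simp only [neg_mul, integral_neg] at this ⊢
  rw [this]

/-- A backward cylinder with vertex `z` is not a neighbourhood of `z`, so the vertex is moved up in
time by half of the height of the inner cylinder. -/
theorem exists_cyl_mem_nhds {Ω : Set (Fin n → ℝ)} (hΩ : IsOpen Ω) {T : ℝ}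
    (hp : ∀ i, 1 < p i) (hp2 : ∀ i, p i < 2) {z : (Fin n → ℝ) × ℝ} (hz : z ∈ spaceTime Ω T) :
    ∃ t₀ ρ : ℝ, 0 < ρ ∧ cyl p z.1 t₀ ρ ∈ nhds z ∧
      closure (cyl p z.1 t₀ (2 * ρ)) ⊆ spaceTime Ω T := by
  obtain ⟨ε, hε, hball⟩ := Metric.isOpen_iff.1 (hΩ.prod isOpen_Ioo) z hz
  set r := min 1 (min ε (ε ^ 2)) / 2 with hr
  have hr0 : 0 < r := by positivity
  have hr1 : r < 1 := by
    have := min_le_left 1 (min ε (ε ^ 2)); rw [hr]; linarith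
  have hmin : 0 < min 1 (min ε (ε ^ 2)) := by positivity
  have hrε : r < ε := by
    have := (min_le_right 1 (min ε (ε ^ 2))).trans (min_le_left _ _); rw [hr]; linarith
  have hrε2 : r < ε ^ 2 := by
    have := (min_le_right 1 (min ε (ε ^ 2))).trans (min_le_right _ _); rw [hr]; linarith
  have hri : ∀ i, r ^ (1 / p i) < ε := fun i => by
    have hpi : 0 < p i := by linarith [hp i]
    calc r ^ (1 / p i) ≤ r ^ (1 / 2 : ℝ) :=
          Real.rpow_le_rpow_of_exponent_ge hr0 hr1.le (one_div_le_one_div_of_le hpi (hp2 i).le)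
      _ = √r := (Real.sqrt_eq_rpow r).symm
      _ < ε := by rw [Real.sqrt_lt' hε]; exact hrε2
  refine ⟨z.2 + r / 4, r / 2, by positivity, ?_, ?_⟩
  · have ho : IsOpen (cyl p z.1 (z.2 + r / 4) (r / 2)) :=
      (isOpen_set_pi finite_univ fun _ _ => isOpen_Ioo).prod isOpen_Ioo
    refine ho.mem_nhds ⟨fun i _ => ?_, ?_⟩
    · have : 0 < (r / 2) ^ (1 / p i) := by positivity
      exact ⟨by linarith, by linarith⟩
    · exact ⟨by linarith, by linarith⟩
  · rw [mul_div_cancel₀ r (by norm_num), closure_cyl _ _ hr0]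
    refine Subset.trans (fun y hy => ?_) hball
    rw [Metric.mem_ball, Prod.dist_eq, max_lt_iff, dist_pi_lt_iff hε]
    refine ⟨fun i => ?_, ?_⟩
    · have := hy.1 i (mem_univ i)
      have h := hri i
      rw [Real.dist_eq, abs_lt]
      exact ⟨by linarith [this.1], by linarith [this.2]⟩
    · have := hy.2
      rw [Real.dist_eq, abs_lt]
      exact ⟨by linarith [this.1], by linarith [this.2]⟩

/-- Local boundedness of functions in the De Giorgi classes. -/
theorem DeGiorgiClass.exists_supBound (hn : 2 ≤ n)
    (hp : ∀ i, 1 < p i ∧ p i < harmonicAvg p * (1 + 2 / (n : ℝ)))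
    (hpn : harmonicAvg p < n) (hsub : harmonicAvg p ≤ 2 * (n : ℝ) / ((n : ℝ) + 2)) {m : ℝ}
    (hm : (n : ℝ) / harmonicAvg p * (2 - harmonicAvg p) < m) {𝒞 : ℝ} (h𝒞 : 0 < 𝒞) (δmax : ℝ) :
    ∃ C : ℝ, 0 < C ∧ ∀ δ : Fin n → ℝ, (∀ i, 0 ≤ δ i) → ⨆ i, δ i = δmax →
      ∀ Ω : Set (Fin n → ℝ), IsOpen Ω → ∀ (T : ℝ) (u : (Fin n → ℝ) × ℝ → ℝ),
        DeGiorgiClass p δ Ω T 𝒞 u → MemLpLoc u (ENNReal.ofReal m) (spaceTime Ω T) →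
        MemLpLoc u ⊤ (spaceTime Ω T) ∧ SupBound p m C Ω T u := by
  have hn0 : (0 : ℝ) < n := by positivity
  have hP : 0 < harmonicAvg p := harmonicAvg_pos (by omega) fun i => by linarith [(hp i).1]
  have hq : harmonicAvg p * (1 + 2 / n) ≤ 2 := by
    rw [le_div_iff₀ (by positivity)] at hsub
    have : harmonicAvg p * (1 + 2 / n) = harmonicAvg p * (n + 2) / n := by field_simp
    rw [this, div_le_iff₀ hn0]
    exact hsub
  -- The threshold (n/P)(2 - P) is at least 2 precisely when P ≤ 2n/(n+2).
  have hm2 : 2 < m := by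
    refine lt_of_le_of_lt ?_ hm
    rw [div_mul_eq_mul_div, le_div_iff₀ hP]
    rw [le_div_iff₀ (by positivity)] at hsub
    linarith
  have hp1 : ∀ i, 1 < p i := fun i => (hp i).1
  have hp2 : ∀ i, p i < 2 := fun i => (hp i).2.trans_le hq
  obtain ⟨C, hC, H⟩ := exists_ae_le hn hp1 hp2 hpn hm2 hq hm h𝒞 δmax
  refine ⟨C, hC, fun δ hδ hδm Ω hΩ T u hu hum => ?_⟩
  obtain ⟨-, Du, hDu, hE⟩ := hu
  have hδ' : ∀ i, 0 ≤ δ i ∧ δ i ≤ δmax := fun i =>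
    ⟨hδ i, hδm ▸ le_ciSup (Set.finite_range δ).bddAbove i⟩
  have hbound : ∀ (x₀ : Fin n → ℝ) (t₀ ρ : ℝ), 0 < ρ →
      closure (cyl p x₀ t₀ (2 * ρ)) ⊆ spaceTime Ω T →
      ∀ᵐ z ∂(volume.restrict (cyl p x₀ t₀ ρ)),
        |u z| ≤ C * ((⨍ z in cyl p x₀ t₀ (2 * ρ), |u z| ^ m) ^
          (1 / (m - (n : ℝ) / harmonicAvg p * (2 - harmonicAvg p))) + 1 + √ρ) := by
    intro x₀ t₀ ρ hρ hQ
    have h1 := H hδ' hDu hum hρ hQ fun ζ hζ k =>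
      (hE x₀ t₀ (2 * ρ) (by linarith) hQ ζ hζ k).1
    -- The lower bound: the energy inequality for (u - k)₋ at level -k is the one for (-u - k)₊.
    have h2 := H hδ' hDu.neg hum.neg hρ hQ fun ζ hζ k => by
      have h3 := (hE x₀ t₀ (2 * ρ) (by linarith) hQ ζ hζ (-k)).2
      unfold EnergyInequality at h3 ⊢
      have e1 : ∀ z, max (-k - u z) 0 = max (-u z - k) 0 := fun z => by
        congr 1; ring
      have e2 : {z | u z < -k} = {z | k < -u z} := by
        ext z; exact ⟨fun h => by simp only [mem_ofPred_eq] at *; linarith,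
          fun h => by simp only [mem_ofPred_eq] at *; linarith⟩
      simp only [e1, e2] at h3
      simpa only [abs_neg] using h3
    simp only [abs_neg] at h2
    filter_upwards [h1, h2] with z hz1 hz2
    exact abs_le.2 ⟨by linarith, hz1⟩
  refine ⟨fun K hK hKs => ?_, fun x₀ t₀ ρ hρ hQ => ?_⟩
  · have hb : ∃ B : ℝ, ∀ᵐ z ∂(volume.restrict K), ‖u z‖ ≤ B := by
      refine hK.induction_on (p := fun s => ∃ B : ℝ, ∀ᵐ z ∂(volume.restrict s), ‖u z‖ ≤ B)
        ⟨0, by simp⟩ (fun s t hst ⟨B, hB⟩ => ⟨B, ae_restrict_of_ae_restrict_of_subset hst hB⟩)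
        (fun s t ⟨B, hB⟩ ⟨B', hB'⟩ => ⟨max B B', ?_⟩) fun z hz => ?_
      · rw [ae_restrict_union_iff]
        exact ⟨hB.mono fun z hz => hz.trans (le_max_left _ _),
          hB'.mono fun z hz => hz.trans (le_max_right _ _)⟩
      · obtain ⟨t₀, ρ, hρ, hn, hQ⟩ := exists_cyl_mem_nhds hΩ hp1 hp2 (hKs hz)
        exact ⟨_, mem_nhdsWithin_of_mem_nhds hn, _, hbound z.1 t₀ ρ hρ hQ⟩
    obtain ⟨B, hB⟩ := hb
    exact memLp_top_of_bound (hum K hK hKs).1 B hB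
  · refine essSup_le_of_ae_le _ ?_
    filter_upwards [hbound x₀ t₀ ρ hρ hQ] with z hz
    exact ENNReal.ofReal_le_ofReal hz

end SupBound

/-! ### The chain rule for weak solutions, by mollification in space-time -/

section WeakChainRule

open Filter Metric
open scoped Topology

/-- Hölder's inequality after splitting F_j H_j - fh = F_j(H_j - h) + (F_j - f)h, the norms of F_j
being convergent. -/
theorem tendsto_integral_mul_of_eLpNorm_sub {α : Type*} [MeasurableSpace α] {μ : Measure α}
    {p q : ℝ≥0∞} [hpq : p.HolderTriple q 1] (hp : 1 ≤ p) {F H : ℕ → α → ℝ} {f h : α → ℝ}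
    (hF : ∀ j, MemLp (F j) p μ) (hf : MemLp f p μ) (hH : ∀ j, MemLp (H j) q μ) (hh : MemLp h q μ)
    (hFf : Tendsto (fun j => eLpNorm (F j - f) p μ) atTop (𝓝 0))
    (hHh : Tendsto (fun j => eLpNorm (H j - h) q μ) atTop (𝓝 0)) :
    Tendsto (fun j => ∫ x, F j x * H j x ∂μ) atTop (𝓝 (∫ x, f x * h x ∂μ)) := by
  have hFn := tendsto_eLpNorm_of_sub hp (fun j => (hF j).1) hf hFf
  refine tendsto_integral_of_eLpNorm_sub (F := fun j => F j * H j) (G := f * h)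
    (fun j => (hF j).integrable_mul (hH j)) (hf.integrable_mul hh) ?_
  have hle : ∀ j, eLpNorm (F j * H j - f * h) 1 μ ≤
      eLpNorm (F j) p μ * eLpNorm (H j - h) q μ + eLpNorm (F j - f) p μ * eLpNorm h q μ := by
    intro j
    have e : F j * H j - f * h = F j • (H j - h) + (F j - f) • h := by
      simp only [smul_eq_mul]; ring
    rw [e]
    refine (eLpNorm_add_le ((hF j).1.smul ((hH j).1.sub hh.1))
      (((hF j).1.sub hf.1).smul hh.1) le_rfl).trans ?_
    exact add_le_add (eLpNorm_smul_le_mul_eLpNorm ((hH j).1.sub hh.1) (hF j).1)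
      (eLpNorm_smul_le_mul_eLpNorm hh.1 ((hF j).1.sub hf.1))
  have hlim : Tendsto (fun j => eLpNorm (F j) p μ * eLpNorm (H j - h) q μ +
      eLpNorm (F j - f) p μ * eLpNorm h q μ) atTop (𝓝 0) := by
    have h1 := ENNReal.Tendsto.mul hFn (Or.inr ENNReal.zero_ne_top) hHh (Or.inr hf.2.ne)
    have h2 := ENNReal.Tendsto.mul_const hFf (b := eLpNorm h q μ) (Or.inr hh.2.ne)
    simpa using h1.add h2
  exact tendsto_of_tendsto_of_tendsto_of_le_of_le tendsto_const_nhds hlim (fun _ => zero_le) hle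

variable {E : Type*} [NormedAddCommGroup E] [NormedSpace ℝ E] [FiniteDimensional ℝ E]
  [MeasurableSpace E] [BorelSpace E] {μ : Measure E} [μ.IsAddHaarMeasure]

theorem integral_mul_fderiv_eq_neg {f Φ : E → ℝ} (hf : ContDiff ℝ 1 f) (hΦ : ContDiff ℝ 1 Φ)
    (hΦs : HasCompactSupport Φ) (v : E) :
    ∫ x, f x * fderiv ℝ Φ x v ∂μ = -∫ x, fderiv ℝ f x v * Φ x ∂μ := by
  have hcf : Continuous fun x => fderiv ℝ f x v :=
    (hf.continuous_fderiv one_ne_zero).clm_apply continuous_const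
  have hcΦ : Continuous fun x => fderiv ℝ Φ x v :=
    (hΦ.continuous_fderiv one_ne_zero).clm_apply continuous_const
  refine integral_mul_fderiv_eq_neg_fderiv_mul_of_integrable
    ((hcf.mul hΦ.continuous).integrable_of_hasCompactSupport hΦs.mul_left)
    ((hf.continuous.mul hcΦ).integrable_of_hasCompactSupport
      (HasCompactSupport.mul_left (hΦs.fderiv_apply ℝ v)))
    ((hf.continuous.mul hΦ.continuous).integrable_of_hasCompactSupport hΦs.mul_left)
    (fun x _ => hf.differentiable one_ne_zero x) fun x _ => hΦ.differentiable one_ne_zero x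

/-- The smooth form of the chain rule for solutions of `∂₀U = ∑ ∂ᵢAᵢ`. -/
theorem integral_softSq_mul_fderiv_of_contDiff {ι : Type*} [Fintype ι] {U : E → ℝ}
    {A D : ι → E → ℝ} {v₀ : E} {v : ι → E} (hU : ContDiff ℝ 1 U) (hA : ∀ i, ContDiff ℝ 1 (A i))
    (hD : ∀ i, Continuous (D i)) {Φ : E → ℝ} (hΦ : ContDiff ℝ 1 Φ) (hΦs : HasCompactSupport Φ)
    (h0 : ∀ x ∈ tsupport Φ, fderiv ℝ U x v₀ = ∑ i, fderiv ℝ (A i) x (v i))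
    (hi : ∀ x ∈ tsupport Φ, ∀ i, fderiv ℝ U x (v i) = D i x) (k : ℝ) (j : ℕ) :
    ∫ x, softSq k j (U x) * fderiv ℝ Φ x v₀ ∂μ =
      ∑ i, (∫ x, A i x * (softStep k j (U x) * Φ x * D i x) ∂μ +
        ∫ x, A i x * (softPos k j (U x) * fderiv ℝ Φ x (v i)) ∂μ) := by
  have hB : ContDiff ℝ 1 fun x => softSq k j (U x) := (contDiff_softSq k j).comp hU
  have hβ : ContDiff ℝ 1 fun x => softPos k j (U x) := (contDiff_softPos k j).comp hU
  have hUd : ∀ x, HasFDerivAt U (fderiv ℝ U x) x := fun x =>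
    (hU.differentiable one_ne_zero x).hasFDerivAt
  have hcβ : Continuous fun x => softPos k j (U x) := hβ.continuous
  have hcb : Continuous fun x => softStep k j (U x) := (continuous_softStep k j).comp hU.continuous
  have hcA : ∀ i, Continuous fun x => fderiv ℝ (A i) x (v i) := fun i =>
    ((hA i).continuous_fderiv one_ne_zero).clm_apply continuous_const
  have hcΦ : ∀ w, Continuous fun x => fderiv ℝ Φ x w := fun w =>
    (hΦ.continuous_fderiv one_ne_zero).clm_apply continuous_const
  have hβΦ : ContDiff ℝ 1 fun x => softPos k j (U x) * Φ x := hβ.mul hΦ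
  have hβΦs : HasCompactSupport fun x => softPos k j (U x) * Φ x := hΦs.mul_left
  have hdB : ∀ x, fderiv ℝ (fun x => softSq k j (U x)) x v₀ =
      softPos k j (U x) * fderiv ℝ U x v₀ := fun x => by
    have := (hasDerivAt_softSq k j (U x)).comp_hasFDerivAt x (hUd x)
    rw [HasFDerivAt.fderiv (f := fun x => softSq k j (U x)) this]
    rfl
  have hdβ : ∀ x w, fderiv ℝ (fun x => softPos k j (U x) * Φ x) x w =
      softStep k j (U x) * Φ x * fderiv ℝ U x w + softPos k j (U x) * fderiv ℝ Φ x w :=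
    fun x w => by
    have h1 := (hasDerivAt_softPos k j (U x)).comp_hasFDerivAt x (hUd x)
    have h2 := HasFDerivAt.fun_mul (c := fun x => softPos k j (U x)) h1
      (hΦ.differentiable one_ne_zero x).hasFDerivAt
    rw [h2.fderiv]
    simp only [add_apply, smul_apply, smul_eq_mul]
    ring
  have hz : ∀ x, x ∉ tsupport Φ → Φ x = 0 := fun x hx => eq_zero_of_notMem_tsupport hx
  -- The derivative along `v₀` is moved onto `softSq`, whose derivative is `softPos`; the equation
  -- replaces it by the divergence of `A`, and a second integration by parts moves the derivatives
  -- off `A`.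
  rw [integral_mul_fderiv_eq_neg hB hΦ hΦs]
  have e1 : ∀ x, fderiv ℝ (fun x => softSq k j (U x)) x v₀ * Φ x =
      ∑ i, fderiv ℝ (A i) x (v i) * (softPos k j (U x) * Φ x) := fun x => by
    rw [hdB]
    by_cases hx : x ∈ tsupport Φ
    · rw [h0 x hx, ← Finset.sum_mul]; ring
    · simp [hz x hx]
  simp only [e1]
  have hI : ∀ i, Integrable (fun x => fderiv ℝ (A i) x (v i) * (softPos k j (U x) * Φ x)) μ :=
    fun i => ((hcA i).mul hβΦ.continuous).integrable_of_hasCompactSupport hβΦs.mul_left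
  rw [integral_finsetSum _ fun i _ => hI i, ← Finset.sum_neg_distrib]
  refine Finset.sum_congr rfl fun i _ => ?_
  rw [← integral_mul_fderiv_eq_neg (hA i) hβΦ hβΦs, ← integral_add]
  · congr with x
    rw [hdβ]
    by_cases hx : x ∈ tsupport Φ
    · rw [hi x hx i]; ring
    · simp [hz x hx]
  · exact ((hA i).continuous.mul ((hcb.mul hΦ.continuous).mul
      (hD i))).integrable_of_hasCompactSupport (hΦs.mul_left.mul_right.mul_left)
  · exact ((hA i).continuous.mul (hcβ.mul (hcΦ _))).integrable_of_hasCompactSupport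
      (HasCompactSupport.mul_left (HasCompactSupport.mul_left (hΦs.fderiv_apply ℝ (v i))))

/-- The chain rule for weak solutions of `∂₀U = ∑ ∂ᵢAᵢ`, with truncated test functions. -/
theorem integral_softSq_mul_fderiv {ι : Type*} [Fintype ι] {W : Set E} (hW : IsOpen W) {U : E → ℝ}
    {A D : ι → E → ℝ} {v₀ : E} {v : ι → E} {p : ι → ℝ} (hp : ∀ i, 1 < p i) (hU : Integrable U μ)
    (hA1 : ∀ i, Integrable (A i) μ) (hD1 : ∀ i, Integrable (D i) μ)
    (hA : ∀ i, MemLp (A i) (ENNReal.ofReal (p i).conjExponent) μ)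
    (hD : ∀ i, MemLp (D i) (ENNReal.ofReal (p i)) μ)
    (hUA : ∀ η, IsTestFunction W η →
      ∫ x, (U x * fderiv ℝ η x v₀ - ∑ i, A i x * fderiv ℝ η x (v i)) ∂μ = 0)
    (hUD : ∀ i η, IsTestFunction W η → ∫ x, (U x * fderiv ℝ η x (v i) + D i x * η x) ∂μ = 0)
    {Φ : E → ℝ} (hΦ : IsTestFunction W Φ) (k : ℝ) (j : ℕ) :
    ∫ x, softSq k j (U x) * fderiv ℝ Φ x v₀ ∂μ =
      ∑ i, (∫ x, A i x * (softStep k j (U x) * Φ x * D i x) ∂μ +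
        ∫ x, A i x * (softPos k j (U x) * fderiv ℝ Φ x (v i)) ∂μ) := by
  obtain ⟨φ, hφ, hφ'⟩ := exists_contDiffBump_seq E
  obtain ⟨δ, hδ, hδW⟩ := hΦ.2.1.isCompact.exists_cthickening_subset_open hW hΦ.2.2
  have hΦ1 : ContDiff ℝ 1 Φ := hΦ.1.of_le (by simp)
  have hmc : ∀ {f : E → ℝ}, Integrable f μ → ∀ h, ContDiff ℝ 1 (mollify μ (φ h) f) :=
    fun hf h => contDiff_mollify (φ h) hf.locallyIntegrable
  have hcΦ : ∀ w, Continuous fun x => fderiv ℝ Φ x w := fun w =>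
    (hΦ1.continuous_fderiv one_ne_zero).clm_apply continuous_const
  obtain ⟨M, hM⟩ := hΦ1.continuous.bounded_above_of_compact_support hΦ.2.1
  have hM' : ∀ w, ∃ M', ∀ x, ‖fderiv ℝ Φ x w‖ ≤ M' := fun w =>
    (hcΦ w).bounded_above_of_compact_support (hΦ.2.1.fderiv_apply ℝ w)
  have hq : ∀ i, 1 < (p i).conjExponent := fun i =>
    (Real.HolderConjugate.conjExponent (hp i)).symm.lt
  have hUae := ae_tendsto_mollify hφ hφ' hU.locallyIntegrable
  -- The relations between U, A and D are linear, so once the mollification radius is small they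
  -- hold classically for the mollified functions near the support of Φ.
  have key : ∀ᶠ h in atTop, ∫ x, softSq k j (mollify μ (φ h) U x) * fderiv ℝ Φ x v₀ ∂μ =
      ∑ i, (∫ x, mollify μ (φ h) (A i) x *
          (softStep k j (mollify μ (φ h) U x) * Φ x * mollify μ (φ h) (D i) x) ∂μ +
        ∫ x, mollify μ (φ h) (A i) x *
          (softPos k j (mollify μ (φ h) U x) * fderiv ℝ Φ x (v i)) ∂μ) := by
    filter_upwards [hφ.eventually (gt_mem_nhds hδ)] with h hh
    have hball : ∀ x ∈ tsupport Φ, closedBall x (φ h).rOut ⊆ W := fun x hx =>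
      ((closedBall_subset_cthickening hx _).trans (cthickening_mono (le_of_lt hh) _)).trans hδW
    refine integral_softSq_mul_fderiv_of_contDiff (hmc hU h) (fun i => hmc (hA1 i) h)
      (fun i => (hmc (hD1 i) h).continuous) hΦ1 hΦ.2.1 (fun x hx => ?_) (fun x hx i => ?_) k j
    · have := sum_fderiv_mollify_eq (μ := μ) (F := fun o : Option ι => o.elim U A) (g := 0)
        (v := fun o : Option ι => o.elim v₀ (fun i => -v i)) (W := W)
        (fun o => by cases o <;> simp [hU, hA1]) (integrable_zero _ _ _) (fun η hη => ?_)
        (φ h) (hball x hx)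
      · rw [Fintype.sum_option] at this
        simp only [Option.elim, map_neg, Finset.sum_neg_distrib] at this
        rw [mollify_apply] at this
        simp only [Pi.zero_apply, mul_zero, integral_zero] at this
        linarith
      · rw [← hUA η hη]
        congr with y
        rw [Fintype.sum_option]
        simp [sub_eq_add_neg]
    · have := sum_fderiv_mollify_eq (μ := μ) (F := fun _ : Unit => U) (g := D i)
        (v := fun _ : Unit => v i) (W := W) (fun _ => hU) (hD1 i)
        (fun η hη => by simpa using hUD i η hη) (φ h) (hball x hx)
      simpa using this
  have hsub1 : ∀ {f : E → ℝ}, Integrable f μ →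
      Tendsto (fun h => eLpNorm (mollify μ (φ h) f - f) 1 μ) atTop (𝓝 0) := fun {f} hf => by
    have := tendsto_eLpNorm_mollify_sub (μ := μ) hφ le_rfl
      (by simpa using memLp_one_iff_integrable.2 hf : MemLp f (ENNReal.ofReal 1) μ)
    simpa using this
  have hmI : ∀ {f : E → ℝ}, Integrable f μ → ∀ h, Integrable (mollify μ (φ h) f) μ :=
    fun {f} hf h => by
    rw [← memLp_one_iff_integrable] at hf ⊢
    refine ⟨(hmc (memLp_one_iff_integrable.1 hf) h).continuous.aestronglyMeasurable, ?_⟩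
    have := eLpNorm_mollify_le (μ := μ) (φ h) le_rfl hf.1
    rw [ENNReal.ofReal_one] at this
    exact this.trans_lt hf.2
  have hmL : ∀ {f : E → ℝ} {r : ℝ}, 1 < r → Integrable f μ → MemLp f (ENNReal.ofReal r) μ → ∀ h,
      MemLp (mollify μ (φ h) f) (ENNReal.ofReal r) μ := fun {f r} hr hf1 hf h =>
    ⟨(hmc hf1 h).continuous.aestronglyMeasurable,
      (eLpNorm_mollify_le (μ := μ) (φ h) hr.le hf.1).trans_lt hf.2⟩
  -- the left-hand side
  have hlim0 : Tendsto (fun h => ∫ x, softSq k j (mollify μ (φ h) U x) * fderiv ℝ Φ x v₀ ∂μ)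
      atTop (𝓝 (∫ x, softSq k j (U x) * fderiv ℝ Φ x v₀ ∂μ)) := by
    obtain ⟨M', hM'⟩ := hM' v₀
    have hM'0 : 0 ≤ M' := (norm_nonneg _).trans (hM' 0)
    rw [tendsto_iff_norm_sub_tendsto_zero]
    have hB : ∀ {f : E → ℝ}, Integrable f μ →
        Integrable (fun x => softSq k j (f x) * fderiv ℝ Φ x v₀) μ := fun {f} hf => by
      have hb : Integrable (fun x => fderiv ℝ Φ x v₀) μ :=
        (hcΦ v₀).integrable_of_hasCompactSupport (hΦ.2.1.fderiv_apply ℝ v₀)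
      refine Integrable.mono' ((((hf.abs.const_mul (j + 1)).mul_const M').add
        (hb.abs.const_mul ((j + 1) * |k|)))) ?_ (Eventually.of_forall fun x => ?_)
      · exact ((contDiff_softSq k j).continuous.comp_aestronglyMeasurable hf.1).mul
          (hcΦ v₀).aestronglyMeasurable
      · have h2 := lipschitz_softSq k j (f x) k
        rw [softSq_of_le k j le_rfl, sub_zero] at h2
        have h3 : |f x - k| ≤ |f x| + |k| := abs_sub _ _
        have h4 := hM' x
        rw [Real.norm_eq_abs] at h4
        rw [Real.norm_eq_abs, abs_mul]
        calc |softSq k j (f x)| * |fderiv ℝ Φ x v₀|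
            ≤ ((j + 1) * (|f x| + |k|)) * |fderiv ℝ Φ x v₀| := by
              gcongr; exact h2.trans (by gcongr)
          _ = (j + 1) * |f x| * |fderiv ℝ Φ x v₀| + (j + 1) * |k| * |fderiv ℝ Φ x v₀| := by ring
          _ ≤ (j + 1) * |f x| * M' + (j + 1) * |k| * |fderiv ℝ Φ x v₀| := by gcongr
          _ = _ := by simp
    -- The Lipschitz constant j + 1 of `softSq` reduces this limit to L¹ convergence of the
    -- mollifications.
    have hle : ∀ h, ‖∫ x, softSq k j (mollify μ (φ h) U x) * fderiv ℝ Φ x v₀ ∂μ -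
        ∫ x, softSq k j (U x) * fderiv ℝ Φ x v₀ ∂μ‖ ≤
        (j + 1) * M' * (eLpNorm (mollify μ (φ h) U - U) 1 μ).toReal := fun h => by
      rw [← integral_sub (hB (hmI hU h)) (hB hU)]
      have hd := (hmI hU h).sub hU
      have e : (eLpNorm (mollify μ (φ h) U - U) 1 μ).toReal =
          ∫ x, |mollify μ (φ h) U x - U x| ∂μ := by
        rw [eLpNorm_one_eq_lintegral_enorm, ← integral_norm_eq_lintegral_enorm hd.1]
        rfl
      rw [e, ← integral_const_mul]
      refine norm_integral_le_of_norm_le (hd.abs.const_mul _) (Eventually.of_forall fun x => ?_)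
      rw [← sub_mul, norm_mul, Real.norm_eq_abs]
      calc _ ≤ ((j + 1) * |mollify μ (φ h) U x - U x|) * M' :=
            mul_le_mul (lipschitz_softSq k j _ _) (hM' x) (norm_nonneg _) (by positivity)
        _ = _ := by ring
    refine squeeze_zero (fun _ => norm_nonneg _) hle ?_
    have := (ENNReal.tendsto_toReal ENNReal.zero_ne_top).comp (hsub1 hU)
    simpa using this.const_mul ((j + 1) * M')
  -- the right-hand side
  have hlim : ∀ i, Tendsto (fun h => ∫ x, mollify μ (φ h) (A i) x *
          (softStep k j (mollify μ (φ h) U x) * Φ x * mollify μ (φ h) (D i) x) ∂μ +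
        ∫ x, mollify μ (φ h) (A i) x *
          (softPos k j (mollify μ (φ h) U x) * fderiv ℝ Φ x (v i)) ∂μ) atTop
      (𝓝 (∫ x, A i x * (softStep k j (U x) * Φ x * D i x) ∂μ +
        ∫ x, A i x * (softPos k j (U x) * fderiv ℝ Φ x (v i)) ∂μ)) := fun i => by
    have : (ENNReal.ofReal (p i).conjExponent).HolderTriple (ENNReal.ofReal (p i)) 1 :=
      (Real.HolderConjugate.conjExponent (hp i)).symm.ennrealOfReal
    have hUm : ∀ h, Continuous (mollify μ (φ h) U) := fun h => (hmc hU h).continuous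
    refine Tendsto.add ?_ ?_
    · have hbm : ∀ {f : E → ℝ}, AEStronglyMeasurable f μ →
          AEStronglyMeasurable (fun x => softStep k j (f x) * Φ x) μ := fun hf =>
        ((continuous_softStep k j).comp_aestronglyMeasurable hf).mul
          hΦ1.continuous.aestronglyMeasurable
      have hbb : ∀ s x, |softStep k j s * Φ x| ≤ M := fun s x => by
        rw [abs_mul, abs_of_nonneg (softStep_nonneg k j s)]
        calc _ ≤ 1 * |Φ x| := by gcongr; exact softStep_le_one k j s
          _ ≤ M := by rw [one_mul]; exact hM x
      have hconv := tendsto_eLpNorm_mul_sub (μ := μ) (hp i).le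
        (F := fun h => mollify μ (φ h) (D i)) (G := D i)
        (c := fun h x => softStep k j (mollify μ (φ h) U x) * Φ x)
        (d := fun x => softStep k j (U x) * Φ x) (M := M)
        (fun h => (hmc (hD1 i) h).continuous.aestronglyMeasurable) (hD i)
        (fun h => hbm (hUm h).aestronglyMeasurable) (fun h x => hbb _ x)
        (tendsto_eLpNorm_mollify_sub hφ (hp i).le (hD i))
        (hUae.mono fun x hx => (((continuous_softStep k j).tendsto _).comp hx).mul_const _)
      have hmem : ∀ {f g : E → ℝ}, AEStronglyMeasurable f μ → MemLp g (ENNReal.ofReal (p i)) μ →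
          MemLp ((fun x => softStep k j (f x) * Φ x) * g) (ENNReal.ofReal (p i)) μ :=
        fun {f g} hf hg => by
        refine MemLp.of_le_mul (c := M) hg ((hbm hf).mul hg.1) (Eventually.of_forall fun x => ?_)
        rw [Pi.mul_apply, norm_mul]
        gcongr
        exact hbb _ x
      -- The product of A and D is handled by strong convergence in conjugate exponents, the
      -- truncation factor having been absorbed into D.
      exact tendsto_integral_mul_of_eLpNorm_sub (p := ENNReal.ofReal (p i).conjExponent)
        (q := ENNReal.ofReal (p i)) (by simpa using (hq i).le)
        (fun h => hmL (hq i) (hA1 i) (hA i) h) (hA i)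
        (fun h => hmem (hUm h).aestronglyMeasurable (hmL (hp i) (hD1 i) (hD i) h))
        (hmem hU.1 (hD i)) (tendsto_eLpNorm_mollify_sub hφ (hq i).le (hA i)) hconv
    · obtain ⟨M', hM'⟩ := hM' (v i)
      have hM'0 : 0 ≤ M' := (norm_nonneg _).trans (hM' 0)
      have hbm : ∀ {f : E → ℝ}, AEStronglyMeasurable f μ →
          AEStronglyMeasurable (fun x => softPos k j (f x) * fderiv ℝ Φ x (v i)) μ := fun hf =>
        ((continuous_softPos k j).comp_aestronglyMeasurable hf).mul (hcΦ _).aestronglyMeasurable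
      have hbb : ∀ s x, |softPos k j s * fderiv ℝ Φ x (v i)| ≤ (j + 1) * M' := fun s x => by
        rw [abs_mul, abs_of_nonneg (softPos_nonneg k j s)]
        exact mul_le_mul (softPos_le_const k j s) (hM' x) (abs_nonneg _) (by positivity)
      -- Here the factor of A is bounded and converges almost everywhere, so L¹ convergence of A
      -- suffices.
      have hconv := tendsto_eLpNorm_mul_sub (μ := μ) (le_refl (1 : ℝ))
        (F := fun h => mollify μ (φ h) (A i)) (G := A i)
        (c := fun h x => softPos k j (mollify μ (φ h) U x) * fderiv ℝ Φ x (v i))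
        (d := fun x => softPos k j (U x) * fderiv ℝ Φ x (v i)) (M := (j + 1) * M')
        (fun h => (hmc (hA1 i) h).continuous.aestronglyMeasurable)
        (by simpa using memLp_one_iff_integrable.2 (hA1 i))
        (fun h => hbm (hUm h).aestronglyMeasurable) (fun h x => hbb _ x)
        (by simpa using hsub1 (hA1 i))
        (hUae.mono fun x hx => (((continuous_softPos k j).tendsto _).comp hx).mul_const _)
      rw [ENNReal.ofReal_one] at hconv
      have hint : ∀ {f g : E → ℝ}, AEStronglyMeasurable f μ → Integrable g μ →
          Integrable ((fun x => softPos k j (f x) * fderiv ℝ Φ x (v i)) * g) μ :=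
        fun {f g} hf hg => by
        refine Integrable.mono' (hg.norm.const_mul ((j + 1) * M')) ((hbm hf).mul hg.1)
          (Eventually.of_forall fun x => ?_)
        rw [Pi.mul_apply, norm_mul]
        gcongr
        exact hbb _ x
      have := tendsto_integral_of_eLpNorm_sub
        (fun h => hint (hUm h).aestronglyMeasurable (hmI (hA1 i) h)) (hint hU.1 (hA1 i)) hconv
      simpa only [Pi.mul_apply, mul_comm (_ * _) (_ : ℝ)] using this
  exact tendsto_nhds_unique (hlim0.congr' key) (tendsto_finsetSum _ fun i _ => hlim i)

end WeakChainRule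

/-! ### Removal of the bounded truncation -/

section TruncatedIdentity

open Filter Metric
open scoped Topology

variable {E : Type*} [NormedAddCommGroup E] [NormedSpace ℝ E] [FiniteDimensional ℝ E]
  [MeasurableSpace E] [BorelSpace E] {μ : Measure E} [μ.IsAddHaarMeasure]

theorem posPart_sub_le (s k : ℝ) : max (s - k) 0 ≤ |s| + |k| :=
  max_le (by linarith [le_abs_self s, neg_abs_le k]) (by positivity)

/-- The chain rule for weak solutions of `∂₀U = ∑ ∂ᵢAᵢ`, with the test function `(U - k)₊ Φ`. -/
theorem integral_posPart_sq_mul_fderiv {ι : Type*} [Fintype ι] {W : Set E} (hW : IsOpen W)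
    {U : E → ℝ} {A D : ι → E → ℝ} {v₀ : E} {v : ι → E} {p : ι → ℝ} (hp : ∀ i, 1 < p i)
    (hU : Integrable U μ) (hU2 : Integrable (fun x => U x ^ 2) μ)
    (hUp : ∀ i, MemLp U (ENNReal.ofReal (p i)) μ)
    (hA1 : ∀ i, Integrable (A i) μ) (hD1 : ∀ i, Integrable (D i) μ)
    (hA : ∀ i, MemLp (A i) (ENNReal.ofReal (p i).conjExponent) μ)
    (hD : ∀ i, MemLp (D i) (ENNReal.ofReal (p i)) μ)
    (hUA : ∀ η, IsTestFunction W η →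
      ∫ x, (U x * fderiv ℝ η x v₀ - ∑ i, A i x * fderiv ℝ η x (v i)) ∂μ = 0)
    (hUD : ∀ i η, IsTestFunction W η → ∫ x, (U x * fderiv ℝ η x (v i) + D i x * η x) ∂μ = 0)
    {Φ : E → ℝ} (hΦ : IsTestFunction W Φ) (k : ℝ) :
    ∫ x, max (U x - k) 0 ^ 2 / 2 * fderiv ℝ Φ x v₀ ∂μ =
      ∑ i, (∫ x, A i x * ((Ioi k).indicator 1 (U x) * Φ x * D i x) ∂μ +
        ∫ x, A i x * (max (U x - k) 0 * fderiv ℝ Φ x (v i)) ∂μ) := by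
  have hΦ1 : ContDiff ℝ 1 Φ := hΦ.1.of_le (by simp)
  have hcΦ : ∀ w, Continuous fun x => fderiv ℝ Φ x w := fun w =>
    (hΦ1.continuous_fderiv one_ne_zero).clm_apply continuous_const
  obtain ⟨M, hM⟩ := hΦ1.continuous.bounded_above_of_compact_support hΦ.2.1
  have hM' : ∀ w, ∃ M', ∀ x, ‖fderiv ℝ Φ x w‖ ≤ M' := fun w =>
    (hcΦ w).bounded_above_of_compact_support (hΦ.2.1.fderiv_apply ℝ w)
  -- Dominated convergence in `j`; the majorant is a multiple of U² plus a constant times |∂Φ|,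
  -- which uses square integrability.
  have hlim0 : Tendsto (fun j => ∫ x, softSq k j (U x) * fderiv ℝ Φ x v₀ ∂μ) atTop
      (𝓝 (∫ x, max (U x - k) 0 ^ 2 / 2 * fderiv ℝ Φ x v₀ ∂μ)) := by
    obtain ⟨M', hM'⟩ := hM' v₀
    have hb : Integrable (fun x => fderiv ℝ Φ x v₀) μ :=
      (hcΦ v₀).integrable_of_hasCompactSupport (hΦ.2.1.fderiv_apply ℝ v₀)
    refine tendsto_integral_of_dominated_convergence
      (fun x => U x ^ 2 * M' + k ^ 2 * ‖fderiv ℝ Φ x v₀‖)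
      (fun j => ((contDiff_softSq k j).continuous.comp_aestronglyMeasurable hU.1).mul
        (hcΦ v₀).aestronglyMeasurable)
      ((hU2.mul_const M').add (hb.norm.const_mul _))
      (fun j => Eventually.of_forall fun x => ?_)
      (Eventually.of_forall fun x => (tendsto_softSq k (U x)).mul_const _)
    rw [norm_mul, Real.norm_eq_abs (softSq k j (U x)), abs_of_nonneg (softSq_nonneg k j _)]
    have h1 : softSq k j (U x) ≤ U x ^ 2 + k ^ 2 := by
      refine (softSq_le k j _).trans ?_
      have := pow_le_pow_left₀ (le_max_right _ _) (posPart_sub_le (U x) k) 2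
      nlinarith [sq_nonneg (|U x| - |k|), sq_abs (U x), sq_abs k]
    calc _ ≤ (U x ^ 2 + k ^ 2) * ‖fderiv ℝ Φ x v₀‖ := by gcongr
      _ = U x ^ 2 * ‖fderiv ℝ Φ x v₀‖ + k ^ 2 * ‖fderiv ℝ Φ x v₀‖ := by ring
      _ ≤ _ := by gcongr; exact hM' x
  have hlim : ∀ i, Tendsto (fun j => ∫ x, A i x * (softStep k j (U x) * Φ x * D i x) ∂μ +
        ∫ x, A i x * (softPos k j (U x) * fderiv ℝ Φ x (v i)) ∂μ) atTop
      (𝓝 (∫ x, A i x * ((Ioi k).indicator 1 (U x) * Φ x * D i x) ∂μ +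
        ∫ x, A i x * (max (U x - k) 0 * fderiv ℝ Φ x (v i)) ∂μ)) := fun i => by
    have : (ENNReal.ofReal (p i).conjExponent).HolderTriple (ENNReal.ofReal (p i)) 1 :=
      (Real.HolderConjugate.conjExponent (hp i)).symm.ennrealOfReal
    refine Tendsto.add ?_ ?_
    -- The majorant |A_i D_i| is integrable by the conjugacy of the exponents.
    · refine tendsto_integral_of_dominated_convergence (fun x => M * ‖(A i * D i) x‖)
        (fun j => (hA1 i).1.mul ((((continuous_softStep k j).comp_aestronglyMeasurable hU.1).mul
          hΦ1.continuous.aestronglyMeasurable).mul (hD1 i).1))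
        (((hA i).integrable_mul (hD i)).norm.const_mul M)
        (fun j => Eventually.of_forall fun x => ?_)
        (Eventually.of_forall fun x =>
          (((tendsto_softStep k (U x)).mul_const _).mul_const _).const_mul _)
      have h1 : ‖softStep k j (U x) * Φ x‖ ≤ M := by
        rw [norm_mul, Real.norm_eq_abs (softStep k j (U x)),
          abs_of_nonneg (softStep_nonneg k j _)]
        calc _ ≤ 1 * ‖Φ x‖ := by gcongr; exact softStep_le_one k j _
          _ ≤ M := by rw [one_mul]; exact hM x
      rw [Pi.mul_apply, norm_mul, norm_mul (A i x) (D i x),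
        norm_mul (softStep k j (U x) * Φ x) (D i x)]
      calc _ ≤ ‖A i x‖ * (M * ‖D i x‖) :=
            mul_le_mul_of_nonneg_left (mul_le_mul_of_nonneg_right h1 (norm_nonneg _))
              (norm_nonneg _)
        _ = _ := by ring
    · obtain ⟨M', hM'⟩ := hM' (v i)
      have hM'0 : 0 ≤ M' := (norm_nonneg _).trans (hM' 0)
      -- Without the truncation the factor (U - k)₊ is unbounded, and the majorant |A_i U| requires
      -- U to be in L^{p_i}.
      refine tendsto_integral_of_dominated_convergence
        (fun x => M' * ‖(A i * U) x‖ + M' * |k| * ‖A i x‖)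
        (fun j => (hA1 i).1.mul (((continuous_softPos k j).comp_aestronglyMeasurable hU.1).mul
          (hcΦ _).aestronglyMeasurable))
        ((((hA i).integrable_mul (hUp i)).norm.const_mul M').add ((hA1 i).norm.const_mul _))
        (fun j => Eventually.of_forall fun x => ?_)
        (Eventually.of_forall fun x =>
          ((tendsto_softPos k (U x)).mul_const _).const_mul _)
      have h1 : ‖softPos k j (U x)‖ ≤ |U x| + |k| := by
        rw [Real.norm_eq_abs, abs_of_nonneg (softPos_nonneg k j _)]
        exact (softPos_le k j _).trans (posPart_sub_le _ _)
      rw [Pi.mul_apply, norm_mul, norm_mul (A i x) (U x), norm_mul (softPos k j (U x))]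
      calc _ ≤ ‖A i x‖ * ((|U x| + |k|) * M') := by gcongr; exact hM' x
        _ = _ := by rw [Real.norm_eq_abs (U x)]; ring
  exact tendsto_nhds_unique hlim0 ((tendsto_finsetSum _ fun i _ => hlim i).congr fun j =>
    (integral_softSq_mul_fderiv hW hp hU hA1 hD1 hA hD hUA hUD hΦ k j).symm)

end TruncatedIdentity

/-! ### Localization of the weak formulation to a cylinder -/

section Localization

open Filter Metric
open scoped Topology

variable {n : ℕ} {p δ : Fin n → ℝ} {Ω : Set (Fin n → ℝ)} {T : ℝ} {u : (Fin n → ℝ) × ℝ → ℝ}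
  {Du : Fin n → (Fin n → ℝ) × ℝ → ℝ} {x₀ : Fin n → ℝ} {t₀ r : ℝ}

theorem isOpen_cyl : IsOpen (cyl p x₀ t₀ r) :=
  (isOpen_set_pi finite_univ fun _ _ => isOpen_Ioo).prod isOpen_Ioo

theorem le_bigP (i : Fin n) : p i ≤ bigP p :=
  (le_ciSup (Set.finite_range p).bddAbove i).trans (le_max_right _ _)

theorem IsTestFunction.slice {η : (Fin n → ℝ) × ℝ → ℝ} {B : Set (Fin n → ℝ)} {I : Set ℝ}
    (hη : IsTestFunction (B ×ˢ I) η) (t : ℝ) : IsTestFunction B fun x => η (x, t) := by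
  have hsub : tsupport (fun x => η (x, t)) ⊆ (fun x => (x, t)) ⁻¹' tsupport η := by
    refine closure_minimal (fun x hx => subset_tsupport _ hx) ?_
    exact (isClosed_tsupport _).preimage (by fun_prop)
  refine ⟨hη.1.comp (contDiff_id.prodMk contDiff_const), ?_, fun x hx => (hη.2.2 (hsub hx)).1⟩
  refine (hη.2.1.isCompact.image continuous_fst).of_isClosed_subset (isClosed_tsupport _) ?_
  exact fun x hx => ⟨(x, t), hsub hx, rfl⟩

/-- The weak derivatives of the slices are weak derivatives in space-time. -/
theorem MemSobolevLoc.integral_indicator (hu : MemSobolevLoc p Ω T u Du) (hp : ∀ i, 1 < p i)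
    (hr : 0 < r) (hQ : closure (cyl p x₀ t₀ r) ⊆ spaceTime Ω T) (i : Fin n)
    {η : (Fin n → ℝ) × ℝ → ℝ} (hη : IsTestFunction (cyl p x₀ t₀ r) η) :
    ∫ z, ((closure (cyl p x₀ t₀ r)).indicator u z * fderiv ℝ η z (Pi.single i 1, 0) +
      (closure (cyl p x₀ t₀ r)).indicator (Du i) z * η z) = 0 := by
  obtain ⟨hKΩ, hIT⟩ := closedBox_subset_and_Icc_subset hr hQ
  have hKc := isCompact_closure_cyl (p := p) x₀ t₀ hr
  have hη1 : ContDiff ℝ 1 η := hη.1.of_le (by simp)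
  have hcη : Continuous fun z => fderiv ℝ η z (Pi.single i 1, 0) :=
    (hη1.continuous_fderiv one_ne_zero).clm_apply continuous_const
  obtain ⟨M, hM⟩ := hη1.continuous.bounded_above_of_compact_support hη.2.1
  obtain ⟨M', hM'⟩ := hcη.bounded_above_of_compact_support (hη.2.1.fderiv_apply ℝ _)
  have hUI : Integrable ((closure (cyl p x₀ t₀ r)).indicator u) := hu.1.integrable_indicator hKc hQ
  have hDI : Integrable ((closure (cyl p x₀ t₀ r)).indicator (Du i)) := by
    rw [integrable_indicator_iff hKc.measurableSet, IntegrableOn, ← memLp_one_iff_integrable]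
    have : IsFiniteMeasure (volume.restrict (closure (cyl p x₀ t₀ r))) :=
      ⟨by simpa using hKc.measure_lt_top⟩
    exact ((hu.2 i).1 _ hKc hQ).mono_exponent (by simpa using (hp i).le)
  have hint : Integrable fun z => (closure (cyl p x₀ t₀ r)).indicator u z *
      fderiv ℝ η z (Pi.single i 1, 0) + (closure (cyl p x₀ t₀ r)).indicator (Du i) z * η z :=
    (hUI.mul_bdd (c := M') hcη.aestronglyMeasurable (Eventually.of_forall hM')).add
      (hDI.mul_bdd (c := M) hη1.continuous.aestronglyMeasurable (Eventually.of_forall hM))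
  -- Fubini reduces the claim to almost every time slice; slices outside the time interval of the
  -- cylinder contribute nothing because η vanishes on them.
  rw [Measure.volume_eq_prod] at hint ⊢
  rw [integral_prod_symm _ hint]
  refine integral_eq_zero_of_ae ?_
  have hw := (ae_restrict_iff' measurableSet_Ioo).1 (hu.2 i).2
  filter_upwards [hw] with t ht
  have hd : ∀ x, fderiv ℝ η (x, t) (Pi.single i 1, 0) =
      fderiv ℝ (fun y => η (y, t)) x (Pi.single i 1) := fun x => by
    rw [← spaceDeriv_eq_fderiv (hη1.differentiable one_ne_zero _), spaceDeriv]
    exact partialDeriv_eq_fderiv ((hη.slice t).1.differentiable (by simp) x) i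
  simp only [hd, Pi.zero_apply]
  by_cases htI : t ∈ Ioo (t₀ - r) t₀
  · have h := (ht (hIT (Ioo_subset_Icc_self htI))).integral_indicator
      (isCompact_closedBox (p := p) x₀ r) hKΩ
      (by rw [interior_closedBox]; exact hη.slice t)
    rw [← h]
    congr with x
    rw [closure_cyl x₀ t₀ hr]
    have e : ∀ f : (Fin n → ℝ) × ℝ → ℝ, (closedBox p x₀ r ×ˢ Icc (t₀ - r) t₀).indicator f (x, t) =
        (closedBox p x₀ r).indicator (fun y => f (y, t)) x := fun f => by
      by_cases hx : x ∈ closedBox p x₀ r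
      · rw [indicator_of_mem hx, indicator_of_mem (mk_mem_prod hx (Ioo_subset_Icc_self htI))]
      · rw [indicator_of_notMem hx, indicator_of_notMem fun h => hx h.1]
    simp [e]
  · have hz : ∀ x, η (x, t) = 0 := fun x =>
      eq_zero_of_notMem_tsupport fun h => htI (hη.2.2 h).2
    simp [hz]

variable {a : Fin n → (Fin n → ℝ) × ℝ → ℝ} {Λ : ℝ}

theorem abs_flux_le {z : (Fin n → ℝ) × ℝ} {ξ : Fin n → ℝ} {i : Fin n} (ha : |a i z| ≤ Λ) :
    |flux p δ a z ξ i| ≤ Λ * max (|ξ i| - δ i) 0 ^ (p i - 1) := by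
  have h0 : 0 ≤ max (|ξ i| - δ i) 0 ^ (p i - 1) := Real.rpow_nonneg (le_max_right _ _) _
  have hs : |(ξ i / |ξ i|)| ≤ 1 := by rw [abs_div, abs_abs]; exact div_self_le_one _
  rw [flux, abs_mul, abs_mul, abs_of_nonneg h0]
  have hΛ : 0 ≤ Λ := (abs_nonneg _).trans ha
  calc _ ≤ Λ * max (|ξ i| - δ i) 0 ^ (p i - 1) * 1 := by gcongr
    _ = _ := mul_one _

/-- The flux grows at most like |∂_i u|^{p_i - 1}, which lies in the conjugate space L^{p_i/(p_i -
1)}. -/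
theorem memLp_flux {K : Set ((Fin n → ℝ) × ℝ)} {i : Fin n} (hp : 1 < p i) (hδ : 0 ≤ δ i)
    (ham : AEMeasurable (a i) (volume.restrict K)) (ha : ∀ᵐ z ∂(volume.restrict K), |a i z| ≤ Λ)
    (hD : MemLp (Du i) (ENNReal.ofReal (p i)) (volume.restrict K)) :
    MemLp (fun z => flux p δ a z (fun j => Du j z) i) (ENNReal.ofReal (p i).conjExponent)
      (volume.restrict K) := by
  have hDm := hD.1.aemeasurable
  have h1 := hD.norm_rpow_div (ENNReal.ofReal (p i - 1))
  rw [ENNReal.toReal_ofReal (by linarith), ← ENNReal.ofReal_div_of_pos (by linarith)] at h1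
  refine h1.of_le_mul (c := Λ) ?_ ?_
  · refine AEMeasurable.aestronglyMeasurable ?_
    unfold flux
    exact (ham.mul ((((measurable_norm.comp_aemeasurable hDm).sub_const (δ i)).max
      aemeasurable_const).pow_const _)).mul (hDm.div (measurable_norm.comp_aemeasurable hDm))
  · filter_upwards [ha] with z hz
    have hΛ : 0 ≤ Λ := (abs_nonneg _).trans hz
    refine (abs_flux_le hz).trans ?_
    rw [Real.norm_eq_abs, Real.norm_eq_abs,
      abs_of_nonneg (Real.rpow_nonneg (abs_nonneg (Du i z)) (p i - 1))]
    exact mul_le_mul_of_nonneg_left (Real.rpow_le_rpow (le_max_right _ _)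
      (max_le (by linarith) (abs_nonneg _)) (by linarith)) hΛ

/-- The weak formulation, tested with `(u - k)₊ Φ`. -/
theorem integral_posPart_sq_mul_timeDeriv (hp : ∀ i, 1 < p i) (hδ : ∀ i, 0 ≤ δ i)
    (hu : MemSobolevLoc p Ω T u Du) (huP : MemLpLoc u (ENNReal.ofReal (bigP p)) (spaceTime Ω T))
    (ham : ∀ i, AEMeasurable (a i) (volume.restrict (spaceTime Ω T)))
    (ha : ∀ i, ∀ᵐ z ∂(volume.restrict (spaceTime Ω T)), |a i z| ≤ Λ)
    (hsol : ∀ φ, IsTestFunction (spaceTime Ω T) φ → ∫ z in spaceTime Ω T,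
      (u z * timeDeriv φ z - ∑ i, flux p δ a z (fun j => Du j z) i * spaceDeriv i φ z) = 0)
    (hr : 0 < r) (hQ : closure (cyl p x₀ t₀ r) ⊆ spaceTime Ω T)
    {Φ : (Fin n → ℝ) × ℝ → ℝ} (hΦ : IsTestFunction (cyl p x₀ t₀ r) Φ) (k : ℝ) :
    ∫ z in cyl p x₀ t₀ r, max (u z - k) 0 ^ 2 / 2 * timeDeriv Φ z =
      ∑ i, ((∫ z in cyl p x₀ t₀ r, flux p δ a z (fun j => Du j z) i *
          ((Ioi k).indicator 1 (u z) * Φ z * Du i z)) +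
        ∫ z in cyl p x₀ t₀ r, flux p δ a z (fun j => Du j z) i *
          (max (u z - k) 0 * spaceDeriv i Φ z)) := by
  set Q := cyl p x₀ t₀ r with hQdef
  set K := closure Q with hK
  have hKc : IsCompact K := isCompact_closure_cyl x₀ t₀ hr
  have hKm : MeasurableSet K := hKc.measurableSet
  have : IsFiniteMeasure (volume.restrict K) := ⟨by simpa using hKc.measure_lt_top⟩
  -- Integrability to the power `bigP p` gives, on a compact set, both L² and every L^{p_i}, as the
  -- truncated identity demands.
  have hP : ∀ i, ENNReal.ofReal (p i) ≤ ENNReal.ofReal (bigP p) := fun i =>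
    ENNReal.ofReal_le_ofReal (le_bigP i)
  have hP2 : ENNReal.ofReal 2 ≤ ENNReal.ofReal (bigP p) :=
    ENNReal.ofReal_le_ofReal (le_max_left _ _)
  have huK := huP K hKc hQ
  have hDK : ∀ i, MemLp (Du i) (ENNReal.ofReal (p i)) (volume.restrict K) := fun i =>
    (hu.2 i).1 K hKc hQ
  have hAK : ∀ i, MemLp (fun z => flux p δ a z (fun j => Du j z) i)
      (ENNReal.ofReal (p i).conjExponent) (volume.restrict K) := fun i =>
    memLp_flux (hp i) (hδ i) ((ham i).mono_measure (Measure.restrict_mono hQ le_rfl))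
      (ae_restrict_of_ae_restrict_of_subset hQ (ha i)) (hDK i)
  have hq : ∀ i, 1 < (p i).conjExponent := fun i =>
    (Real.HolderConjugate.conjExponent (hp i)).symm.lt
  have hz : ∀ {η : (Fin n → ℝ) × ℝ → ℝ}, IsTestFunction Q η → ∀ z, z ∉ Q →
      η z = 0 ∧ ∀ w, fderiv ℝ η z w = 0 := fun hη z hzQ =>
    ⟨eq_zero_of_notMem_tsupport fun h => hzQ (hη.2.2 h), fun w => by
      rw [fderiv_eq_zero_of_notMem_tsupport fun h => hzQ (hη.2.2 h)]; rfl⟩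
  have hsd : ∀ {η : (Fin n → ℝ) × ℝ → ℝ}, IsTestFunction Q η → ∀ z i,
      spaceDeriv i η z = fderiv ℝ η z (Pi.single i 1, 0) := fun hη z i =>
    spaceDeriv_eq_fderiv (hη.1.differentiable (by simp) z) i
  have htd : ∀ {η : (Fin n → ℝ) × ℝ → ℝ}, IsTestFunction Q η → ∀ z,
      timeDeriv η z = fderiv ℝ η z (0, 1) := fun hη z =>
    timeDeriv_eq_fderiv (hη.1.differentiable (by simp) z)
  have hQK : Q ⊆ K := subset_closure
  have hi : ∀ {f : (Fin n → ℝ) × ℝ → ℝ} {z}, z ∈ Q → K.indicator f z = f z := fun hz =>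
    indicator_of_mem (hQK hz) _
  have hHaar : (volume : Measure ((Fin n → ℝ) × ℝ)).IsAddHaarMeasure := by
    rw [Measure.volume_eq_prod]; infer_instance
  -- All functions are cut to the compact set `K` to become globally integrable; the relations
  -- between them survive for test functions supported in `Q`.
  have h := integral_posPart_sq_mul_fderiv (μ := volume) (W := Q) isOpen_cyl
    (U := K.indicator u) (A := fun i => K.indicator fun z => flux p δ a z (fun j => Du j z) i)
    (D := fun i => K.indicator (Du i)) (v₀ := ((0, 1) : (Fin n → ℝ) × ℝ))
    (v := fun i => (Pi.single i 1, 0)) hp (hu.1.integrable_indicator hKc hQ) ?_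
    (fun i => (memLp_indicator_iff_restrict hKm).2 (huK.mono_exponent (hP i)))
    (fun i => by
      rw [← memLp_one_iff_integrable, memLp_indicator_iff_restrict hKm]
      exact (hAK i).mono_exponent (by simpa using (hq i).le))
    (fun i => by
      rw [← memLp_one_iff_integrable, memLp_indicator_iff_restrict hKm]
      exact (hDK i).mono_exponent (by simpa using (hp i).le))
    (fun i => (memLp_indicator_iff_restrict hKm).2 (hAK i))
    (fun i => (memLp_indicator_iff_restrict hKm).2 (hDK i)) (fun η hη => ?_)
    (fun i η hη => hu.integral_indicator hp hr hQ i hη) hΦ k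
  · have e : ∀ F G : (Fin n → ℝ) × ℝ → ℝ, (∀ z, z ∉ Q → F z = 0) → (∀ z ∈ Q, F z = G z) →
        ∫ z, F z = ∫ z in Q, G z := fun F G hF hFG => by
      rw [← setIntegral_eq_integral_of_forall_compl_eq_zero hF]
      exact setIntegral_congr_fun (isOpen_cyl).measurableSet hFG
    rw [e _ (fun z => max (u z - k) 0 ^ 2 / 2 * timeDeriv Φ z)
      (fun z hzQ => by rw [(hz hΦ z hzQ).2, mul_zero])
      (fun z hzQ => by rw [hi hzQ, htd hΦ])] at h
    rw [h]
    refine Finset.sum_congr rfl fun i _ => ?_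
    rw [e _ (fun z => flux p δ a z (fun j => Du j z) i *
          ((Ioi k).indicator 1 (u z) * Φ z * Du i z))
      (fun z hzQ => by rw [(hz hΦ z hzQ).1]; ring)
      (fun z hzQ => by simp only [hi hzQ]),
      e _ (fun z => flux p δ a z (fun j => Du j z) i *
          (max (u z - k) 0 * spaceDeriv i Φ z))
      (fun z hzQ => by rw [(hz hΦ z hzQ).2]; ring)
      (fun z hzQ => by simp only [hi hzQ, hsd hΦ])]
  · have h2 := (huK.mono_exponent hP2).integrable_norm_rpow (by simp) ENNReal.ofReal_ne_top
    rw [ENNReal.toReal_ofReal zero_le_two] at h2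
    have e : (fun z => K.indicator u z ^ 2) = K.indicator fun z => ‖u z‖ ^ (2 : ℝ) := by
      funext z
      by_cases hzK : z ∈ K
      · simp [indicator_of_mem hzK]
      · simp [indicator_of_notMem hzK]
    rw [e, integrable_indicator_iff hKm]
    exact h2
  · refine Eq.trans ?_ (hsol η (hη.mono (hQK.trans hQ)))
    rw [setIntegral_eq_integral_of_forall_compl_eq_zero]
    · congr with z
      by_cases hzQ : z ∈ Q
      · simp only [hi hzQ, htd hη, hsd hη]
      · simp [(hz hη z hzQ).2, htd hη, hsd hη]
    · intro z hzs
      have hzQ : z ∉ Q := fun h => hzs (hQ (hQK h))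
      simp [(hz hη z hzQ).2, htd hη, hsd hη]

end Localization

/-! ### Decreasing cut-offs in time -/

section TimeCutoff

open Filter
open scoped Topology

/-- The smooth decreasing function `s ↦ ∫_s^∞ φ(t - τ) dτ`. -/
def timeCutoff (φ : ContDiffBump (0 : ℝ)) (t s : ℝ) : ℝ :=
  ∫ τ in s..(t + φ.rOut), φ.normed volume (t - τ)

variable (φ : ContDiffBump (0 : ℝ)) (t : ℝ)

/-- The derivative is minus a mollification kernel, so testing with this cut-off makes a time
mollification, evaluated at `t`, appear. -/
theorem hasDerivAt_timeCutoff (s : ℝ) :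
    HasDerivAt (timeCutoff φ t) (-φ.normed volume (t - s)) s := by
  have hc : Continuous fun τ => φ.normed volume (t - τ) :=
    φ.continuous_normed.comp (continuous_const.sub continuous_id)
  exact intervalIntegral.integral_hasDerivAt_left (hc.intervalIntegrable _ _)
    (hc.stronglyMeasurableAtFilter _ _) hc.continuousAt

theorem contDiff_timeCutoff : ContDiff ℝ ∞ (timeCutoff φ t) := by
  rw [contDiff_infty_iff_deriv]
  refine ⟨fun s => (hasDerivAt_timeCutoff φ t s).differentiableAt, ?_⟩
  rw [show deriv (timeCutoff φ t) = fun s => -φ.normed volume (t - s) from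
    funext fun s => (hasDerivAt_timeCutoff φ t s).deriv]
  exact (φ.contDiff_normed.comp (contDiff_const.sub contDiff_id)).neg

theorem antitone_timeCutoff : Antitone (timeCutoff φ t) := by
  refine antitone_of_deriv_nonpos
    (fun s => (hasDerivAt_timeCutoff φ t s).differentiableAt) fun s => ?_
  rw [(hasDerivAt_timeCutoff φ t s).deriv]
  exact neg_nonpos.2 (φ.nonneg_normed _)

theorem normed_sub_eq_zero {s : ℝ} (hs : φ.rOut ≤ |t - s|) : φ.normed volume (t - s) = 0 := by
  rw [← Function.notMem_support, φ.support_normed_eq, Metric.mem_ball, Real.dist_eq, sub_zero]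
  exact not_lt.2 hs

theorem timeCutoff_eq_zero {s : ℝ} (hs : t + φ.rOut ≤ s) : timeCutoff φ t s = 0 := by
  rw [timeCutoff, intervalIntegral.integral_congr (g := fun _ => (0 : ℝ)) fun τ hτ => ?_,
    intervalIntegral.integral_zero]
  rw [uIcc_of_ge hs] at hτ
  refine normed_sub_eq_zero φ t ?_
  rw [abs_sub_comm]
  exact le_trans (by linarith [hτ.1]) (le_abs_self _)

theorem timeCutoff_eq_one {s : ℝ} (hs : s ≤ t - φ.rOut) : timeCutoff φ t s = 1 := by
  rw [timeCutoff, intervalIntegral.integral_eq_integral_of_support_subset,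
    integral_sub_left_eq_self (fun τ => φ.normed volume τ) volume t, φ.integral_normed]
  intro τ hτ
  by_contra hne
  refine hτ (normed_sub_eq_zero φ t ?_)
  by_contra hlt
  rw [not_le, abs_lt] at hlt
  exact hne ⟨by linarith [hlt.2], by linarith [hlt.1]⟩

theorem timeCutoff_mem_Icc (s : ℝ) : timeCutoff φ t s ∈ Icc (0 : ℝ) 1 := by
  constructor
  · rw [← timeCutoff_eq_zero φ t (le_max_right s (t + φ.rOut))]
    exact antitone_timeCutoff φ t (le_max_left _ _)
  · rw [← timeCutoff_eq_one φ t (min_le_right s (t - φ.rOut))]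
    exact antitone_timeCutoff φ t (min_le_left _ _)

end TimeCutoff

/-! ### Properties of the cut-off functions -/

section CutoffProperties

open Function

variable {n : ℕ} {p : Fin n → ℝ} {x₀ : Fin n → ℝ} {t₀ r : ℝ} {ζ : (Fin n → ℝ) × ℝ → ℝ}

/-- A cut-off function as a function of the `i`-th variable, and its derivatives. -/
theorem IsCutoff.exists_factor (hζ : IsCutoff p x₀ t₀ r ζ) (hp : ∀ i, 1 < p i) (i : Fin n) :
    ∃ c d e : (Fin n → ℝ) × ℝ → ℝ, Continuous c ∧ Continuous d ∧ (∀ z, 0 ≤ c z) ∧ (∀ z, 0 ≤ e z) ∧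
      ∀ z, ζ z = c z * e z ^ p i ∧ spaceDeriv i ζ z = c z * (d z * p i * e z ^ (p i - 1)) ∧
        spaceDeriv i (fun y => ζ y ^ (1 / p i)) z = c z ^ (1 / p i) * d z := by
  obtain ⟨-, ε, ψ, η, -, -, hψc, hψI, -, -, -, hη, hζe⟩ := hζ
  have hpi : 0 < p i := by linarith [hp i]
  set c : (Fin n → ℝ) × ℝ → ℝ := fun z =>
    ψ z.2 * ∏ m ∈ Finset.univ.erase i, η m (z.1 m) ^ p m with hc
  have hc0 : ∀ z, 0 ≤ c z := fun z =>
    mul_nonneg (hψI _).1 (Finset.prod_nonneg fun m _ => Real.rpow_nonneg ((hη m).2.1 _).1 _)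
  have hupd : ∀ z s, ζ (update z.1 i s, z.2) = c z * η i s ^ p i := fun z s => by
    simp only [hζe, hc]
    rw [← Finset.mul_prod_erase Finset.univ _ (Finset.mem_univ i), update_self]
    have : ∏ m ∈ Finset.univ.erase i, η m (update z.1 i s m) ^ p m =
        ∏ m ∈ Finset.univ.erase i, η m (z.1 m) ^ p m :=
      Finset.prod_congr rfl fun m hm => by rw [update_of_ne (Finset.ne_of_mem_erase hm)]
    rw [this]; ring
  have hηd : ∀ s, HasDerivAt (η i) (deriv (η i) s) s := fun s =>
    ((hη i).1.differentiable (by simp)).differentiableAt.hasDerivAt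
  refine ⟨c, fun z => deriv (η i) (z.1 i), fun z => η i (z.1 i), ?_, ?_, hc0,
    fun z => ((hη i).2.1 _).1, fun z => ⟨?_, ?_, ?_⟩⟩
  · refine (hψc.continuous.comp continuous_snd).mul (continuous_finsetProd _ fun m _ => ?_)
    exact ((hη m).1.continuous.comp ((continuous_apply m).comp continuous_fst)).rpow_const
      fun z => Or.inr (by linarith [hp m])
  · exact ((hη i).1.continuous_deriv (by simp)).comp ((continuous_apply i).comp continuous_fst)
  · have := hupd z (z.1 i)
    rwa [update_eq_self] at this
  · have h1 : HasDerivAt (fun s => c z * η i s ^ p i) _ (z.1 i) :=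
      ((hηd (z.1 i)).rpow_const (Or.inr (hp i).le)).const_mul (c z)
    unfold spaceDeriv partialDeriv
    simp only [hupd]
    exact h1.deriv
  · have h1 : HasDerivAt (fun s => c z ^ (1 / p i) * η i s) _ (z.1 i) :=
      (hηd (z.1 i)).const_mul (c z ^ (1 / p i))
    unfold spaceDeriv partialDeriv
    have e : (fun s => ζ (update z.1 i s, z.2) ^ (1 / p i)) =
        fun s => c z ^ (1 / p i) * η i s := by
      funext s
      rw [hupd, Real.mul_rpow (hc0 z) (Real.rpow_nonneg ((hη i).2.1 s).1 _),
        ← Real.rpow_mul ((hη i).2.1 s).1, mul_one_div_cancel hpi.ne', Real.rpow_one]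
    rw [e]
    exact h1.deriv

theorem IsCutoff.mem_Icc (hζ : IsCutoff p x₀ t₀ r ζ) (hp : ∀ i, 1 < p i)
    (z : (Fin n → ℝ) × ℝ) : 0 ≤ ζ z ∧ ζ z ≤ 1 := by
  obtain ⟨-, ε, ψ, η, -, -, -, hψI, -, -, -, hη, hζe⟩ := hζ
  rw [show z = (z.1, z.2) from rfl, hζe]
  have h0 : 0 ≤ ∏ i, η i (z.1 i) ^ p i :=
    Finset.prod_nonneg fun i _ => Real.rpow_nonneg ((hη i).2.1 _).1 _
  have h1 : ∏ i, η i (z.1 i) ^ p i ≤ 1 :=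
    Finset.prod_le_one (fun i _ => Real.rpow_nonneg ((hη i).2.1 _).1 _) fun i _ =>
      Real.rpow_le_one ((hη i).2.1 _).1 ((hη i).2.1 _).2 (by linarith [hp i])
  exact ⟨mul_nonneg (hψI _).1 h0, mul_le_one₀ (hψI _).2 h0 h1⟩

theorem IsCutoff.timeDeriv_nonneg (hζ : IsCutoff p x₀ t₀ r ζ) (z : (Fin n → ℝ) × ℝ) :
    0 ≤ timeDeriv ζ z := by
  obtain ⟨-, ε, ψ, η, -, -, -, -, hψm, -, -, hη, hζe⟩ := hζ
  refine Monotone.deriv_nonneg fun s t hst => ?_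
  simp only [hζe]
  exact mul_le_mul_of_nonneg_right (hψm hst)
    (Finset.prod_nonneg fun i _ => Real.rpow_nonneg ((hη i).2.1 _).1 _)

/-- A cut-off function of the cylinder vanishes near its lateral boundary and its bottom but need
not vanish at its top t₀; the factor θ supplies the missing compact support in time. -/
theorem IsCutoff.isTestFunction_mul (hζ : IsCutoff p x₀ t₀ r ζ) (hp : ∀ i, 1 < p i) {θ : ℝ → ℝ}
    (hθ : ContDiff ℝ ∞ θ) {b : ℝ} (hb : b < t₀) (hθb : ∀ s, b ≤ s → θ s = 0) :
    IsTestFunction (cyl p x₀ t₀ r) fun z => ζ z * θ z.2 := by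
  have hc := hζ.1
  obtain ⟨-, ε, ψ, η, hε, -, -, -, -, hψ0, -, hη, hζe⟩ := hζ
  set S : Set ((Fin n → ℝ) × ℝ) :=
    (univ.pi fun i => tsupport (η i)) ×ˢ Icc (t₀ - r + ε / 2) b with hS
  have hSc : IsCompact S := (isCompact_univ_pi fun i => (hη i).2.2.1.isCompact).prod isCompact_Icc
  have hsub : tsupport (fun z => ζ z * θ z.2) ⊆ S := by
    refine closure_minimal (fun z hz => ?_) hSc.isClosed
    have h1 : ζ z ≠ 0 := left_ne_zero_of_mul hz
    have h2 : θ z.2 ≠ 0 := right_ne_zero_of_mul hz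
    rw [show z = (z.1, z.2) from rfl, hζe] at h1
    refine ⟨fun i _ => subset_tsupport _ fun h0 => ?_, ?_, ?_⟩
    · refine right_ne_zero_of_mul h1 (Finset.prod_eq_zero (Finset.mem_univ i) ?_)
      rw [h0, Real.zero_rpow (by linarith [hp i])]
    · by_contra hlt
      exact left_ne_zero_of_mul h1 (hψ0 _ (not_le.1 hlt).le)
    · by_contra hlt
      exact h2 (hθb _ (not_le.1 hlt).le)
  refine ⟨hc.mul (hθ.comp contDiff_snd), hSc.of_isClosed_subset (isClosed_tsupport _) hsub,
    hsub.trans (prod_mono (pi_mono fun i _ => (hη i).2.2.2) fun t ht => ⟨?_, ?_⟩)⟩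
  · linarith [ht.1]
  · linarith [ht.2]

end CutoffProperties

/-! ### Young's inequality adapted to the cut-off functions -/

section Young

/-- No convexity is needed: if Y ≤ εX the first term suffices, and otherwise X ≤ Y/ε and the second
does. -/
theorem young_rpow_mul {p ε X Y : ℝ} (hp : 1 < p) (hε : 0 < ε) (hX : 0 ≤ X) (hY : 0 ≤ Y) :
    X ^ (p - 1) * Y ≤ ε * X ^ p + (1 / ε) ^ (p - 1) * Y ^ p := by
  have hadd : ∀ {x : ℝ}, 0 ≤ x → x ^ (p - 1) * x = x ^ p := fun {x} hx => by
    have := Real.rpow_add_of_nonneg hx (by linarith : 0 ≤ p - 1) zero_le_one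
    rw [Real.rpow_one, sub_add_cancel] at this
    exact this.symm
  rcases le_total Y (ε * X) with h | h
  · have h1 : X ^ (p - 1) * Y ≤ X ^ (p - 1) * (ε * X) := by gcongr
    have h2 : X ^ (p - 1) * (ε * X) = ε * X ^ p := by rw [← hadd hX]; ring
    have h3 : 0 ≤ (1 / ε) ^ (p - 1) * Y ^ p := by positivity
    linarith
  · have h1 : X ≤ 1 / ε * Y := by
      rw [one_div_mul_eq_div, le_div_iff₀ hε]; linarith
    have h2 : X ^ (p - 1) * Y ≤ (1 / ε * Y) ^ (p - 1) * Y := by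
      gcongr
    have h3 : (1 / ε * Y) ^ (p - 1) * Y = (1 / ε) ^ (p - 1) * Y ^ p := by
      rw [Real.mul_rpow (by positivity) hY, ← hadd hY]; ring
    have h4 : 0 ≤ ε * X ^ p := by positivity
    linarith

/-- The space derivative of ζ = c e^p is c d p e^{p-1}. Splitting c = (c^{1/p})^{p-1} c^{1/p}
exhibits the product as X^{p-1}Y with X = v c^{1/p} e and Y = w|c^{1/p} d|, where X^p restores the
full cut-off and Y involves only the derivative of ζ^{1/p}. -/
theorem young_cutoff {p Λ v w c d e : ℝ} (hp : 1 < p) (hΛ : 0 < Λ) (hv : 0 ≤ v) (hw : 0 ≤ w)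
    (hc : 0 ≤ c) (he : 0 ≤ e) :
    Λ * v ^ (p - 1) * (w * |c * (d * p * e ^ (p - 1))|) ≤
      1 / (2 * Λ) * (v ^ p * (c * e ^ p)) +
        Λ * p * (2 * Λ ^ 2 * p) ^ (p - 1) * (w ^ p * |c ^ (1 / p) * d| ^ p) := by
  have hp0 : 0 < p := by linarith
  -- After multiplication by Λp this ε becomes 1/(2Λ), half of the ellipticity constant.
  have hε : 0 < 1 / (2 * Λ ^ 2 * p) := by positivity
  have h := young_rpow_mul hp hε (X := v * c ^ (1 / p) * e) (Y := w * |c ^ (1 / p) * d|)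
    (by positivity) (by positivity)
  rw [one_div_one_div] at h
  have hcc : (c ^ (1 / p)) ^ (p - 1) * c ^ (1 / p) = c := by
    have := Real.rpow_add_of_nonneg (Real.rpow_nonneg hc (1 / p)) (by linarith : 0 ≤ p - 1)
      zero_le_one
    rw [Real.rpow_one] at this
    rw [← this, sub_add_cancel, ← Real.rpow_mul hc, one_div_mul_cancel hp0.ne', Real.rpow_one]
  have hcp : (c ^ (1 / p)) ^ p = c := by
    rw [← Real.rpow_mul hc, one_div_mul_cancel hp0.ne', Real.rpow_one]
  have e1 : Λ * v ^ (p - 1) * (w * |c * (d * p * e ^ (p - 1))|) =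
      Λ * p * ((v * c ^ (1 / p) * e) ^ (p - 1) * (w * |c ^ (1 / p) * d|)) := by
    rw [Real.mul_rpow (by positivity) he, Real.mul_rpow hv (by positivity), abs_mul, abs_mul,
      abs_mul, abs_mul, abs_of_nonneg hc, abs_of_pos hp0,
      abs_of_nonneg (Real.rpow_nonneg he _), abs_of_nonneg (Real.rpow_nonneg hc _)]
    conv_lhs => rw [← hcc]
    ring
  have e2 : (v * c ^ (1 / p) * e) ^ p = v ^ p * (c * e ^ p) := by
    rw [Real.mul_rpow (by positivity) he, Real.mul_rpow hv (by positivity), hcp]; ring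
  rw [e1]
  calc _ ≤ Λ * p * (1 / (2 * Λ ^ 2 * p) * (v * c ^ (1 / p) * e) ^ p +
        (2 * Λ ^ 2 * p) ^ (p - 1) * (w * |c ^ (1 / p) * d|) ^ p) := by gcongr
    _ = _ := by
      rw [e2, Real.mul_rpow hw (abs_nonneg _)]
      have : Λ * p * (1 / (2 * Λ ^ 2 * p)) = 1 / (2 * Λ) := by field_simp
      rw [mul_add, ← mul_assoc, this]
      ring

end Young

/-! ### Coercivity of the flux -/

section FluxBound

variable {n : ℕ} {p δ : Fin n → ℝ} {a : Fin n → (Fin n → ℝ) × ℝ → ℝ} {Λ : ℝ}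

/-- The flux times ξ_i is a_i v^{p_i - 1}|ξ_i| with v = (|ξ_i| - δ_i)₊, and v ≤ |ξ_i| since δ_i ≥ 0.
-/
theorem le_flux_mul {z : (Fin n → ℝ) × ℝ} {ξ : Fin n → ℝ} {i : Fin n} (hp : 1 < p i)
    (hδ : 0 ≤ δ i) (hΛ : 0 < Λ) (ha : Λ⁻¹ ≤ a i z) :
    Λ⁻¹ * max (|ξ i| - δ i) 0 ^ p i ≤ flux p δ a z ξ i * ξ i := by
  have hv : 0 ≤ max (|ξ i| - δ i) 0 := le_max_right _ _
  have hvξ : max (|ξ i| - δ i) 0 ≤ |ξ i| := max_le (by linarith) (abs_nonneg _)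
  have e : flux p δ a z ξ i * ξ i = a i z * (max (|ξ i| - δ i) 0 ^ (p i - 1) * |ξ i|) := by
    have : ξ i / |ξ i| * ξ i = |ξ i| := by
      rcases eq_or_ne (ξ i) 0 with h | h
      · simp [h]
      · have h' : |ξ i| ≠ 0 := abs_ne_zero.2 h
        rw [div_mul_eq_mul_div, div_eq_iff h', ← sq, ← sq, sq_abs]
    rw [flux, mul_assoc, mul_assoc, this]
  have hadd : max (|ξ i| - δ i) 0 ^ p i =
      max (|ξ i| - δ i) 0 ^ (p i - 1) * max (|ξ i| - δ i) 0 := by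
    have := Real.rpow_add_of_nonneg hv (by linarith : 0 ≤ p i - 1) zero_le_one
    rwa [Real.rpow_one, sub_add_cancel] at this
  rw [e, hadd]
  have ha0 : 0 ≤ a i z := (inv_nonneg.2 hΛ.le).trans ha
  gcongr

/-- The coercivity of the equation, with the terms of lower order absorbed. -/
theorem flux_cutoff_lower_bound {z : (Fin n → ℝ) × ℝ} {ξ : Fin n → ℝ} {i : Fin n} (hp : 1 < p i)
    (hδ : 0 ≤ δ i) (hΛ : 0 < Λ) (ha : Λ⁻¹ ≤ a i z) (ha' : a i z ≤ Λ) {s k θ c d e : ℝ}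
    (hθ : 0 ≤ θ) (hθ1 : θ ≤ 1) (hc : 0 ≤ c) (he : 0 ≤ e) :
    1 / (2 * Λ) * ((Ioi k).indicator 1 s * (max (|ξ i| - δ i) 0 ^ p i * (c * e ^ p i)) * θ) -
        Λ * p i * (2 * Λ ^ 2 * p i) ^ (p i - 1) *
          (max (s - k) 0 ^ p i * |c ^ (1 / p i) * d| ^ p i) ≤
      flux p δ a z ξ i * ((Ioi k).indicator 1 s * (c * e ^ p i * θ) * ξ i) +
        flux p δ a z ξ i * (max (s - k) 0 * (c * (d * p i * e ^ (p i - 1)) * θ)) := by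
  have hpi : 0 < p i := by linarith
  by_cases hs : k < s
  · rw [indicator_of_mem (by exact hs), Pi.one_apply]
    have hw : 0 ≤ max (s - k) 0 := le_max_right _ _
    have hv : 0 ≤ max (|ξ i| - δ i) 0 := le_max_right _ _
    have hΛ' : 0 < Λ⁻¹ := by positivity
    have hY := young_cutoff (d := d) hp hΛ hv hw hc he
    have hlow := le_flux_mul (ξ := ξ) hp hδ hΛ ha
    have hup := abs_flux_le (p := p) (δ := δ) (ξ := ξ) (a := a) (Λ := Λ) (z := z) (i := i)
      (by rw [abs_of_nonneg (hΛ'.le.trans ha)]; exact ha')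
    set F := flux p δ a z ξ i with hF
    set v := max (|ξ i| - δ i) 0 with hvdef
    set w := max (s - k) 0 with hwdef
    set G := c * (d * p i * e ^ (p i - 1)) with hG
    have hce : 0 ≤ c * e ^ p i := by positivity
    have h1 : Λ⁻¹ * v ^ p i * (c * e ^ p i * θ) ≤ F * ξ i * (c * e ^ p i * θ) :=
      mul_le_mul_of_nonneg_right hlow (by positivity)
    have h2 : -(Λ * v ^ (p i - 1) * (w * |G|)) ≤ F * (w * G) := by
      refine neg_le_of_abs_le ?_
      rw [abs_mul, abs_mul, abs_of_nonneg hw]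
      gcongr
    set C := Λ * p i * (2 * Λ ^ 2 * p i) ^ (p i - 1) * (w ^ p i * |c ^ (1 / p i) * d| ^ p i)
      with hC
    have hC0 : 0 ≤ C := by positivity
    have h3 : -(1 / (2 * Λ) * (v ^ p i * (c * e ^ p i)) + C) * θ ≤ F * (w * G) * θ := by
      refine mul_le_mul_of_nonneg_right (le_trans ?_ h2) hθ
      linarith
    have h4 : C * θ ≤ C := mul_le_of_le_one_right hC0 hθ1
    -- One half of the coercive term absorbs the Young term, the other half is the lower bound.
    have h5 : Λ⁻¹ = 1 / (2 * Λ) + 1 / (2 * Λ) := by field_simp; norm_num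
    rw [h5] at h1
    linarith
  · rw [indicator_of_notMem (by exact hs), max_eq_right (by linarith : s - k ≤ 0),
      Real.zero_rpow hpi.ne']
    simp

end FluxBound

/-! ### The energy inequality for local weak solutions -/

section Caccioppoli

open Filter
open scoped Topology

variable {n : ℕ} {p δ : Fin n → ℝ} {Ω : Set (Fin n → ℝ)} {T : ℝ} {u : (Fin n → ℝ) × ℝ → ℝ}
  {Du : Fin n → (Fin n → ℝ) × ℝ → ℝ} {x₀ : Fin n → ℝ} {t₀ r : ℝ}
  {a : Fin n → (Fin n → ℝ) × ℝ → ℝ} {Λ : ℝ}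

/-- The integrability of the terms of the energy inequality. -/
theorem integrableOn_energy_terms (hp : ∀ i, 1 < p i) (hδ : ∀ i, 0 ≤ δ i)
    (hu : MemSobolevLoc p Ω T u Du) (huP : MemLpLoc u (ENNReal.ofReal (bigP p)) (spaceTime Ω T))
    (ham : ∀ i, AEMeasurable (a i) (volume.restrict (spaceTime Ω T)))
    (ha : ∀ i, ∀ᵐ z ∂(volume.restrict (spaceTime Ω T)), |a i z| ≤ Λ)
    {K : Set ((Fin n → ℝ) × ℝ)} (hKc : IsCompact K) (hK : K ⊆ spaceTime Ω T) (k : ℝ) :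
    IntegrableOn (fun z => max (u z - k) 0 ^ 2) K ∧ ∀ i,
      IntegrableOn (fun z => max (u z - k) 0 ^ p i) K ∧
      IntegrableOn (fun z => (Ioi k).indicator 1 (u z) * max (|Du i z| - δ i) 0 ^ p i) K ∧
      IntegrableOn (fun z => flux p δ a z (fun j => Du j z) i *
        ((Ioi k).indicator 1 (u z) * Du i z)) K ∧
      IntegrableOn (fun z => flux p δ a z (fun j => Du j z) i * max (u z - k) 0) K := by
  have : IsFiniteMeasure (volume.restrict K) := ⟨by simpa using hKc.measure_lt_top⟩
  have huK := huP K hKc hK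
  have hum := huK.1.aemeasurable
  have hw : MemLp (fun z => max (u z - k) 0) (ENNReal.ofReal (bigP p)) (volume.restrict K) := by
    refine (huK.sub (memLp_const k)).of_le
      ((hum.sub_const k).max aemeasurable_const).aestronglyMeasurable
      (Eventually.of_forall fun z => ?_)
    rw [Real.norm_eq_abs, abs_of_nonneg (le_max_right _ _)]
    exact max_le (le_abs_self _) (abs_nonneg _)
  have hwr : ∀ s : ℝ, 0 < s → s ≤ bigP p → IntegrableOn (fun z => max (u z - k) 0 ^ s) K :=
    fun s hs0 hs => by
    have h := (hw.mono_exponent (ENNReal.ofReal_le_ofReal hs)).integrable_norm_rpow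
      (by simpa using hs0) ENNReal.ofReal_ne_top
    rw [ENNReal.toReal_ofReal hs0.le] at h
    refine h.congr (Eventually.of_forall fun z => ?_)
    simp only [Real.norm_eq_abs, abs_of_nonneg (le_max_right (u z - k) 0)]
  have hS : AEStronglyMeasurable (fun z => (Ioi k).indicator (1 : ℝ → ℝ) (u z))
      (volume.restrict K) :=
    ((measurable_one.indicator measurableSet_Ioi).comp_aemeasurable hum).aestronglyMeasurable
  have hS1 : ∀ z, ‖(Ioi k).indicator (1 : ℝ → ℝ) (u z)‖ ≤ 1 := fun z => by
    by_cases h : u z ∈ Ioi k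
    · rw [indicator_of_mem h]; simp
    · rw [indicator_of_notMem h]; simp
  refine ⟨by simpa using hwr 2 two_pos (le_max_left _ _), fun i => ?_⟩
  have hpi : 0 < p i := by linarith [hp i]
  have hD := (hu.2 i).1 K hKc hK
  have hA := memLp_flux (hp i) (hδ i) ((ham i).mono_measure (Measure.restrict_mono hK le_rfl))
    (ae_restrict_of_ae_restrict_of_subset hK (ha i)) hD
  have : (ENNReal.ofReal (p i).conjExponent).HolderTriple (ENNReal.ofReal (p i)) 1 :=
    (Real.HolderConjugate.conjExponent (hp i)).symm.ennrealOfReal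
  refine ⟨hwr _ hpi (le_bigP i), ?_, ?_, ?_⟩
  · have h := hD.integrable_norm_rpow (by simpa using hpi) ENNReal.ofReal_ne_top
    rw [ENNReal.toReal_ofReal hpi.le] at h
    have h2 : Integrable (fun z => max (|Du i z| - δ i) 0 ^ p i) (volume.restrict K) := by
      refine h.mono' ?_ (Eventually.of_forall fun z => ?_)
      · exact ((((measurable_norm.comp_aemeasurable hD.1.aemeasurable).sub_const (δ i)).max
          aemeasurable_const).pow_const _).aestronglyMeasurable
      · rw [Real.norm_eq_abs, abs_of_nonneg (Real.rpow_nonneg (le_max_right _ _) _)]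
        exact Real.rpow_le_rpow (le_max_right _ _)
          (max_le (by linarith [hδ i, Real.norm_eq_abs (Du i z)]) (norm_nonneg _)) hpi.le
    exact h2.bdd_mul hS (Eventually.of_forall hS1)
  · have h := (hA.integrable_mul hD).bdd_mul hS (Eventually.of_forall hS1)
    refine h.congr (Eventually.of_forall fun z => ?_)
    simp only [Pi.mul_apply]; ring
  · exact hA.integrable_mul (hw.mono_exponent (ENNReal.ofReal_le_ofReal (le_bigP i)))

/-- The Caccioppoli inequality with a cut-off in time. -/
theorem integral_caccioppoli (hp : ∀ i, 1 < p i) (hδ : ∀ i, 0 ≤ δ i) (hΛ : 0 < Λ)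
    (hu : MemSobolevLoc p Ω T u Du) (huP : MemLpLoc u (ENNReal.ofReal (bigP p)) (spaceTime Ω T))
    (ham : ∀ i, AEMeasurable (a i) (volume.restrict (spaceTime Ω T)))
    (ha : ∀ i, ∀ᵐ z ∂(volume.restrict (spaceTime Ω T)), Λ⁻¹ ≤ a i z ∧ a i z ≤ Λ)
    (hsol : ∀ φ, IsTestFunction (spaceTime Ω T) φ → ∫ z in spaceTime Ω T,
      (u z * timeDeriv φ z - ∑ i, flux p δ a z (fun j => Du j z) i * spaceDeriv i φ z) = 0)
    (hr : 0 < r) (hQ : closure (cyl p x₀ t₀ r) ⊆ spaceTime Ω T)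
    {ζ : (Fin n → ℝ) × ℝ → ℝ} (hζ : IsCutoff p x₀ t₀ r ζ) (k : ℝ)
    (φ : ContDiffBump (0 : ℝ)) {t : ℝ} (ht : t + φ.rOut < t₀) :
    (∫ z in cyl p x₀ t₀ r, max (u z - k) 0 ^ 2 / 2 * (ζ z * φ.normed volume (t - z.2))) +
      1 / (2 * Λ) * (∑ i, ∫ z in cyl p x₀ t₀ r, (Ioi k).indicator 1 (u z) *
        max (|Du i z| - δ i) 0 ^ p i * (ζ z * timeCutoff φ t z.2)) ≤
    (∫ z in cyl p x₀ t₀ r, max (u z - k) 0 ^ 2 / 2 * timeDeriv ζ z) +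
      ∑ i, Λ * p i * (2 * Λ ^ 2 * p i) ^ (p i - 1) * ∫ z in cyl p x₀ t₀ r,
        max (u z - k) 0 ^ p i * |spaceDeriv i (fun y => ζ y ^ (1 / p i)) z| ^ p i := by
  have ha' : ∀ i, ∀ᵐ z ∂(volume.restrict (spaceTime Ω T)), |a i z| ≤ Λ := fun i => by
    filter_upwards [ha i] with z hz
    rw [abs_of_nonneg ((inv_nonneg.2 hΛ.le).trans hz.1)]
    exact hz.2
  set θ := timeCutoff φ t with hθ
  have hθc : ContDiff ℝ ∞ θ := contDiff_timeCutoff φ t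
  have hΦ := hζ.isTestFunction_mul hp hθc ht fun s hs => timeCutoff_eq_zero φ t hs
  have hid := integral_posPart_sq_mul_timeDeriv hp hδ hu huP ham ha' hsol hr hQ hΦ k
  have hKc := isCompact_closure_cyl (p := p) x₀ t₀ hr
  obtain ⟨hw2, hterms⟩ := integrableOn_energy_terms (Λ := Λ) hp hδ hu huP ham ha' hKc hQ k
  have hmul : ∀ {f g : (Fin n → ℝ) × ℝ → ℝ}, IntegrableOn f (closure (cyl p x₀ t₀ r)) →
      Continuous g → Integrable (fun z => f z * g z) (volume.restrict (cyl p x₀ t₀ r)) :=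
    fun hf hg => (hf.mul_continuousOn hg.continuousOn hKc).mono_set subset_closure
  have hζc : Continuous ζ := hζ.1.continuous
  have hθc' : Continuous fun z : (Fin n → ℝ) × ℝ => θ z.2 := hθc.continuous.comp continuous_snd
  have hφc : Continuous fun z : (Fin n → ℝ) × ℝ => φ.normed volume (t - z.2) :=
    φ.continuous_normed.comp (continuous_const.sub continuous_snd)
  have hζd : ∀ z, DifferentiableAt ℝ ζ z := fun z => hζ.1.differentiable (by simp) z
  have htdc : Continuous fun z => timeDeriv ζ z := by
    simp only [timeDeriv_eq_fderiv (hζd _)]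
    exact (hζ.1.continuous_fderiv (by simp)).clm_apply continuous_const
  -- The first term goes to the right-hand side of the energy inequality; the second, a kernel in
  -- time, becomes the square term at time `t`.
  have htd : ∀ z, timeDeriv (fun z => ζ z * θ z.2) z =
      timeDeriv ζ z * θ z.2 - ζ z * φ.normed volume (t - z.2) := fun z => by
    have h1 : DifferentiableAt ℝ (fun s => ζ (z.1, s)) z.2 :=
      (hζd (z.1, z.2)).comp z.2 (by fun_prop)
    have h2 := h1.hasDerivAt.fun_mul (hasDerivAt_timeCutoff φ t z.2)
    unfold timeDeriv
    rw [h2.deriv, hθ]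
    ring
  have hsd : ∀ i z, spaceDeriv i (fun z => ζ z * θ z.2) z = spaceDeriv i ζ z * θ z.2 := fun i z => by
    simp only [spaceDeriv, partialDeriv]
    exact deriv_mul_const_field _
  have hθI : ∀ s, 0 ≤ θ s ∧ θ s ≤ 1 := fun s => timeCutoff_mem_Icc φ t s
  -- the terms with the time derivative
  have hI1 : Integrable (fun z => max (u z - k) 0 ^ 2 / 2 * (timeDeriv ζ z * θ z.2))
      (volume.restrict (cyl p x₀ t₀ r)) := hmul (hw2.div_const 2) (htdc.mul hθc')
  have hI2 : Integrable (fun z => max (u z - k) 0 ^ 2 / 2 * (ζ z * φ.normed volume (t - z.2)))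
      (volume.restrict (cyl p x₀ t₀ r)) := hmul (hw2.div_const 2) (hζc.mul hφc)
  have hL : ∫ z in cyl p x₀ t₀ r, max (u z - k) 0 ^ 2 / 2 *
        timeDeriv (fun z => ζ z * θ z.2) z =
      (∫ z in cyl p x₀ t₀ r, max (u z - k) 0 ^ 2 / 2 * (timeDeriv ζ z * θ z.2)) -
        ∫ z in cyl p x₀ t₀ r, max (u z - k) 0 ^ 2 / 2 * (ζ z * φ.normed volume (t - z.2)) := by
    rw [← integral_sub hI1 hI2]
    congr with z
    rw [htd]; ring
  -- The monotonicity of ψ makes ∂_t ζ nonnegative, so θ ≤ 1 can be dropped.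
  have hL' : ∫ z in cyl p x₀ t₀ r, max (u z - k) 0 ^ 2 / 2 * (timeDeriv ζ z * θ z.2) ≤
      ∫ z in cyl p x₀ t₀ r, max (u z - k) 0 ^ 2 / 2 * timeDeriv ζ z := by
    refine integral_mono hI1 (hmul (hw2.div_const 2) htdc) fun z => ?_
    have h1 := hζ.timeDeriv_nonneg z
    have h2 : timeDeriv ζ z * θ z.2 ≤ timeDeriv ζ z := mul_le_of_le_one_right h1 (hθI _).2
    exact mul_le_mul_of_nonneg_left h2 (by positivity)
  -- the terms with the space derivatives
  have hR : ∀ i, 1 / (2 * Λ) * (∫ z in cyl p x₀ t₀ r, (Ioi k).indicator 1 (u z) *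
        max (|Du i z| - δ i) 0 ^ p i * (ζ z * θ z.2)) -
      Λ * p i * (2 * Λ ^ 2 * p i) ^ (p i - 1) * (∫ z in cyl p x₀ t₀ r,
        max (u z - k) 0 ^ p i * |spaceDeriv i (fun y => ζ y ^ (1 / p i)) z| ^ p i) ≤
      (∫ z in cyl p x₀ t₀ r, flux p δ a z (fun j => Du j z) i *
          ((Ioi k).indicator 1 (u z) * (ζ z * θ z.2) * Du i z)) +
        ∫ z in cyl p x₀ t₀ r, flux p δ a z (fun j => Du j z) i *
          (max (u z - k) 0 * spaceDeriv i (fun z => ζ z * θ z.2) z) := fun i => by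
    obtain ⟨hwp, hvp, hAD, hAw⟩ := hterms i
    obtain ⟨c, d, e, hcc, hdc, hc0, he0, hcde⟩ := hζ.exists_factor hp i
    have hpi : 0 < p i := by linarith [hp i]
    have hsdc : Continuous fun z => spaceDeriv i ζ z := by
      simp only [spaceDeriv_eq_fderiv (hζd _)]
      exact (hζ.1.continuous_fderiv (by simp)).clm_apply continuous_const
    have hrc : Continuous fun z => |spaceDeriv i (fun y => ζ y ^ (1 / p i)) z| ^ p i := by
      simp only [(hcde _).2.2]
      exact (((hcc.rpow_const fun z => Or.inr (by positivity)).mul hdc).abs).rpow_const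
        fun z => Or.inr hpi.le
    have hζθ : Continuous fun z => ζ z * θ z.2 := hζc.mul hθc'
    have hsθ : Continuous fun z => spaceDeriv i ζ z * θ z.2 := hsdc.mul hθc'
    have hJ1 : Integrable (fun z => flux p δ a z (fun j => Du j z) i *
        ((Ioi k).indicator 1 (u z) * (ζ z * θ z.2) * Du i z))
        (volume.restrict (cyl p x₀ t₀ r)) := by
      refine (hmul hAD hζθ).congr (Eventually.of_forall fun z => ?_)
      simp only; ring
    have hJ2 : Integrable (fun z => flux p δ a z (fun j => Du j z) i *
        (max (u z - k) 0 * spaceDeriv i (fun z => ζ z * θ z.2) z))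
        (volume.restrict (cyl p x₀ t₀ r)) := by
      refine (hmul hAw hsθ).congr (Eventually.of_forall fun z => ?_)
      simp only [hsd]; ring
    have hJ3 := hmul hvp hζθ
    have hJ4 := hmul hwp hrc
    rw [← integral_add hJ1 hJ2, ← integral_const_mul, ← integral_const_mul,
      ← integral_sub (hJ3.const_mul _) (hJ4.const_mul _)]
    refine integral_mono_ae ((hJ3.const_mul _).sub (hJ4.const_mul _)) (hJ1.add hJ2) ?_
    filter_upwards [ae_restrict_of_ae_restrict_of_subset (subset_closure.trans hQ) (ha i)]
      with z hz
    have h := flux_cutoff_lower_bound (ξ := fun j => Du j z) (k := k) (s := u z) (c := c z)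
      (d := d z) (e := e z) (θ := θ z.2) (hp i) (hδ i) hΛ hz.1 hz.2 (hθI _).1 (hθI _).2 (hc0 z)
      (he0 z)
    obtain ⟨h1, h2, h3⟩ := hcde z
    simp only [hsd]
    rw [h3, h2, h1]
    refine le_trans (le_of_eq ?_) h
    ring
  have hsum := Finset.sum_le_sum fun i (_ : i ∈ Finset.univ) => hR i
  rw [Finset.sum_sub_distrib, ← Finset.mul_sum, ← hid, hL] at hsum
  linarith

/-- The energy inequality for local weak solutions. -/
theorem energyInequality_posPart (hp : ∀ i, 1 < p i) (hδ : ∀ i, 0 ≤ δ i) (hΛ : 0 < Λ)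
    (hu : MemSobolevLoc p Ω T u Du) (huP : MemLpLoc u (ENNReal.ofReal (bigP p)) (spaceTime Ω T))
    (ham : ∀ i, AEMeasurable (a i) (volume.restrict (spaceTime Ω T)))
    (ha : ∀ i, ∀ᵐ z ∂(volume.restrict (spaceTime Ω T)), Λ⁻¹ ≤ a i z ∧ a i z ≤ Λ)
    (hsol : ∀ φ, IsTestFunction (spaceTime Ω T) φ → ∫ z in spaceTime Ω T,
      (u z * timeDeriv φ z - ∑ i, flux p δ a z (fun j => Du j z) i * spaceDeriv i φ z) = 0)
    (hr : 0 < r) (hQ : closure (cyl p x₀ t₀ r) ⊆ spaceTime Ω T)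
    {ζ : (Fin n → ℝ) × ℝ → ℝ} (hζ : IsCutoff p x₀ t₀ r ζ) (k : ℝ) :
    EnergyInequality p δ
      ((2 + 2 * Λ) * (1 + ∑ i, Λ * p i * (2 * Λ ^ 2 * p i) ^ (p i - 1))) x₀ t₀ r ζ Du
      (fun z => max (u z - k) 0) {z | k < u z} := by
  have hp0 : ∀ i, 0 < p i := fun i => by linarith [hp i]
  have ha' : ∀ i, ∀ᵐ z ∂(volume.restrict (spaceTime Ω T)), |a i z| ≤ Λ := fun i => by
    filter_upwards [ha i] with z hz
    rw [abs_of_nonneg ((inv_nonneg.2 hΛ.le).trans hz.1)]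
    exact hz.2
  have hKc := isCompact_closure_cyl (p := p) x₀ t₀ hr
  have hQm := measurableSet_cyl (p := p) x₀ t₀ r
  obtain ⟨hw2, hterms⟩ := integrableOn_energy_terms (Λ := Λ) hp hδ hu huP ham ha' hKc hQ k
  have hmul : ∀ {f g : (Fin n → ℝ) × ℝ → ℝ}, IntegrableOn f (closure (cyl p x₀ t₀ r)) →
      Continuous g → Integrable (fun z => f z * g z) (volume.restrict (cyl p x₀ t₀ r)) :=
    fun hf hg => (hf.mul_continuousOn hg.continuousOn hKc).mono_set subset_closure
  have hζc : Continuous ζ := hζ.1.continuous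
  have hζI := hζ.mem_Icc hp
  have htdc : Continuous fun z => timeDeriv ζ z := by
    simp only [timeDeriv_eq_fderiv (hζ.1.differentiable (by simp) _)]
    exact (hζ.1.continuous_fderiv (by simp)).clm_apply continuous_const
  have hrc : ∀ i, Continuous fun z => |spaceDeriv i (fun y => ζ y ^ (1 / p i)) z| ^ p i :=
    fun i => by
    obtain ⟨c, d, e, hcc, hdc, -, -, hcde⟩ := hζ.exists_factor hp i
    simp only [(hcde _).2.2]
    have := hp0 i
    exact (((hcc.rpow_const fun z => Or.inr (by positivity)).mul hdc).abs).rpow_const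
      fun z => Or.inr (hp0 i).le
  set C : Fin n → ℝ := fun i => Λ * p i * (2 * Λ ^ 2 * p i) ^ (p i - 1) with hC
  have hC0 : ∀ i, 0 ≤ C i := fun i => by have := hp0 i; positivity
  set R₁ := ∫ z in cyl p x₀ t₀ r, max (u z - k) 0 ^ 2 * timeDeriv ζ z with hR₁
  set R₂ : Fin n → ℝ := fun i => ∫ z in cyl p x₀ t₀ r,
    max (u z - k) 0 ^ p i * |spaceDeriv i (fun y => ζ y ^ (1 / p i)) z| ^ p i with hR₂
  have hR₁0 : 0 ≤ R₁ := integral_nonneg fun z => by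
    have := hζ.timeDeriv_nonneg z
    positivity
  have hR₂0 : ∀ i, 0 ≤ R₂ i := fun i => integral_nonneg fun z => by positivity
  set R := R₁ / 2 + ∑ i, C i * R₂ i with hR
  have hR0 : 0 ≤ R := add_nonneg (by positivity)
    (Finset.sum_nonneg fun i _ => mul_nonneg (hC0 i) (hR₂0 i))
  have hcacc : ∀ (φ : ContDiffBump (0 : ℝ)) (t : ℝ), t + φ.rOut < t₀ →
      (∫ z in cyl p x₀ t₀ r, max (u z - k) 0 ^ 2 / 2 * (ζ z * φ.normed volume (t - z.2))) +
      1 / (2 * Λ) * (∑ i, ∫ z in cyl p x₀ t₀ r, (Ioi k).indicator 1 (u z) *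
        max (|Du i z| - δ i) 0 ^ p i * (ζ z * timeCutoff φ t z.2)) ≤ R := fun φ t ht => by
    refine (integral_caccioppoli hp hδ hΛ hu huP ham ha hsol hr hQ hζ k φ ht).trans (le_of_eq ?_)
    rw [hR, hR₁, ← integral_div]
    congr 1
    congr with z
    ring
  have hS0 : ∀ z, 0 ≤ (Ioi k).indicator (1 : ℝ → ℝ) (u z) := fun z =>
    indicator_nonneg (fun _ _ => zero_le_one) _
  obtain ⟨φ, hφ, hφ'⟩ := exists_contDiffBump_seq ℝ
  -- the gradient terms
  have hgrad : ∑ i, ∫ z in cyl p x₀ t₀ r, (Ioi k).indicator 1 (u z) *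
      max (|Du i z| - δ i) 0 ^ p i * ζ z ≤ 2 * Λ * R := by
    -- The times t₀ - 2 rOut satisfy the constraint t + rOut < t₀ and tend to t₀, so the cut-offs
    -- equal 1 eventually at each point of the cylinder.
    have hlim : Tendsto (fun j => ∑ i, ∫ z in cyl p x₀ t₀ r, (Ioi k).indicator 1 (u z) *
        max (|Du i z| - δ i) 0 ^ p i *
          (ζ z * timeCutoff (φ j) (t₀ - 2 * (φ j).rOut) z.2)) atTop
        (𝓝 (∑ i, ∫ z in cyl p x₀ t₀ r, (Ioi k).indicator 1 (u z) *
          max (|Du i z| - δ i) 0 ^ p i * ζ z)) := by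
      refine tendsto_finsetSum _ fun i _ => ?_
      have hθc : ∀ j, Continuous fun z : (Fin n → ℝ) × ℝ =>
          timeCutoff (φ j) (t₀ - 2 * (φ j).rOut) z.2 := fun j =>
        (contDiff_timeCutoff _ _).continuous.comp continuous_snd
      refine tendsto_integral_of_dominated_convergence (fun z => (Ioi k).indicator 1 (u z) *
          max (|Du i z| - δ i) 0 ^ p i * ζ z)
        (fun j => (hmul (hterms i).2.1 (hζc.mul (hθc j))).1) (hmul (hterms i).2.1 hζc)
        (fun j => Eventually.of_forall fun z => ?_) ?_
      · have h1 := timeCutoff_mem_Icc (φ j) (t₀ - 2 * (φ j).rOut) z.2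
        have h2 := hS0 z
        have h3 : 0 ≤ max (|Du i z| - δ i) 0 ^ p i := Real.rpow_nonneg (le_max_right _ _) _
        have h4 := (hζI z).1
        rw [Real.norm_eq_abs, abs_of_nonneg
          (mul_nonneg (mul_nonneg h2 h3) (mul_nonneg h4 h1.1))]
        exact mul_le_mul_of_nonneg_left (mul_le_of_le_one_right h4 h1.2) (mul_nonneg h2 h3)
      · filter_upwards [ae_restrict_mem hQm] with z hz
        refine tendsto_const_nhds.congr' ?_
        have hzt : 0 < (t₀ - z.2) / 3 := by linarith [hz.2.2]
        filter_upwards [hφ.eventually (gt_mem_nhds hzt)] with j hj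
        rw [timeCutoff_eq_one, mul_one]
        linarith
    refine le_of_tendsto' hlim fun j => ?_
    have h1 := hcacc (φ j) (t₀ - 2 * (φ j).rOut) (by linarith [(φ j).rOut_pos])
    have h2 : 0 ≤ ∫ z in cyl p x₀ t₀ r, max (u z - k) 0 ^ 2 / 2 *
        (ζ z * (φ j).normed volume (t₀ - 2 * (φ j).rOut - z.2)) := integral_nonneg fun z =>
      mul_nonneg (by positivity) (mul_nonneg (hζI z).1 ((φ j).nonneg_normed _))
    have h3 : 1 / (2 * Λ) * (∑ i, ∫ z in cyl p x₀ t₀ r, (Ioi k).indicator 1 (u z) *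
        max (|Du i z| - δ i) 0 ^ p i *
          (ζ z * timeCutoff (φ j) (t₀ - 2 * (φ j).rOut) z.2)) ≤ R := by linarith
    rw [one_div_mul_eq_div, div_le_iff₀ (by positivity)] at h3
    linarith
  -- the essential supremum
  set f : (Fin n → ℝ) × ℝ → ℝ :=
    (cyl p x₀ t₀ r).indicator fun z => max (u z - k) 0 ^ 2 * ζ z with hf
  have hfI : Integrable f (volume.prod volume) :=
    (integrable_indicator_iff hQm).2 (hmul hw2 hζc)
  have hf0 : ∀ z, 0 ≤ f z := fun z => indicator_nonneg (fun z _ => by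
    have := (hζI z).1
    positivity) z
  set G : ℝ → ℝ := fun t => ∫ x, f (x, t) with hG
  have hGI : Integrable G := hfI.integral_prod_right
  -- By Fubini the kernel term of the Caccioppoli inequality is half of the mollification of `G`,
  -- the integral of (u - k)₊² ζ over the slice; the gradient term is dropped.
  have hGle : ∀ (φ : ContDiffBump (0 : ℝ)) (t : ℝ), t + φ.rOut < t₀ →
      mollify volume φ G t ≤ 2 * R := fun φ t ht => by
    have h1 := hcacc φ t ht
    have h2 : 0 ≤ 1 / (2 * Λ) * (∑ i, ∫ z in cyl p x₀ t₀ r, (Ioi k).indicator 1 (u z) *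
        max (|Du i z| - δ i) 0 ^ p i * (ζ z * timeCutoff φ t z.2)) :=
      mul_nonneg (by positivity) (Finset.sum_nonneg fun i _ => integral_nonneg fun z =>
        mul_nonneg (mul_nonneg (hS0 z) (Real.rpow_nonneg (le_max_right _ _) _))
          (mul_nonneg (hζI z).1 (timeCutoff_mem_Icc φ t _).1))
    obtain ⟨B, hB⟩ := φ.continuous_normed.bounded_above_of_compact_support
      (φ.hasCompactSupport_normed (μ := volume))
    have hint : Integrable (fun z : (Fin n → ℝ) × ℝ => φ.normed volume (t - z.2) * f z)
        (volume.prod volume) :=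
      hfI.bdd_mul (φ.continuous_normed.comp
        (continuous_const.sub continuous_snd)).aestronglyMeasurable
        (Eventually.of_forall fun z => hB _)
    have e : mollify volume φ G t =
        2 * ∫ z in cyl p x₀ t₀ r, max (u z - k) 0 ^ 2 / 2 * (ζ z * φ.normed volume (t - z.2)) := by
      rw [mollify_apply, hG]
      simp only [← integral_const_mul]
      rw [← integral_prod_symm _ hint, ← integral_indicator hQm, ← Measure.volume_eq_prod]
      congr with z
      by_cases hz : z ∈ cyl p x₀ t₀ r
      · rw [hf, indicator_of_mem hz, indicator_of_mem hz]; ring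
      · rw [hf, indicator_of_notMem hz, indicator_of_notMem hz, mul_zero]
    rw [e]
    linarith
  have hsup : essSup (fun τ : ℝ => ∫⁻ x in box p x₀ r,
      ENNReal.ofReal (max (u (x, τ) - k) 0 ^ 2 * ζ (x, τ)))
      (volume.restrict (Ioo (t₀ - r) t₀)) ≤ ENNReal.ofReal (2 * R) := by
    refine essSup_le_of_ae_le _ ?_
    filter_upwards [ae_restrict_of_ae (ae_tendsto_mollify hφ hφ' hGI.locallyIntegrable),
      ae_restrict_of_ae hfI.prod_left_ae, ae_restrict_mem measurableSet_Ioo] with t ht1 ht2 ht3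
    -- The bound on the mollifications passes to `G t` at almost every `t`, for radii smaller than
    -- t₀ - t.
    have hGt : G t ≤ 2 * R := by
      refine le_of_tendsto ht1 ?_
      filter_upwards [hφ.eventually (gt_mem_nhds (sub_pos.2 ht3.2))] with j hj
      exact hGle (φ j) t (by linarith)
    have e : ∫⁻ x in box p x₀ r, ENNReal.ofReal (max (u (x, t) - k) 0 ^ 2 * ζ (x, t)) =
        ENNReal.ofReal (G t) := by
      rw [hG, ofReal_integral_eq_lintegral_ofReal ht2 (Eventually.of_forall fun x => hf0 _),
        ← lintegral_indicator (measurableSet_box x₀ r)]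
      congr with x
      by_cases hx : x ∈ box p x₀ r
      · rw [indicator_of_mem hx, hf, indicator_of_mem (show (x, t) ∈ cyl p x₀ t₀ r from
          mk_mem_prod hx ht3)]
      · rw [indicator_of_notMem hx, hf, indicator_of_notMem (show (x, t) ∉ cyl p x₀ t₀ r
          from fun h => hx h.1), ENNReal.ofReal_zero]
    rw [e]
    exact ENNReal.ofReal_le_ofReal hGt
  -- conclusion
  have hS : ∀ z, {z | k < u z}.indicator (1 : (Fin n → ℝ) × ℝ → ℝ) z =
      (Ioi k).indicator (1 : ℝ → ℝ) (u z) := fun z => rfl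
  have hgi : ∀ i, ∫⁻ z in cyl p x₀ t₀ r, ENNReal.ofReal (max (|Du i z| - δ i) 0 ^ p i * ζ z *
      {z | k < u z}.indicator 1 z) = ENNReal.ofReal (∫ z in cyl p x₀ t₀ r,
        (Ioi k).indicator 1 (u z) * max (|Du i z| - δ i) 0 ^ p i * ζ z) := fun i => by
    rw [ofReal_integral_eq_lintegral_ofReal (hmul (hterms i).2.1 hζc)
      (Eventually.of_forall fun z => mul_nonneg (mul_nonneg (hS0 z)
        (Real.rpow_nonneg (le_max_right _ _) _)) (hζI z).1)]
    congr with z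
    rw [hS]; congr 1; ring
  have hg0 : ∀ i, 0 ≤ ∫ z in cyl p x₀ t₀ r, (Ioi k).indicator 1 (u z) *
      max (|Du i z| - δ i) 0 ^ p i * ζ z := fun i => integral_nonneg fun z =>
    mul_nonneg (mul_nonneg (hS0 z) (Real.rpow_nonneg (le_max_right _ _) _)) (hζI z).1
  have hr1 : ∫⁻ z in cyl p x₀ t₀ r, ENNReal.ofReal (max (u z - k) 0 ^ 2 * timeDeriv ζ z) =
      ENNReal.ofReal R₁ :=
    (ofReal_integral_eq_lintegral_ofReal (hmul hw2 htdc) (Eventually.of_forall fun z =>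
      mul_nonneg (by positivity) (hζ.timeDeriv_nonneg z))).symm
  have hr2 : ∀ i, ∫⁻ z in cyl p x₀ t₀ r, ENNReal.ofReal (max (u z - k) 0 ^ p i *
      |spaceDeriv i (fun y => ζ y ^ (1 / p i)) z| ^ p i) = ENNReal.ofReal (R₂ i) := fun i =>
    (ofReal_integral_eq_lintegral_ofReal (hmul (hterms i).1 (hrc i)) (Eventually.of_forall fun z =>
      by positivity)).symm
  unfold EnergyInequality
  simp only [hgi, hr1, hr2]
  have hCs : 0 ≤ ∑ i, C i := Finset.sum_nonneg fun i _ => hC0 i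
  have hR₂s : 0 ≤ ∑ i, R₂ i := Finset.sum_nonneg fun i _ => hR₂0 i
  rw [← ENNReal.ofReal_sum_of_nonneg fun i _ => hg0 i,
    ← ENNReal.ofReal_sum_of_nonneg fun i _ => hR₂0 i, ← ENNReal.ofReal_mul (by positivity),
    ← ENNReal.ofReal_mul (by positivity), ← ENNReal.ofReal_add (by positivity) (by positivity)]
  refine (add_le_add hsup (ENNReal.ofReal_le_ofReal hgrad)).trans ?_
  rw [← ENNReal.ofReal_add (by positivity) (by positivity)]
  apply ENNReal.ofReal_le_ofReal
  have hCR : ∑ i, C i * R₂ i ≤ (∑ i, C i) * ∑ i, R₂ i := by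
    rw [Finset.sum_mul]
    refine Finset.sum_le_sum fun i _ => mul_le_mul_of_nonneg_left ?_ (hC0 i)
    exact Finset.single_le_sum (fun j _ => hR₂0 j) (Finset.mem_univ i)
  have hfin : R ≤ (1 + ∑ i, C i) * (R₁ + ∑ i, R₂ i) := by
    rw [hR]
    nlinarith [mul_nonneg hCs hR₁0]
  -- The supremum term contributes 2R and the gradient terms 2ΛR.
  calc 2 * R + 2 * Λ * R = (2 + 2 * Λ) * R := by ring
    _ ≤ (2 + 2 * Λ) * ((1 + ∑ i, C i) * (R₁ + ∑ i, R₂ i)) := by gcongr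
    _ = _ := by ring

theorem flux_neg (z : (Fin n → ℝ) × ℝ) (ξ : Fin n → ℝ) (i : Fin n) :
    flux p δ a z (fun j => -ξ j) i = -flux p δ a z ξ i := by
  simp only [flux, abs_neg, neg_div, mul_neg]

/-- Local weak solutions belong to the De Giorgi classes. -/
theorem IsLocalWeakSolution.deGiorgiClass (hp : ∀ i, 1 < p i) (hδ : ∀ i, 0 ≤ δ i) (hΛ : 0 < Λ)
    (ham : ∀ i, AEMeasurable (a i) (volume.restrict (spaceTime Ω T)))
    (ha : ∀ i, ∀ᵐ z ∂(volume.restrict (spaceTime Ω T)), Λ⁻¹ ≤ a i z ∧ a i z ≤ Λ)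
    (hu : IsLocalWeakSolution p δ a Ω T u) :
    DeGiorgiClass p δ Ω T
      ((2 + 2 * Λ) * (1 + ∑ i, Λ * p i * (2 * Λ ^ 2 * p i) ^ (p i - 1))) u := by
  obtain ⟨huP, Du, hDu, hsol⟩ := hu
  refine ⟨huP, Du, hDu, fun x₀ t₀ r hr hQ ζ hζ k =>
    ⟨energyInequality_posPart hp hδ hΛ hDu huP ham ha hsol hr hQ hζ k, ?_⟩⟩
  -- The flux is odd in the gradient, so -u solves the same equation, and its upper truncation at
  -- level -k is the lower truncation of u at level k.
  have h := energyInequality_posPart hp hδ hΛ hDu.neg huP.neg ham ha (fun φ hφ => by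
    rw [← neg_eq_zero, ← integral_neg]
    refine Eq.trans ?_ (hsol φ hφ)
    congr with z
    simp only [flux_neg, neg_mul, Finset.sum_neg_distrib]
    ring) hr hQ hζ (-k)
  unfold EnergyInequality at h ⊢
  have e1 : ∀ z, max (-u z - -k) 0 = max (k - u z) 0 := fun z => by congr 1; ring
  have e2 : {z | -k < -u z} = {z | u z < k} := by
    ext z; simp only [mem_ofPred_eq, neg_lt_neg_iff]
  simpa only [e1, e2, abs_neg] using h

end Caccioppoli

end AnisoDiff

end

/-! ### The theorem -/

theorem mainTheorem8 (n : ℕ) (hn : 2 ≤ n) (p : Fin n → ℝ)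
    (hp : ∀ i, 1 < p i ∧ p i < AnisoDiff.harmonicAvg p * (1 + 2 / (n : ℝ)))
    (hpn : AnisoDiff.harmonicAvg p < n)
    (hsub : AnisoDiff.harmonicAvg p ≤ 2 * (n : ℝ) / ((n : ℝ) + 2))
    (m : ℝ)
    (hm : (n : ℝ) / AnisoDiff.harmonicAvg p * (2 - AnisoDiff.harmonicAvg p) < m) :
    (∀ (𝒞 δmax : ℝ), 0 < 𝒞 → ∃ C : ℝ, 0 < C ∧
      ∀ (δ : Fin n → ℝ), (∀ i, 0 ≤ δ i) → ⨆ i, δ i = δmax →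
      ∀ (Ω : Set (Fin n → ℝ)), IsOpen Ω → IsConnected Ω → Bornology.IsBounded Ω →
      ∀ (T : ℝ), 0 < T →
      ∀ (u : (Fin n → ℝ) × ℝ → ℝ), AnisoDiff.DeGiorgiClass p δ Ω T 𝒞 u →
        AnisoDiff.MemLpLoc u (ENNReal.ofReal m) (AnisoDiff.spaceTime Ω T) →
        AnisoDiff.MemLpLoc u ⊤ (AnisoDiff.spaceTime Ω T) ∧
          AnisoDiff.SupBound p m C Ω T u) ∧
    (∀ (Λ δmax : ℝ), 1 ≤ Λ → ∃ C : ℝ, 0 < C ∧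
      ∀ (δ : Fin n → ℝ), (∀ i, 0 ≤ δ i) → ⨆ i, δ i = δmax →
      ∀ (Ω : Set (Fin n → ℝ)), IsOpen Ω → IsConnected Ω → Bornology.IsBounded Ω →
      ∀ (T : ℝ), 0 < T →
      ∀ (a : Fin n → (Fin n → ℝ) × ℝ → ℝ),
        (∀ i, AEMeasurable (a i) (volume.restrict (AnisoDiff.spaceTime Ω T))) →
        (∀ i, ∀ᵐ z ∂(volume.restrict (AnisoDiff.spaceTime Ω T)), Λ⁻¹ ≤ a i z ∧ a i z ≤ Λ) →
      ∀ (u : (Fin n → ℝ) × ℝ → ℝ), AnisoDiff.IsLocalWeakSolution p δ a Ω T u →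
        AnisoDiff.MemLpLoc u (ENNReal.ofReal m) (AnisoDiff.spaceTime Ω T) →
        AnisoDiff.MemLpLoc u ⊤ (AnisoDiff.spaceTime Ω T) ∧
          AnisoDiff.SupBound p m C Ω T u) := by
  refine ⟨fun 𝒞 δmax h𝒞 => ?_, fun Λ δmax hΛ => ?_⟩
  · obtain ⟨C, hC, H⟩ := AnisoDiff.DeGiorgiClass.exists_supBound hn hp hpn hsub hm h𝒞 δmax
    exact ⟨C, hC, fun δ hδ hδm Ω hΩ _ _ T _ u hu hum => H δ hδ hδm Ω hΩ T u hu hum⟩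
  · have hΛ0 : 0 < Λ := by linarith
    -- The constant of the De Giorgi class depends only on Λ and the exponents, so part (2) inherits
    -- the stated dependence of `C` from part (1).
    have h𝒞 : 0 < (2 + 2 * Λ) * (1 + ∑ i, Λ * p i * (2 * Λ ^ 2 * p i) ^ (p i - 1)) := by
      have : 0 ≤ ∑ i, Λ * p i * (2 * Λ ^ 2 * p i) ^ (p i - 1) :=
        Finset.sum_nonneg fun i _ => by
          have : 0 < p i := by linarith [(hp i).1]
          positivity
      positivity
    obtain ⟨C, hC, H⟩ := AnisoDiff.DeGiorgiClass.exists_supBound hn hp hpn hsub hm h𝒞 δmax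
    exact ⟨C, hC, fun δ hδ hδm Ω hΩ _ _ T _ a ham ha u hu hum =>
      H δ hδ hδm Ω hΩ T u (hu.deGiorgiClass (fun i => (hp i).1) hδ hΛ0 ham ha) hum⟩
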